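/- **Setting.** Let $X$ be a random vector in $\mathbb R^d$ with law $\nu$, let $\beta_1,\dots,\beta_K\in\mathbb R^d$ ($K\ge1$) be unknown, $c_k(x)=\beta_k^\top x$, and let $p$ be a probability vector on $\{1,\dots,K\}$. Let $g^*\in\mathbb R^K$ maximize $g\mapsto \mathbb E\big(\min_j (c_j(X)-g_j)\big)+p^\top g$, put $\pi^*(x)=\arg\min_j (c_j(x)-g^*_j)$ and $Z_{j,k}=(c_j(X)-g^*_j)-(c_k(X)-g^*_k)$. Here $\arg\min$ is made single-valued by any fixed measurable convention for ties. **Assumptions**, with constants $\kappa_1,\dots,\kappa_8>0$. (1) For $j\ne k$ the law of $c_j(X)-c_k(X)$ is absolutely continuous. (2) For $j\neq k$, $Z_{j,k}$ has a density with values in $[\kappa_2,\kappa_3]$ on $[-\kappa_1,\kappa_1]$. (3) For $j\ne k$ and $0<\kappa<\kappa_1$, $P\big(Z_{\ell,k}\ge\kappa_4 \text{ for all } \ell\notin\{j,k\}\,\big|\,0<Z_{j,k}\le\kappa\big)\ge\kappa_5$. (4) $\|X\|_2\le\kappa_6$ a.s. (5) $X^1,X^2,\dots$ have law $\nu$, the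 pairs $(X^n,(\varepsilon^n_k)_{k\le K})$, $n\ge1$, are independent, and $\mathbb E(e^{t\varepsilon^n_k}\mid X^n)\le e^{\kappa_7t^2/2}$ for all $n$, $k$ and $t\in\mathbb R$. (6) For every $k$, $\lambda_{\min}\big(\mathbb E(XX^\top 1_{\{\pi^*(X)=k\}})\big)\ge\kappa_8$. **Algorithm.** Fix $a,\alpha>0$ and initial values $g^0\in\mathbb R^K$, $\hat\beta^0_1,\dots,\hat\beta^0_K\in\mathbb R^d$. Let $\mathcal T_k=\{\lceil \exp(a\,m^{1/9})\rceil : m\ge1,\ (k+1)\mid m\}$. For $n=0,1,2,\dots$: observe $X^{n+1}$ and let $\hat\pi^{n+1}=\arg\min_j\big((\hat\beta^n_j)^\top X^{n+1}-g^n_j\big)$. The sampled index is $\pi^{n+1}=\max\{k: n\in\mathcal T_k\}$ if $n\in\bigcup_k\mathcal T_k$, and $\pi^{n+1}=\hat\pi^{n+1}$ otherwise. Update $$g^{n+1}_k=g^n_k+\frac{\alpha}{n+1}\big(-1_{\{k=\hat\pi^{n+1}\}}+p_k\big),\qquad k=1,\dots,K,$$ observe $W^{n+1}_{\pi^{n+1}}=\beta_{\pi^{n+1}}^\top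 X^{n+1}+\varepsilon^{n+1}_{\pi^{n+1}}$, and set, with $\rho^n=1+(\log n)^3$, $$\hat\beta^{n+1}_k=\Big(\rho^{n+1}I+\sum_{m=1}^{n+1}X^m(X^m)^\top1_{\{\pi^m=k\}}\Big)^{-1}\sum_{m=1}^{n+1}W^m_kX^m1_{\{\pi^m=k\}},$$ either for every $k$ in every period, or only for $k=\pi^{n+1}$, with $\hat\beta^{n+1}_k=\hat\beta^n_k$ for the other $k$ (the result holds for both versions). **Theorem.** There is $\bar\alpha>0$, depending only on $\kappa_1,\dots,\kappa_8$, and for all $a,\alpha,R>0$ there are $C,C'>0$, depending only on $\kappa_1,\dots,\kappa_8$, $a$, $\alpha$, $R$, such that the following holds whenever $\|\beta_k\|_2\le R$, $\|\hat\beta^0_k\|_2\le R$ and $|g^0_k-g^*_k|\le R$ for all $k$. For every $n\ge1$, $$\mathbb E\Big(\max_j\|\hat\beta^n_j-\beta_j\|_2^2\Big)\le\frac Cn ,$$ and, if $\alpha>\bar\alpha$, $$\mathbb E\Big(\sum_{k=1}^K\big((g^n_k-g^n_1)-(g^*_k-g^*_1)\big)^2\Big)\le\frac{C'}n .$$ If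 moreover $\sum_kg^0_k=\sum_kg^*_k$ (which can always be arranged by adding a constant to all components of $g^*$), then also $\mathbb E\|g^n-g^*\|_2^2\le C'/n$. In particular all these expectations are finite. -/

import Mathlib

open MeasureTheory ProbabilityTheory

open scoped ENNReal RealInnerProductSpace Matrix

noncomputable section

namespace SemidiscreteOT

/-! Alternatives are indexed by `Fin K`; the alternative `k : Fin K` is the one numbered `k + 1` in
the usual `1, …, K` numbering.  Contexts and coefficients live in `EuclideanSpace ℝ (Fin d)`; the
law of a context is `ν`. -/

variable {K d : ℕ}

/-- The adjusted linear cost `bⱼᵀ x - gⱼ` of alternative `j`. -/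
def adjCost (b : Fin K → EuclideanSpace ℝ (Fin d)) (g : Fin K → ℝ)
    (x : EuclideanSpace ℝ (Fin d)) (j : Fin K) : ℝ :=
  ⟪b j, x⟫ - g j

/-- `sel` picks a minimizing index of every finite vector of costs, in a measurable way:
a rule for `arg min` with a fixed convention for ties. -/
structure IsArgminRule (sel : (Fin K → ℝ) → Fin K) : Prop where
  measurable : Measurable sel
  le : ∀ (v : Fin K → ℝ) (j : Fin K), v (sel v) ≤ v j

/-- The decision rule `x ↦ argminⱼ (bⱼᵀ x - gⱼ)`. -/
def decision (sel : (Fin K → ℝ) → Fin K) (b : Fin K → EuclideanSpace ℝ (Fin d))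
    (g : Fin K → ℝ) (x : EuclideanSpace ℝ (Fin d)) : Fin K :=
  sel (adjCost b g x)

/-- The dual (Kantorovich) objective `E (minⱼ (βⱼᵀ X - gⱼ)) + pᵀ g`. -/
def dualObjective (ν : Measure (EuclideanSpace ℝ (Fin d)))
    (β : Fin K → EuclideanSpace ℝ (Fin d)) (p g : Fin K → ℝ) : ℝ :=
  (∫ x, (⨅ j, adjCost β g x j) ∂ν) + ∑ k, p k * g k

/-- `Z j k = (c_j(X) - g_j) - (c_k(X) - g_k)` as a function of the context. -/
def gap (β : Fin K → EuclideanSpace ℝ (Fin d)) (g : Fin K → ℝ) (j k : Fin K)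
    (x : EuclideanSpace ℝ (Fin d)) : ℝ :=
  adjCost β g x j - adjCost β g x k

/-- Differences of costs are absolutely continuous random variables. -/
def CostDifferencesAC (ν : Measure (EuclideanSpace ℝ (Fin d)))
    (β : Fin K → EuclideanSpace ℝ (Fin d)) : Prop :=
  ∀ j k : Fin K, j ≠ k → ν.map (fun x => ⟪β j, x⟫ - ⟪β k, x⟫) ≪ volume

/-- The margin, richness and boundedness conditions with constants `κ₁, …, κ₆`. -/
structure MarginCondition (ν : Measure (EuclideanSpace ℝ (Fin d)))
    (β : Fin K → EuclideanSpace ℝ (Fin d)) (gstar : Fin K → ℝ)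
    (κ₁ κ₂ κ₃ κ₄ κ₅ κ₆ : ℝ) : Prop where
  density : ∀ j k : Fin K, j ≠ k → ∃ f : ℝ → ℝ≥0∞, Measurable f ∧
    ν.map (gap β gstar j k) = volume.withDensity f ∧
    ∀ z ∈ Set.Icc (-κ₁) κ₁, ENNReal.ofReal κ₂ ≤ f z ∧ f z ≤ ENNReal.ofReal κ₃
  rich : ∀ j k : Fin K, j ≠ k → ∀ κ : ℝ, 0 < κ → κ < κ₁ →
    κ₅ ≤ (ν[|{x | 0 < gap β gstar j k x ∧ gap β gstar j k x ≤ κ}]).real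
      {x | ∀ l : Fin K, l ≠ j → l ≠ k → κ₄ ≤ gap β gstar l k x}
  bounded : ∀ᵐ x ∂ν, ‖x‖ ≤ κ₆

/-- The matrix `E (X Xᵀ 1{argminⱼ (bⱼᵀ X - gⱼ) = k})`. -/
def infoMatrix (ν : Measure (EuclideanSpace ℝ (Fin d))) (sel : (Fin K → ℝ) → Fin K)
    (b : Fin K → EuclideanSpace ℝ (Fin d)) (g : Fin K → ℝ) (k : Fin K) :
    Matrix (Fin d) (Fin d) ℝ :=
  Matrix.of fun i i' => ∫ x, (if decision sel b g x = k then x i * x i' else 0) ∂ν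

/-- Every eigenvalue of the (symmetric) information matrix of the optimal decision rule is at
least `κ₈`, for every alternative. -/
def MinEigenvalueCondition (ν : Measure (EuclideanSpace ℝ (Fin d)))
    (sel : (Fin K → ℝ) → Fin K) (β : Fin K → EuclideanSpace ℝ (Fin d)) (gstar : Fin K → ℝ)
    (κ₈ : ℝ) : Prop :=
  ∀ (k : Fin K) (r : ℝ),
    Module.End.HasEigenvalue (Matrix.toLin' (infoMatrix ν sel β gstar k)) r → κ₈ ≤ r

/-- The observations: `X n` is the context and `ε n k` the noise of alternative `k` in the
`(n + 1)`-st period.  Contexts have law `ν`, different periods are independent, and the noise is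
sub-Gaussian conditionally on the context of its period. -/
structure ObservationModel {Ω : Type*} [MeasurableSpace Ω] (P : Measure Ω)
    (ν : Measure (EuclideanSpace ℝ (Fin d))) (X : ℕ → Ω → EuclideanSpace ℝ (Fin d))
    (ε : ℕ → Ω → Fin K → ℝ) (κ₇ : ℝ) : Prop where
  measurable_context : ∀ n, Measurable (X n)
  measurable_noise : ∀ n, Measurable (ε n)
  law : ∀ n, P.map (X n) = ν
  indep : iIndepFun (fun n ω => (X n ω, ε n ω)) P
  integrable_exp : ∀ (n : ℕ) (k : Fin K) (t : ℝ), Integrable (fun ω => Real.exp (t * ε n ω k)) P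
  subgaussian : ∀ (n : ℕ) (k : Fin K) (t : ℝ),
    P[fun ω => Real.exp (t * ε n ω k) | MeasurableSpace.comap (X n) inferInstance]
      ≤ᵐ[P] fun _ => Real.exp (κ₇ * t ^ 2 / 2)

/-- The set `T_k = {⌈exp (a m^(1/9))⌉ : m = (k+1), 2 (k+1), …}` for the `k`-th alternative in the
numbering `1, …, K`; with numbering from `0` the multiples are those of `k + 2`. -/
def exploreTimes (a : ℝ) (k : Fin K) : Set ℕ :=
  {n | ∃ m : ℕ, 0 < m ∧ ((k : ℕ) + 2) ∣ m ∧
    n = ⌈Real.exp (a * (m : ℝ) ^ ((1 : ℝ) / 9))⌉₊}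

open Classical in
/-- The alternatives whose exploration set contains `n`. -/
def exploreSet (K : ℕ) (a : ℝ) (n : ℕ) : Finset (Fin K) :=
  Finset.univ.filter fun k => n ∈ exploreTimes a k

/-- The inputs of the algorithm. -/
structure Inputs (K d : ℕ) where
  /-- exploration parameter -/
  a : ℝ
  /-- stepsize constant: the stepsizes are `α / (n + 1)` -/
  α : ℝ
  /-- target probabilities -/
  p : Fin K → ℝ
  /-- initial dual vector -/
  g₀ : Fin K → ℝ
  /-- initial coefficient estimates -/
  b₀ : Fin K → EuclideanSpace ℝ (Fin d)
  /-- convention for the minimizing index -/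
  sel : (Fin K → ℝ) → Fin K
  /-- `true`: the estimate of an alternative is recomputed only in periods in which the
  alternative is sampled; `false`: all estimates are recomputed in every period -/
  hold : Bool

/-- The state after `n` periods: dual vector, coefficient estimates, and for each alternative the
sums `∑ X Xᵀ` and `∑ W X` over the periods in which it was sampled. -/
structure State (K d : ℕ) where
  g : Fin K → ℝ
  bhat : Fin K → EuclideanSpace ℝ (Fin d)
  gram : Fin K → Matrix (Fin d) (Fin d) ℝ
  resp : Fin K → Fin d → ℝ

/-- The regularization `ρⁿ = 1 + (log n)³`. -/
def rho (n : ℕ) : ℝ := 1 + Real.log n ^ 3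

/-- The sampled alternative `πⁿ⁺¹` of the semi-myopic policy in state `s` after `n` periods, for
the new context `x`.  If `n` lies in several exploration sets, the largest index is explored. -/
def sampled (I : Inputs K d) (n : ℕ) (s : State K d) (x : EuclideanSpace ℝ (Fin d)) : Fin K :=
  if h : (exploreSet K I.a n).Nonempty then (exploreSet K I.a n).max' h
  else decision I.sel s.bhat s.g x

/-- The ridge-like estimator `(ρ I + ∑ X Xᵀ)⁻¹ ∑ W X`. -/
def ridge (r : ℝ) (V : Matrix (Fin d) (Fin d) ℝ) (u : Fin d → ℝ) : EuclideanSpace ℝ (Fin d) :=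
  WithLp.toLp 2 ((r • (1 : Matrix (Fin d) (Fin d) ℝ) + V)⁻¹ *ᵥ u)

/-- One period of the algorithm, from `n` to `n + 1`, with new context `x` and noise `e`;
only the response `βₖᵀ x + eₖ` of the sampled alternative `k` enters. -/
def step (I : Inputs K d) (β : Fin K → EuclideanSpace ℝ (Fin d)) (n : ℕ) (s : State K d)
    (x : EuclideanSpace ℝ (Fin d)) (e : Fin K → ℝ) : State K d :=
  let π := sampled I n s x
  let V : Fin K → Matrix (Fin d) (Fin d) ℝ := fun k =>
    s.gram k + if π = k then Matrix.vecMulVec x x else 0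
  let u : Fin K → Fin d → ℝ := fun k =>
    s.resp k + if π = k then (⟪β k, x⟫ + e k) • (x : Fin d → ℝ) else 0
  { g := fun k => s.g k +
      I.α / ((n : ℝ) + 1) * (-(if k = decision I.sel s.bhat s.g x then 1 else 0) + I.p k)
    bhat := fun k =>
      if I.hold = true ∧ π ≠ k then s.bhat k else ridge (rho (n + 1)) (V k) (u k)
    gram := V
    resp := u }

/-- The state after `n` periods, along the contexts `x 0, x 1, …` and noises `e 0, e 1, …`. -/
def run (I : Inputs K d) (β : Fin K → EuclideanSpace ℝ (Fin d))
    (x : ℕ → EuclideanSpace ℝ (Fin d)) (e : ℕ → Fin K → ℝ) : ℕ → State K d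
  | 0 => { g := I.g₀, bhat := I.b₀, gram := 0, resp := 0 }
  | n + 1 => step I β n (run I β x e n) (x n) (e n)

end SemidiscreteOT

end

namespace SemidiscreteOT

universe u

noncomputable section

/-! The proof is a bootstrap. Forced exploration first gives crude consistency of the estimates,
then of the dual vector, with failure probabilities below every power of `n`. Consistency makes the
information about every alternative grow linearly, and this gives the rate `1 / n`.

Consistency of the estimates. Before time `n` every alternative is explored of the order of `(log n)
^ 9` times, whatever the dual vector does, so by concentration its Gram form is at least of that
order. The regularization is only of order `(log n) ^ 3`. The noise is controlled by the
supermartingale `exp (⟪θ, noise⟫ - κ₇ / 2 * gramForm θ θ)`, with `θ` ranging over a net of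
polynomial size: a deviation `(log n) ^ 8` has probability `exp (-(log n) ^ 8)` for each `θ`. The
normal equation `err_equation` turns this into `measure_err_gt_le`.

Consistency of the dual vector. The update is stochastic gradient ascent for a concave objective.
The first-order condition `sum_p_mul` says that the optimal cells have probabilities `p`, so the
mean first-order change of the squared distance `pot` is twice the step size times `drift`. Adding a
constant to `g` changes no decision, and the algorithm preserves the sum of the components, so `pot`
measures centred deviations. If `Δ` is the largest difference of two deviations, the lower density
bound and the richness condition give a drift of at most `-const * Δ * min Δ κ₁`, up to an error
proportional to the estimation error `δ` (`drift_le`). Near the optimum this error improves to order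
`Δ * δ`, because wrong estimates change the decision only on a set of measure of order `δ`
(`drift_le_of_near`). Exponential moments of `pot`, followed from time `exp ((log n) ^ (1 / 3))` to
time `n` while the estimates are accurate, give `measure_pot_ge_le`.

Rates. Once estimates and dual vector are close to their limits, the decision rule agrees with the
optimal one off a small set, and by the eigenvalue condition every unexplored period is informative
about every alternative. Gram forms are then at least `κ₈ / 16 * n` outside an event of probability
of order `n ^ (-4)` (`measure_gramForm_lt_linear_le`). With fourth moments of the noise of order `n
^ 2` this gives mean squared errors of order `1 / n`. Near the optimum the drift is at most `-rate *
pot` plus a multiple of the squared errors, so the mean of `pot` contracts by `1 - 2 * α * rate / (n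
+ 1)` up to a term of order `1 / n ^ 2`. It decreases like `1 / n` when `α * rate ≥ 1`; hence `αbar
= 1 / rate`.

All constants are independent of `K` and `d`, since `K * d ≤ κ₆ ^ 2 / κ₈` by the eigenvalue
condition (`card_mul_dim_le`). -/

/-- The constants on which the bounds may depend. -/
structure Constants where
  κ₁ : ℝ
  κ₂ : ℝ
  κ₃ : ℝ
  κ₄ : ℝ
  κ₅ : ℝ
  κ₆ : ℝ
  κ₇ : ℝ
  κ₈ : ℝ
  a : ℝ
  α : ℝ
  R : ℝ
  hκ₁ : 0 < κ₁
  hκ₂ : 0 < κ₂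
  hκ₃ : 0 < κ₃
  hκ₄ : 0 < κ₄
  hκ₅ : 0 < κ₅
  hκ₆ : 0 < κ₆
  hκ₇ : 0 < κ₇
  hκ₈ : 0 < κ₈
  ha : 0 < a
  hα : 0 < α
  hR : 0 < R

/-- A problem instance, together with a run of the algorithm, that satisfies all assumptions with
the constants `c`. -/
structure Model (c : Constants) where
  K : ℕ
  d : ℕ
  neZero : NeZero K
  ν : Measure (EuclideanSpace ℝ (Fin d))
  β : Fin K → EuclideanSpace ℝ (Fin d)
  gstar : Fin K → ℝ
  I : Inputs K d
  Ω : Type u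
  mΩ : MeasurableSpace Ω
  P : Measure Ω
  prob : IsProbabilityMeasure P
  X : ℕ → Ω → EuclideanSpace ℝ (Fin d)
  ε : ℕ → Ω → Fin K → ℝ
  ha : I.a = c.a
  hα : I.α = c.α
  p_nonneg : ∀ k, 0 ≤ I.p k
  p_sum : ∑ k, I.p k = 1
  argmin : IsArgminRule I.sel
  optimal : ∀ g, dualObjective ν β I.p g ≤ dualObjective ν β I.p gstar
  norm_β : ∀ k, ‖β k‖ ≤ c.R
  norm_b₀ : ∀ k, ‖I.b₀ k‖ ≤ c.R
  abs_g₀ : ∀ k, |I.g₀ k - gstar k| ≤ c.R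
  margin : MarginCondition ν β gstar c.κ₁ c.κ₂ c.κ₃ c.κ₄ c.κ₅ c.κ₆
  eig : MinEigenvalueCondition ν I.sel β gstar c.κ₈
  obs : ObservationModel P ν X ε c.κ₇

attribute [instance] Model.neZero Model.mΩ Model.prob

/-! ### The run of the algorithm and the normal equation of the estimation error. -/

namespace Model

variable {c : Constants} (M : Model.{u} c)

/-- The space of contexts. -/
abbrev E : Type := EuclideanSpace ℝ (Fin M.d)

/-- The part `(g, bhat)` of the state that determines the decisions. -/
abbrev Ctrl : Type := (Fin M.K → ℝ) × (Fin M.K → M.E)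

/-- Context and noise of a period. -/
def Z (n : ℕ) (ω : M.Ω) : M.E × (Fin M.K → ℝ) := (M.X n ω, M.ε n ω)

/-- The state after `n` periods. -/
def S (n : ℕ) (ω : M.Ω) : State M.K M.d :=
  run M.I M.β (fun m => M.X m ω) (fun m => M.ε m ω) n

/-- The decision-relevant part of the state after `n` periods. -/
def ctrl (n : ℕ) (ω : M.Ω) : M.Ctrl := ((M.S n ω).g, (M.S n ω).bhat)

/-- The sampled alternative as a function of the decision-relevant part of the state. -/
def pick (n : ℕ) (s : M.Ctrl) (x : M.E) : Fin M.K :=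
  -- The zeros are dummies: `sampled` reads only the fields `g` and `bhat`.
  sampled M.I n { g := s.1, bhat := s.2, gram := 0, resp := 0 } x

/-- The alternative sampled in the `(n + 1)`-st period. -/
def arm (n : ℕ) (ω : M.Ω) : Fin M.K := M.pick n (M.ctrl n ω) (M.X n ω)

/-- The myopic decision. -/
def dec (s : M.Ctrl) (x : M.E) : Fin M.K := decision M.I.sel s.2 s.1 x

/-- The optimal decision. -/
def opt (x : M.E) : Fin M.K := decision M.I.sel M.β M.gstar x

/-- The accumulated noise `∑ ε X` of an alternative. -/
def noise (n : ℕ) (ω : M.Ω) (k : Fin M.K) : M.E :=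
  ∑ m ∈ Finset.range n, if M.arm m ω = k then M.ε m ω k • M.X m ω else 0

/-- The Gram form `∑ ⟪X, v⟫ ⟪X, w⟫` of the contexts in which an alternative was sampled. -/
def gramForm (n : ℕ) (ω : M.Ω) (k : Fin M.K) (v w : M.E) : ℝ :=
  ∑ m ∈ Finset.range n, if M.arm m ω = k then ⟪M.X m ω, v⟫ * ⟪M.X m ω, w⟫ else 0

/-- The estimation error. -/
def err (n : ℕ) (ω : M.Ω) (k : Fin M.K) : M.E := (M.S n ω).bhat k - M.β k

lemma gramForm_succ (n : ℕ) (ω : M.Ω) (k : Fin M.K) (v w : M.E) :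
    M.gramForm (n + 1) ω k v w = M.gramForm n ω k v w +
      if M.arm n ω = k then ⟪M.X n ω, v⟫ * ⟪M.X n ω, w⟫ else 0 := by
  simp [gramForm, Finset.sum_range_succ]

lemma noise_succ (n : ℕ) (ω : M.Ω) (k : Fin M.K) :
    M.noise (n + 1) ω k = M.noise n ω k +
      if M.arm n ω = k then M.ε n ω k • M.X n ω else 0 := by
  simp [noise, Finset.sum_range_succ]

lemma gramForm_self_nonneg (n : ℕ) (ω : M.Ω) (k : Fin M.K) (v : M.E) :
    0 ≤ M.gramForm n ω k v v := by
  refine Finset.sum_nonneg fun m _ => ?_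
  split_ifs
  · exact mul_self_nonneg _
  · exact le_rfl

lemma g_succ (n : ℕ) (ω : M.Ω) (k : Fin M.K) : (M.S (n + 1) ω).g k = (M.S n ω).g k +
    M.I.α / ((n : ℝ) + 1) *
      (-(if k = M.dec (M.ctrl n ω) (M.X n ω) then 1 else 0) + M.I.p k) := rfl

lemma gram_succ (n : ℕ) (ω : M.Ω) (k : Fin M.K) : (M.S (n + 1) ω).gram k = (M.S n ω).gram k +
    if M.arm n ω = k then Matrix.vecMulVec (M.X n ω) (M.X n ω) else 0 := rfl

lemma resp_succ (n : ℕ) (ω : M.Ω) (k : Fin M.K) : (M.S (n + 1) ω).resp k = (M.S n ω).resp k +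
    if M.arm n ω = k then (⟪M.β k, M.X n ω⟫ + M.ε n ω k) • (M.X n ω : Fin M.d → ℝ) else 0 := rfl

lemma bhat_succ (n : ℕ) (ω : M.Ω) (k : Fin M.K) : (M.S (n + 1) ω).bhat k =
    if M.I.hold = true ∧ M.arm n ω ≠ k then (M.S n ω).bhat k else
      ridge (rho (n + 1)) ((M.S (n + 1) ω).gram k) ((M.S (n + 1) ω).resp k) := rfl

lemma inner_eq_dotProduct (v w : M.E) : ⟪v, w⟫ = w.ofLp ⬝ᵥ v.ofLp := by
  rw [EuclideanSpace.inner_eq_star_dotProduct]; simp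

lemma gram_mulVec (n : ℕ) (ω : M.Ω) (k : Fin M.K) (v w : M.E) :
    (M.S n ω).gram k *ᵥ v.ofLp ⬝ᵥ w.ofLp = M.gramForm n ω k v w := by
  induction n with
  | zero => simp [S, run, gramForm]
  | succ n ih =>
    rw [gramForm_succ, ← ih, gram_succ]
    split_ifs
    · simp only [Matrix.add_mulVec, add_dotProduct, Matrix.vecMulVec_mulVec, inner_eq_dotProduct]
      congr 1
      simp [dotProduct_comm]
    · simp

lemma gram_isSymm (n : ℕ) (ω : M.Ω) (k : Fin M.K) : ((M.S n ω).gram k).IsHermitian := by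
  induction n with
  | zero => simp [S, run]
  | succ n ih =>
    rw [gram_succ]
    refine ih.add ?_
    split_ifs
    · ext i j; simp [Matrix.vecMulVec_apply, mul_comm]
    · exact Matrix.isHermitian_zero

/-- Each recorded response is `⟪β k, X⟫ + ε`, so the response vector splits into the Gram form
applied to the true coefficient and the accumulated noise. -/
lemma resp_dotProduct (n : ℕ) (ω : M.Ω) (k : Fin M.K) (w : M.E) :
    (M.S n ω).resp k ⬝ᵥ w.ofLp = M.gramForm n ω k (M.β k) w + ⟪M.noise n ω k, w⟫ := by
  induction n with
  | zero => simp [S, run, gramForm, noise]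
  | succ n ih =>
    rw [gramForm_succ, noise_succ, inner_add_left]
    have : (M.S (n+1) ω).resp k ⬝ᵥ w.ofLp = (M.S n ω).resp k ⬝ᵥ w.ofLp +
        if M.arm n ω = k then (⟪M.X n ω, M.β k⟫ + M.ε n ω k) * ⟪M.X n ω, w⟫ else 0 := by
      rw [resp_succ, real_inner_comm]
      split_ifs
      · rw [add_dotProduct, smul_dotProduct, smul_eq_mul, M.inner_eq_dotProduct _ w,
          dotProduct_comm w.ofLp]
      · simp
    rw [this, ih]
    split_ifs
    · rw [inner_smul_left]; simp; ring
    · simp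

lemma one_le_rho (n : ℕ) : 1 ≤ rho n := by
  have : 0 ≤ Real.log n := Real.log_natCast_nonneg n
  unfold rho; nlinarith [pow_nonneg this 3]

lemma rho_mono {m n : ℕ} (h : m ≤ n) : rho m ≤ rho n := by
  unfold rho
  have : Real.log m ≤ Real.log n := by
    rcases Nat.eq_zero_or_pos m with rfl | hm
    · simpa using Real.log_natCast_nonneg n
    · exact Real.log_le_log (by exact_mod_cast hm) (by exact_mod_cast h)
  have h0 : 0 ≤ Real.log m := Real.log_natCast_nonneg m
  gcongr

/-- Normal equation of the regularized least-squares estimator. -/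
lemma ridge_normal_equation (n : ℕ) (ω : M.Ω) (k : Fin M.K) {r : ℝ} (hr : 0 < r) (w : M.E) :
    r * ⟪ridge r ((M.S n ω).gram k) ((M.S n ω).resp k), w⟫ +
      M.gramForm n ω k (ridge r ((M.S n ω).gram k) ((M.S n ω).resp k)) w =
      M.gramForm n ω k (M.β k) w + ⟪M.noise n ω k, w⟫ := by
  set V := (M.S n ω).gram k with hV
  set A := r • (1 : Matrix (Fin M.d) (Fin M.d) ℝ) + V with hA
  -- The Gram matrix is positive semidefinite and `r > 0`, so the inverse in `ridge` is a true
  -- inverse.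
  have hpd : A.PosDef := by
    refine Matrix.PosDef.of_dotProduct_mulVec_pos ?_ fun x hx => ?_
    · refine Matrix.IsHermitian.add ?_ (M.gram_isSymm n ω k)
      ext i j; simp [Matrix.one_apply, eq_comm]
    · have h1 := M.gram_mulVec n ω k (WithLp.toLp 2 x) (WithLp.toLp 2 x)
      have h2 := M.gramForm_self_nonneg n ω k (WithLp.toLp 2 x)
      rw [← h1] at h2
      simp only [star_trivial, hA, Matrix.add_mulVec, Matrix.smul_mulVec, Matrix.one_mulVec,
        dotProduct_add, dotProduct_smul, smul_eq_mul]
      have h3 : 0 < x ⬝ᵥ x := by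
        simpa using (Matrix.dotProduct_star_self_pos_iff (v := x)).2 hx
      rw [dotProduct_comm x (V *ᵥ x)]
      simp only at h2
      have := mul_pos hr h3
      linarith
  have hu : IsUnit A.det := hpd.det_pos.ne'.isUnit
  rw [← resp_dotProduct]
  set b := ridge r V ((M.S n ω).resp k) with hb
  have h4 : A *ᵥ b.ofLp = (M.S n ω).resp k := by
    simp only [hb, ridge, Matrix.mulVec_mulVec]
    rw [Matrix.mul_nonsing_inv _ hu, Matrix.one_mulVec]
  rw [← gram_mulVec, ← h4, hA, ← hV]
  rw [Matrix.add_mulVec, Matrix.smul_mulVec, Matrix.one_mulVec, add_dotProduct,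
    smul_dotProduct, smul_eq_mul, inner_eq_dotProduct, dotProduct_comm w.ofLp]

/-- The estimation error solves a regularized normal equation, unless the alternative has not been
sampled yet. -/
lemma err_equation (n : ℕ) (ω : M.Ω) (k : Fin M.K) :
    ((∀ m < n, M.arm m ω ≠ k) ∧ M.err n ω k = M.I.b₀ k - M.β k) ∨
    ∃ r, 1 ≤ r ∧ r ≤ rho n ∧ ∀ w, r * ⟪M.err n ω k, w⟫ + M.gramForm n ω k (M.err n ω k) w =
      ⟪M.noise n ω k, w⟫ - r * ⟪M.β k, w⟫ := by
  have gsub : ∀ n ω k (u v w : M.E),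
      M.gramForm n ω k (u - v) w = M.gramForm n ω k u w - M.gramForm n ω k v w := by
    intro n ω k u v w
    simp only [gramForm, ← Finset.sum_sub_distrib]
    refine Finset.sum_congr rfl fun m _ => ?_
    split_ifs
    · rw [inner_sub_right]; ring
    · simp
  induction n with
  | zero => left; exact ⟨by simp, rfl⟩
  | succ n ih =>
    -- A held estimate keeps its old equation: when the alternative is not sampled, neither its Gram
    -- form nor its noise changes. Only the weight `r` becomes outdated, which is why it is merely
    -- known to lie in `[1, rho n]`.
    by_cases h : M.I.hold = true ∧ M.arm n ω ≠ k
    · have he : M.err (n + 1) ω k = M.err n ω k := by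
        rw [err, bhat_succ, if_pos h, err]
      rcases ih with ⟨h1, h2⟩ | ⟨r, h1, h2, h3⟩
      · left
        refine ⟨fun m hm => ?_, he.trans h2⟩
        rcases Nat.lt_succ_iff_lt_or_eq.1 hm with h' | rfl
        · exact h1 m h'
        · exact h.2
      · right
        refine ⟨r, h1, h2.trans (rho_mono n.le_succ), fun w => ?_⟩
        rw [he, gramForm_succ, noise_succ, if_neg h.2, if_neg h.2, add_zero, add_zero]
        exact h3 w
    · right
      refine ⟨rho (n + 1), one_le_rho _, le_rfl, fun w => ?_⟩
      have hb : (M.S (n + 1) ω).bhat k =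
          ridge (rho (n + 1)) ((M.S (n + 1) ω).gram k) ((M.S (n + 1) ω).resp k) := by
        rw [bhat_succ, if_neg h]
      have := M.ridge_normal_equation (n + 1) ω k (r := rho (n + 1))
        (zero_lt_one.trans_le (one_le_rho _)) w
      rw [← hb] at this
      rw [err, gsub, inner_sub_left]
      linarith

end Model

/-! ### Measurability of the run. -/

section RunMeasurability

variable {K d : ℕ} {Ω : Type*} [MeasurableSpace Ω]

lemma measurable_det {n : ℕ} {A : Ω → Matrix (Fin n) (Fin n) ℝ}
    (hA : ∀ i j, Measurable fun ω => A ω i j) : Measurable fun ω => (A ω).det := by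
  simp only [Matrix.det_apply]
  refine Finset.measurable_fun_sum _ fun σ _ => ?_
  exact (Finset.measurable_fun_prod _ fun i _ => hA _ _).const_smul _

/-- By Cramer's rule the entries are quotients of determinants. Singular matrices have inverse `0`
here, in agreement with division by a zero determinant, so no invertibility is needed. -/
lemma measurable_inv_apply {n : ℕ} {A : Ω → Matrix (Fin n) (Fin n) ℝ}
    (hA : ∀ i j, Measurable fun ω => A ω i j) (i j : Fin n) :
    Measurable fun ω => (A ω)⁻¹ i j := by
  simp only [Matrix.inv_def, Ring.inverse_eq_inv', Matrix.smul_apply, smul_eq_mul,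
    Matrix.adjugate_apply]
  refine (measurable_det hA).inv.mul (measurable_det fun i' j' => ?_)
  by_cases h : i' = j
  · subst h; simp
  · simpa [Matrix.updateRow_apply, h] using hA i' j'

lemma measurable_ridge (r : ℝ) {V : Ω → Matrix (Fin d) (Fin d) ℝ} {u : Ω → Fin d → ℝ}
    (hV : ∀ i j, Measurable fun ω => V ω i j) (hu : ∀ i, Measurable fun ω => u ω i) :
    Measurable fun ω => ridge r (V ω) (u ω) := by
  refine (WithLp.measurable_toLp 2 _).comp ?_
  refine measurable_pi_lambda _ fun i => ?_
  simp only [Matrix.mulVec, dotProduct]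
  refine Finset.measurable_fun_sum _ fun j _ => Measurable.mul ?_ (hu j)
  refine measurable_inv_apply (fun i j => ?_) i j
  simp only [Matrix.add_apply, Matrix.smul_apply]
  exact measurable_const.add (hV i j)

lemma measurable_decision {sel : (Fin K → ℝ) → Fin K} (hsel : IsArgminRule sel)
    {b : Ω → Fin K → EuclideanSpace ℝ (Fin d)} {g : Ω → Fin K → ℝ}
    {x : Ω → EuclideanSpace ℝ (Fin d)} (hb : Measurable b) (hg : Measurable g)
    (hx : Measurable x) : Measurable fun ω => decision sel (b ω) (g ω) (x ω) := by
  refine hsel.measurable.comp (measurable_pi_lambda _ fun j => ?_)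
  exact (((measurable_pi_apply j).comp hb).inner hx).sub ((measurable_pi_apply j).comp hg)

lemma measurable_sampled {I : Inputs K d} (hsel : IsArgminRule I.sel) (n : ℕ)
    {s : Ω → State K d} {x : Ω → EuclideanSpace ℝ (Fin d)} (hb : Measurable fun ω => (s ω).bhat)
    (hg : Measurable fun ω => (s ω).g) (hx : Measurable x) :
    Measurable fun ω => sampled I n (s ω) (x ω) := by
  by_cases h : (exploreSet K I.a n).Nonempty
  · simp only [sampled, h, dif_pos, measurable_const]
  · simp only [sampled, h, dif_neg, not_false_eq_true]
    exact measurable_decision hsel hb hg hx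

/-- Only the inputs of the periods before `n` are assumed measurable, and the σ-algebra is
arbitrary. Applied with the σ-algebra `F n` generated by these inputs, this says that the run is
adapted. -/
lemma measurable_run {I : Inputs K d} (hsel : IsArgminRule I.sel)
    (β : Fin K → EuclideanSpace ℝ (Fin d)) {x : ℕ → Ω → EuclideanSpace ℝ (Fin d)}
    {e : ℕ → Ω → Fin K → ℝ} (n : ℕ) (hx : ∀ m < n, Measurable (x m))
    (he : ∀ m < n, Measurable (e m)) :
    (Measurable fun ω => (run I β (fun m => x m ω) (fun m => e m ω) n).g) ∧
    (Measurable fun ω => (run I β (fun m => x m ω) (fun m => e m ω) n).bhat) ∧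
    (∀ k i j, Measurable fun ω => (run I β (fun m => x m ω) (fun m => e m ω) n).gram k i j) ∧
    (∀ k i, Measurable fun ω => (run I β (fun m => x m ω) (fun m => e m ω) n).resp k i) := by
  induction n with
  | zero => simp [run]
  | succ n ih =>
    obtain ⟨h1, h2, h3, h4⟩ := ih (fun m hm => hx m (hm.trans n.lt_succ_self))
      (fun m hm => he m (hm.trans n.lt_succ_self))
    have hxn := hx n n.lt_succ_self
    have hen := he n n.lt_succ_self
    have hdec := measurable_decision hsel h2 h1 hxn
    have hsam := measurable_sampled hsel n h2 h1 hxn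
    have hset : ∀ k, MeasurableSet {ω | sampled I n (run I β (fun m => x m ω) (fun m => e m ω) n)
        (x n ω) = k} := fun k => hsam (measurableSet_singleton k)
    have hgram : ∀ k i j, Measurable fun ω =>
        (run I β (fun m => x m ω) (fun m => e m ω) (n + 1)).gram k i j := by
      intro k i j
      have : ∀ ω, (run I β (fun m => x m ω) (fun m => e m ω) (n + 1)).gram k i j =
          (run I β (fun m => x m ω) (fun m => e m ω) n).gram k i j +
          if sampled I n (run I β (fun m => x m ω) (fun m => e m ω) n) (x n ω) = k then
            x n ω i * x n ω j else 0 := by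
        intro ω
        simp only [run, step, Matrix.add_apply]
        congr 1
        split_ifs <;> simp [Matrix.vecMulVec_apply]
      simp only [this]
      exact (h3 k i j).add (Measurable.ite (hset k) (by fun_prop) measurable_const)
    have hresp : ∀ k i, Measurable fun ω =>
        (run I β (fun m => x m ω) (fun m => e m ω) (n + 1)).resp k i := by
      intro k i
      have : ∀ ω, (run I β (fun m => x m ω) (fun m => e m ω) (n + 1)).resp k i =
          (run I β (fun m => x m ω) (fun m => e m ω) n).resp k i +
          if sampled I n (run I β (fun m => x m ω) (fun m => e m ω) n) (x n ω) = k then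
            (⟪β k, x n ω⟫ + e n ω k) * x n ω i else 0 := by
        intro ω
        simp only [run, step, Pi.add_apply]
        congr 1
        split_ifs <;> simp
      simp only [this]
      refine (h4 k i).add (Measurable.ite (hset k) ?_ measurable_const)
      exact ((measurable_const.inner hxn).add ((measurable_pi_apply k).comp hen)).mul (by fun_prop)
    refine ⟨?_, ?_, hgram, hresp⟩
    · refine measurable_pi_lambda _ fun k => ?_
      simp only [run, step]
      refine ((measurable_pi_apply k).comp h1).add (measurable_const.mul (Measurable.add ?_
        measurable_const))
      refine (Measurable.ite ?_ measurable_const measurable_const).neg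
      have : {ω | k = decision I.sel (run I β (fun m => x m ω) (fun m => e m ω) n).bhat
          (run I β (fun m => x m ω) (fun m => e m ω) n).g (x n ω)} =
          (fun ω => decision I.sel (run I β (fun m => x m ω) (fun m => e m ω) n).bhat
          (run I β (fun m => x m ω) (fun m => e m ω) n).g (x n ω)) ⁻¹' {k} := by
        ext ω; simp [eq_comm]
      rw [this]
      exact hdec (measurableSet_singleton k)
    · refine measurable_pi_lambda _ fun k => ?_
      have : ∀ ω, (run I β (fun m => x m ω) (fun m => e m ω) (n + 1)).bhat k =
          if I.hold = true ∧ sampled I n (run I β (fun m => x m ω) (fun m => e m ω) n) (x n ω) ≠ k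
          then (run I β (fun m => x m ω) (fun m => e m ω) n).bhat k else
          ridge (rho (n + 1)) ((run I β (fun m => x m ω) (fun m => e m ω) (n + 1)).gram k)
            ((run I β (fun m => x m ω) (fun m => e m ω) (n + 1)).resp k) := fun ω => rfl
      simp only [this]
      refine Measurable.ite ?_ ((measurable_pi_apply k).comp h2)
        (measurable_ridge _ (hgram k) (hresp k))
      exact (MeasurableSet.const _).inter (hset k).compl

end RunMeasurability

/-! ### The filtration, and independence of a new period from the past. -/

lemma indep_iSup_lt_comap {Ω γ : Type*} [MeasurableSpace Ω] [mγ : MeasurableSpace γ] {P : Measure Ω}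
    {Z : ℕ → Ω → γ} (hZ : ∀ n, Measurable (Z n)) (h : iIndepFun Z P) (n : ℕ) :
    Indep (⨆ m ∈ Set.Iio n, MeasurableSpace.comap (Z m) inferInstance)
      (MeasurableSpace.comap (Z n) mγ) P := by
  have h1 := indep_iSup_of_disjoint (μ := P) (fun m => (hZ m).comap_le)
    h (S := Set.Iio n) (T := {n}) (by simp)
  refine indep_of_indep_of_le_right h1 ?_
  exact le_iSup₂ (f := fun m (_ : m ∈ ({n} : Set ℕ)) => MeasurableSpace.comap (Z m) mγ) n rfl

/-- Integrating a function of two independent random variables. -/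
lemma lintegral_comp_of_indepFun {Ω β γ : Type*} [MeasurableSpace Ω] [MeasurableSpace β]
    [MeasurableSpace γ] {P : Measure Ω} [IsProbabilityMeasure P] {W : Ω → β} {Z : Ω → γ}
    (hW : Measurable W) (hZ : Measurable Z) (hWZ : IndepFun W Z P) {f : β × γ → ℝ≥0∞}
    (hf : Measurable f) :
    ∫⁻ ω, f (W ω, Z ω) ∂P = ∫⁻ ω, ∫⁻ ω', f (W ω, Z ω') ∂P ∂P := by
  rw [indepFun_iff_map_prod_eq_prod_map_map hW.aemeasurable hZ.aemeasurable] at hWZ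
  have : IsProbabilityMeasure (P.map Z) := Measure.isProbabilityMeasure_map hZ.aemeasurable
  rw [← lintegral_map hf (hW.prodMk hZ), hWZ, lintegral_prod _ hf.aemeasurable,
    lintegral_map hf.lintegral_prod_right' hW]
  exact lintegral_congr fun ω => lintegral_map (hf.comp measurable_prodMk_left) hZ

namespace Model

variable {c : Constants} (M : Model.{u} c)

lemma measurable_X (n : ℕ) : Measurable (M.X n) := M.obs.measurable_context n

lemma measurable_Z (n : ℕ) : Measurable (M.Z n) :=
  (M.obs.measurable_context n).prodMk (M.obs.measurable_noise n)

/-- The information available after `n` periods. -/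
@[reducible]
def F (n : ℕ) : MeasurableSpace M.Ω :=
  ⨆ m ∈ Set.Iio n, MeasurableSpace.comap (M.Z m) inferInstance

lemma F_le (n : ℕ) : M.F n ≤ M.mΩ :=
  iSup₂_le fun m _ => (M.measurable_Z m).comap_le

lemma F_mono {m n : ℕ} (h : m ≤ n) : M.F m ≤ M.F n :=
  biSup_mono fun _ hi => lt_of_lt_of_le hi h

lemma measurable_Z_F {m n : ℕ} (h : m < n) : Measurable[M.F n] (M.Z m) := by
  refine Measurable.mono (comap_measurable (M.Z m)) ?_ le_rfl
  exact le_iSup₂ (f := fun m (_ : m ∈ Set.Iio n) =>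
    MeasurableSpace.comap (M.Z m) inferInstance) m h

lemma measurable_of_F {α : Type*} [MeasurableSpace α] {n : ℕ} {f : M.Ω → α}
    (h : Measurable[M.F n] f) : Measurable f := h.mono (M.F_le n) le_rfl

lemma measurable_F_mono {α : Type*} [MeasurableSpace α] {m n : ℕ} {f : M.Ω → α} (hmn : m ≤ n)
    (h : Measurable[M.F m] f) : Measurable[M.F n] f := h.mono (M.F_mono hmn) le_rfl

lemma measurable_X_F {m n : ℕ} (h : m < n) : Measurable[M.F n] (M.X m) :=
  measurable_fst.comp (M.measurable_Z_F h)

lemma measurable_ε_F {m n : ℕ} (h : m < n) : Measurable[M.F n] (M.ε m) :=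
  measurable_snd.comp (M.measurable_Z_F h)

lemma measurable_ctrl (n : ℕ) : Measurable[M.F n] (M.ctrl n) := by
  have := @measurable_run M.K M.d M.Ω (M.F n) M.I M.argmin M.β M.X M.ε n
    (fun m hm => M.measurable_X_F hm) (fun m hm => M.measurable_ε_F hm)
  exact this.1.prodMk this.2.1

lemma measurable_pick (n : ℕ) : Measurable fun q : M.Ctrl × M.E => M.pick n q.1 q.2 :=
  measurable_sampled M.argmin n measurable_fst.snd measurable_fst.fst measurable_snd

lemma measurable_dec : Measurable fun q : M.Ctrl × M.E => M.dec q.1 q.2 :=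
  measurable_decision M.argmin measurable_fst.snd measurable_fst.fst measurable_snd

lemma measurable_arm {m n : ℕ} (h : m < n) : Measurable[M.F n] (M.arm m) := by
  have h1 : Measurable[M.F n] fun ω => (M.ctrl m ω, M.X m ω) :=
    (M.measurable_F_mono h.le (M.measurable_ctrl m)).prodMk (M.measurable_X_F h)
  have h2 : M.arm m = (fun q : M.Ctrl × M.E => M.pick m q.1 q.2) ∘
    fun ω => (M.ctrl m ω, M.X m ω) := rfl
  rw [h2]
  exact (M.measurable_pick m).comp h1

lemma indepFun_Z {α : Type*} [MeasurableSpace α] (n : ℕ) {s : M.Ω → α}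
    (hs : Measurable[M.F n] s) : IndepFun s (M.Z n) M.P := by
  rw [IndepFun_iff_Indep]
  exact indep_of_indep_of_le_left (indep_iSup_lt_comap M.measurable_Z M.obs.indep n) hs.comap_le

/-- Integration over a period, conditionally on the past. -/
lemma lintegral_period {α : Type*} [MeasurableSpace α] (n : ℕ) {w : M.Ω → ℝ≥0∞}
    (hw : Measurable[M.F n] w) {s : M.Ω → α} (hs : Measurable[M.F n] s)
    {h : α → M.E × (Fin M.K → ℝ) → ℝ≥0∞} (hh : Measurable (Function.uncurry h)) :
    ∫⁻ ω, w ω * h (s ω) (M.Z n ω) ∂M.P =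
      ∫⁻ ω, w ω * ∫⁻ ω', h (s ω) (M.Z n ω') ∂M.P ∂M.P := by
  -- Weight and state are merged into one variable that is independent of `Z n`, so that Fubini
  -- applies once.
  have hws : Measurable[M.F n] fun ω => (w ω, s ω) := hw.prodMk hs
  have hf : Measurable fun q : (ℝ≥0∞ × α) × (M.E × (Fin M.K → ℝ)) => q.1.1 * h q.1.2 q.2 :=
    measurable_fst.fst.mul (hh.comp (measurable_fst.snd.prodMk measurable_snd))
  have key := lintegral_comp_of_indepFun (P := M.P) (M.measurable_of_F hws) (M.measurable_Z n)
    (M.indepFun_Z n hws) hf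
  refine key.trans (lintegral_congr fun ω => ?_)
  have hm : Measurable fun ω' => h (s ω) (M.Z n ω') :=
    (hh.comp measurable_prodMk_left).comp (M.measurable_Z n)
  exact lintegral_const_mul (w ω) hm

end Model

/-! ### Measurability with respect to an arbitrary σ-algebra, for use with `F n`. -/

section GenericMeasurability

variable {Ω : Type*} [MeasurableSpace Ω]

lemma measurable_sum_ite {ι : Type*} [MeasurableSpace ι] [MeasurableSingletonClass ι]
    {γ : Type*} [MeasurableSpace γ] [AddCommMonoid γ] [MeasurableAdd₂ γ] [DecidableEq ι] (n : ℕ)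
    (a : ℕ → Ω → ι) (k : ι) (f : ℕ → Ω → γ) (ha : ∀ m < n, Measurable (a m))
    (hf : ∀ m < n, Measurable (f m)) :
    Measurable fun ω => ∑ m ∈ Finset.range n, if a m ω = k then f m ω else 0 := by
  refine Finset.measurable_fun_sum _ fun m hm => ?_
  have hm := Finset.mem_range.1 hm
  exact Measurable.ite (ha m hm (measurableSet_singleton k)) (hf m hm) measurable_const

lemma measurable_smul_apply {K d : ℕ} {e : Ω → Fin K → ℝ} {x : Ω → EuclideanSpace ℝ (Fin d)}
    (k : Fin K) (he : Measurable e) (hx : Measurable x) :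
    Measurable fun ω => e ω k • x ω :=
  ((measurable_pi_apply k).comp he).smul hx

lemma measurable_inner_mul_inner {d : ℕ} {x : Ω → EuclideanSpace ℝ (Fin d)}
    (hx : Measurable x) (v w : EuclideanSpace ℝ (Fin d)) :
    Measurable fun ω => ⟪x ω, v⟫ * ⟪x ω, w⟫ :=
  (hx.inner measurable_const).mul (hx.inner measurable_const)

lemma measurable_inner_sub_mul {d : ℕ} {x : Ω → EuclideanSpace ℝ (Fin d)} {f : Ω → ℝ}
    (hx : Measurable x) (hf : Measurable f) (v : EuclideanSpace ℝ (Fin d)) (r : ℝ) :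
    Measurable fun ω => ⟪v, x ω⟫ - r * f ω :=
  (measurable_const.inner hx).sub (measurable_const.mul hf)

lemma measurable_uncurry_tilt {α β : Type*} [MeasurableSpace α] [MeasurableSpace β] {K : ℕ}
    {t : α → β → ℝ} (ht : Measurable (Function.uncurry t)) (k : Fin K) (r : ℝ) :
    Measurable (Function.uncurry fun (s : α) (z : β × (Fin K → ℝ)) =>
      ENNReal.ofReal (Real.exp (t s z.1 * z.2 k - r * t s z.1 ^ 2))) := by
  have h1 : Measurable fun q : α × (β × (Fin K → ℝ)) => Function.uncurry t (q.1, q.2.1) :=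
    ht.comp (measurable_fst.prodMk measurable_snd.fst)
  have h2 : Measurable fun q : α × (β × (Fin K → ℝ)) => q.2.2 k :=
    (measurable_pi_apply k).comp measurable_snd.snd
  exact ENNReal.measurable_ofReal.comp (Real.measurable_exp.comp
    ((h1.mul h2).sub (measurable_const.mul (h1.pow_const 2))))

end GenericMeasurability

/-! ### The noise: exponential supermartingale, deviations and fourth moments. -/

namespace Model

variable {c : Constants} (M : Model.{u} c)

lemma measurable_ε (n : ℕ) (k : Fin M.K) : Measurable fun ω => M.ε n ω k :=
  (measurable_pi_apply k).comp (M.obs.measurable_noise n)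

lemma ae_norm_X_le : ∀ᵐ ω ∂M.P, ∀ n, ‖M.X n ω‖ ≤ c.κ₆ := by
  rw [ae_all_iff]
  intro n
  have := M.margin.bounded
  rw [← M.obs.law n] at this
  exact ae_of_ae_map (M.measurable_X n).aemeasurable this

/-- The event `X n ∈ A` belongs to the σ-algebra of the conditioning, so on it the exponential may
be replaced by its conditional expectation. This is the case of a constant tilt, localized to a set
of contexts. -/
lemma setLIntegral_exp_noise_le (n : ℕ) (k : Fin M.K) (t : ℝ) {A : Set M.E}
    (hA : MeasurableSet A) :
    ∫⁻ ω in M.X n ⁻¹' A, ENNReal.ofReal (Real.exp (t * M.ε n ω k - c.κ₇ / 2 * t ^ 2)) ∂M.P ≤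
      M.P (M.X n ⁻¹' A) := by
  have hint := M.obs.integrable_exp n k t
  have hm := (M.measurable_X n).comap_le
  have hAm : MeasurableSet (M.X n ⁻¹' A) := M.measurable_X n hA
  have h1 : ∫ ω in M.X n ⁻¹' A, Real.exp (t * M.ε n ω k) ∂M.P ≤
      Real.exp (c.κ₇ / 2 * t ^ 2) * M.P.real (M.X n ⁻¹' A) := by
    rw [← setIntegral_condExp hm hint ⟨A, hA, rfl⟩]
    calc _ ≤ ∫ ω in M.X n ⁻¹' A, Real.exp (c.κ₇ * t ^ 2 / 2) ∂M.P := by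
          refine setIntegral_mono_ae integrable_condExp.integrableOn
            (integrable_const _).integrableOn ?_
          exact M.obs.subgaussian n k t
      _ = _ := by
          rw [setIntegral_const, smul_eq_mul, mul_comm]; congr 2; ring
  have h2 : ∫⁻ ω in M.X n ⁻¹' A, ENNReal.ofReal (Real.exp (t * M.ε n ω k)) ∂M.P ≤
      ENNReal.ofReal (Real.exp (c.κ₇ / 2 * t ^ 2)) * M.P (M.X n ⁻¹' A) := by
    rw [← ofReal_integral_eq_lintegral_ofReal hint.integrableOn
      (Filter.Eventually.of_forall fun _ => (Real.exp_pos _).le)]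
    refine (ENNReal.ofReal_le_ofReal h1).trans_eq ?_
    rw [ENNReal.ofReal_mul (Real.exp_pos _).le, ofReal_measureReal]
  calc _ = ∫⁻ ω in M.X n ⁻¹' A, ENNReal.ofReal (Real.exp (-(c.κ₇ / 2 * t ^ 2))) *
        ENNReal.ofReal (Real.exp (t * M.ε n ω k)) ∂M.P := by
        refine lintegral_congr fun ω => ?_
        rw [← ENNReal.ofReal_mul (Real.exp_pos _).le, ← Real.exp_add]; congr 2; ring
    _ = ENNReal.ofReal (Real.exp (-(c.κ₇ / 2 * t ^ 2))) *
        ∫⁻ ω in M.X n ⁻¹' A, ENNReal.ofReal (Real.exp (t * M.ε n ω k)) ∂M.P := by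
        have := M.measurable_ε n k
        rw [lintegral_const_mul]; fun_prop
    _ ≤ ENNReal.ofReal (Real.exp (-(c.κ₇ / 2 * t ^ 2))) *
        (ENNReal.ofReal (Real.exp (c.κ₇ / 2 * t ^ 2)) * M.P (M.X n ⁻¹' A)) := by gcongr
    _ = _ := by
        rw [← mul_assoc, ← ENNReal.ofReal_mul (Real.exp_pos _).le, ← Real.exp_add]; simp

/-- The sub-Gaussian bound with a tilt that depends on the context. -/
lemma lintegral_exp_noise_le_one (n : ℕ) (k : Fin M.K) {t : M.E → ℝ} (ht : Measurable t) :
    ∫⁻ ω, ENNReal.ofReal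
      (Real.exp (t (M.X n ω) * M.ε n ω k - c.κ₇ / 2 * t (M.X n ω) ^ 2)) ∂M.P ≤ 1 := by
  have hε := M.measurable_ε n k
  have hX := M.measurable_X n
  -- A simple tilt is constant on finitely many fibres; the bounds on the fibres add up to at most
  -- the total mass.
  have simple : ∀ t : SimpleFunc M.E ℝ, ∫⁻ ω, ENNReal.ofReal
      (Real.exp (t (M.X n ω) * M.ε n ω k - c.κ₇ / 2 * t (M.X n ω) ^ 2)) ∂M.P ≤ 1 := by
    intro t
    calc _ = ∫⁻ ω, ∑ v ∈ t.range, (M.X n ⁻¹' (t ⁻¹' {v})).indicator (fun ω =>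
            ENNReal.ofReal (Real.exp (v * M.ε n ω k - c.κ₇ / 2 * v ^ 2))) ω ∂M.P := by
          refine lintegral_congr fun ω => ?_
          rw [Finset.sum_eq_single (t (M.X n ω))]
          · rw [Set.indicator_of_mem]; simp
          · intro b _ hb
            rw [Set.indicator_of_notMem]
            simpa using fun h => hb h.symm
          · intro h; simp at h
      _ = ∑ v ∈ t.range, ∫⁻ ω in M.X n ⁻¹' (t ⁻¹' {v}),
            ENNReal.ofReal (Real.exp (v * M.ε n ω k - c.κ₇ / 2 * v ^ 2)) ∂M.P := by
          rw [lintegral_finsetSum]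
          · refine Finset.sum_congr rfl fun v _ => ?_
            rw [lintegral_indicator (hX (t.measurableSet_fiber v))]
          · intro v _
            exact Measurable.indicator (by fun_prop) (hX (t.measurableSet_fiber v))
      _ ≤ ∑ v ∈ t.range, M.P (M.X n ⁻¹' (t ⁻¹' {v})) :=
          Finset.sum_le_sum fun v _ => M.setLIntegral_exp_noise_le n k v (t.measurableSet_fiber v)
      _ = M.P (⋃ v ∈ t.range, M.X n ⁻¹' (t ⁻¹' {v})) := by
          rw [measure_biUnion_finset _ fun v _ => hX (t.measurableSet_fiber v)]
          intro v _ w _ hvw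
          refine Set.disjoint_left.2 fun ω h1 h2 => hvw ?_
          simp only [Set.mem_preimage, Set.mem_singleton_iff] at h1 h2
          exact h1.symm.trans h2
      _ ≤ 1 := prob_le_one
  -- A general tilt is a pointwise limit of simple ones, and Fatou's lemma preserves the bound.
  set T := ht.stronglyMeasurable.approx
  have hT : ∀ x, Filter.Tendsto (fun i => T i x) Filter.atTop (nhds (t x)) :=
    ht.stronglyMeasurable.tendsto_approx
  calc _ = ∫⁻ ω, Filter.liminf (fun i => ENNReal.ofReal (Real.exp
        (T i (M.X n ω) * M.ε n ω k - c.κ₇ / 2 * T i (M.X n ω) ^ 2))) Filter.atTop ∂M.P := by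
        refine lintegral_congr fun ω => (Filter.Tendsto.liminf_eq ?_).symm
        refine ENNReal.tendsto_ofReal ((Real.continuous_exp.tendsto _).comp ?_)
        exact ((hT _).mul_const _).sub (((hT _).pow 2).const_mul _)
    _ ≤ Filter.liminf (fun i => ∫⁻ ω, ENNReal.ofReal (Real.exp
        (T i (M.X n ω) * M.ε n ω k - c.κ₇ / 2 * T i (M.X n ω) ^ 2)) ∂M.P) Filter.atTop := by
        refine lintegral_liminf_le fun i => ?_
        have := (T i).measurable.comp hX
        simp only [Function.comp_def] at this
        fun_prop
    _ ≤ 1 := by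
        refine Filter.liminf_le_of_le (by isBoundedDefault) fun b hb => ?_
        obtain ⟨i, hi⟩ := hb.exists
        exact hi.trans (simple _)

lemma measurable_noise (n : ℕ) (k : Fin M.K) : Measurable[M.F n] fun ω => M.noise n ω k :=
  @measurable_sum_ite M.Ω (M.F n) _ _ _ M.E _ _ _ _ n (fun m ω => M.arm m ω) k
    (fun m ω => M.ε m ω k • M.X m ω) (fun _ hm => M.measurable_arm hm)
    (fun _ hm => @measurable_smul_apply _ (M.F n) _ _ _ _ k (M.measurable_ε_F hm)
      (M.measurable_X_F hm))

lemma measurable_gramForm (n : ℕ) (k : Fin M.K) (v w : M.E) :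
    Measurable[M.F n] fun ω => M.gramForm n ω k v w :=
  @measurable_sum_ite M.Ω (M.F n) _ _ _ ℝ _ _ _ _ n (fun m ω => M.arm m ω) k
    (fun m ω => ⟪M.X m ω, v⟫ * ⟪M.X m ω, w⟫) (fun _ hm => M.measurable_arm hm)
    (fun _ hm => @measurable_inner_mul_inner _ (M.F n) _ _ (M.measurable_X_F hm) v w)

lemma measurable_expWeight (n : ℕ) (k : Fin M.K) (θ : M.E) : Measurable[M.F n] fun ω =>
    ⟪θ, M.noise n ω k⟫ - c.κ₇ / 2 * M.gramForm n ω k θ θ :=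
  @measurable_inner_sub_mul _ (M.F n) _ _ _ (M.measurable_noise n k)
    (M.measurable_gramForm n k θ θ) θ (c.κ₇ / 2)

/-- Exponential supermartingale bound for the accumulated noise. -/
lemma lintegral_exp_noise_sum_le_one (n : ℕ) (k : Fin M.K) (θ : M.E) :
    ∫⁻ ω, ENNReal.ofReal (Real.exp (⟪θ, M.noise n ω k⟫ - c.κ₇ / 2 * M.gramForm n ω k θ θ)) ∂M.P
      ≤ 1 := by
  induction n with
  | zero => simp [noise, gramForm]
  | succ n ih =>
    -- The increment of `⟪θ, noise⟫` is `t (X n) * ε n k`. The tilt depends only on past and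
    -- context, because these determine the sampled alternative.
    let t : M.Ctrl → M.E → ℝ := fun s x => if M.pick n s x = k then ⟪x, θ⟫ else 0
    have ht : Measurable (Function.uncurry t) := by
      refine Measurable.ite (M.measurable_pick n (measurableSet_singleton k)) ?_ measurable_const
      exact measurable_snd.inner measurable_const
    let h : M.Ctrl → M.E × (Fin M.K → ℝ) → ℝ≥0∞ := fun s z =>
      ENNReal.ofReal (Real.exp (t s z.1 * z.2 k - c.κ₇ / 2 * t s z.1 ^ 2))
    have hh : Measurable (Function.uncurry h) := measurable_uncurry_tilt ht k (c.κ₇ / 2)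
    have hw : Measurable[M.F n] fun ω => ENNReal.ofReal
        (Real.exp (⟪θ, M.noise n ω k⟫ - c.κ₇ / 2 * M.gramForm n ω k θ θ)) := by
      exact ENNReal.measurable_ofReal.comp (Real.measurable_exp.comp (M.measurable_expWeight n k θ))
    calc _ = ∫⁻ ω, ENNReal.ofReal (Real.exp (⟪θ, M.noise n ω k⟫ - c.κ₇ / 2 *
          M.gramForm n ω k θ θ)) * h (M.ctrl n ω) (M.Z n ω) ∂M.P := by
          refine lintegral_congr fun ω => ?_
          rw [← ENNReal.ofReal_mul (Real.exp_pos _).le, ← Real.exp_add, noise_succ, gramForm_succ]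
          congr 2
          have : M.pick n (M.ctrl n ω) (M.Z n ω).1 = M.arm n ω := rfl
          simp only [t, this]
          split_ifs
          · simp only [Z, inner_add_right, inner_smul_right, real_inner_comm θ]
            ring
          · simp
      _ = _ := M.lintegral_period n hw (M.measurable_ctrl n) hh
      _ ≤ ∫⁻ ω, ENNReal.ofReal (Real.exp (⟪θ, M.noise n ω k⟫ - c.κ₇ / 2 *
          M.gramForm n ω k θ θ)) * 1 ∂M.P := by
          gcongr with ω
          exact M.lintegral_exp_noise_le_one n k (t := t (M.ctrl n ω)) (ht.of_uncurry_left)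
      _ ≤ 1 := by simpa using ih

lemma measure_noise_deviation_le (n : ℕ) (k : Fin M.K) (θ : M.E) (T : ℝ) :
    M.P {ω | T ≤ ⟪θ, M.noise n ω k⟫ - c.κ₇ / 2 * M.gramForm n ω k θ θ} ≤
      ENNReal.ofReal (Real.exp (-T)) := by
  have h := M.lintegral_exp_noise_sum_le_one n k θ
  set f : M.Ω → ℝ := fun ω => ⟪θ, M.noise n ω k⟫ - c.κ₇ / 2 * M.gramForm n ω k θ θ
  have hf : Measurable f := M.measurable_of_F (M.measurable_expWeight n k θ)
  have h1 := meas_ge_le_lintegral_div (μ := M.P) (f := fun ω => ENNReal.ofReal (Real.exp (f ω)))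
    (by fun_prop) (ε := ENNReal.ofReal (Real.exp T)) (by simp [Real.exp_pos])
    ENNReal.ofReal_ne_top
  refine (measure_mono fun ω hω => ?_).trans (h1.trans ?_)
  · exact ENNReal.ofReal_le_ofReal (Real.exp_le_exp.2 hω)
  · rw [Real.exp_neg, ENNReal.ofReal_inv_of_pos (Real.exp_pos _), ← one_div]
    gcongr

lemma gramForm_self_le {ω : M.Ω} (hω : ∀ n, ‖M.X n ω‖ ≤ c.κ₆) (n : ℕ) (k : Fin M.K) (v : M.E) :
    M.gramForm n ω k v v ≤ n * (c.κ₆ ^ 2 * ‖v‖ ^ 2) := by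
  have : ∀ m ∈ Finset.range n, (if M.arm m ω = k then ⟪M.X m ω, v⟫ * ⟪M.X m ω, v⟫ else 0) ≤
      c.κ₆ ^ 2 * ‖v‖ ^ 2 := by
    intro m _
    split_ifs
    · have h1 := abs_real_inner_le_norm (M.X m ω) v
      have h2 : ‖M.X m ω‖ * ‖v‖ ≤ c.κ₆ * ‖v‖ := by gcongr; exact hω m
      rw [← mul_pow, ← abs_mul_abs_self, sq]
      exact mul_self_le_mul_self (abs_nonneg _) (h1.trans h2)
    · positivity
  simpa [gramForm] using Finset.sum_le_sum this

lemma pow_four_le_exp (x : ℝ) : x ^ 4 ≤ 24 * (Real.exp x + Real.exp (-x)) := by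
  have key : ∀ x : ℝ, 0 ≤ x → x ^ 4 ≤ 24 * Real.exp x := by
    intro x hx
    have := Real.pow_div_factorial_le_exp x hx 4
    norm_num [Nat.factorial] at this
    linarith
  rcases le_total 0 x with h | h
  · linarith [key x h, Real.exp_pos (-x)]
  · have := key (-x) (by linarith)
    have h4 : (-x) ^ 4 = x ^ 4 := by ring
    linarith [Real.exp_pos x]

/-- Fourth moments of the accumulated noise. -/
lemma lintegral_norm_noise_pow_four_le (n : ℕ) (hn : 1 ≤ n) (k : Fin M.K) :
    ∫⁻ ω, ENNReal.ofReal (‖M.noise n ω k‖ ^ 4) ∂M.P ≤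
      ENNReal.ofReal (48 * M.d ^ 2 * Real.exp (c.κ₇ / 2 * c.κ₆ ^ 2) * n ^ 2) := by
  set e : Fin M.d → M.E := fun i => EuclideanSpace.single i 1
  have hn0 : (0 : ℝ) < n := by exact_mod_cast hn
  -- For `θ` of length `1 / √n` the compensator `κ₇ / 2 * gramForm θ θ` is bounded uniformly in `n`.
  set l : ℝ := 1 / Real.sqrt n with hl
  have hl2 : l ^ 2 = 1 / n := by rw [hl, div_pow, Real.sq_sqrt hn0.le, one_pow]
  have hN : Measurable fun ω => M.noise n ω k := M.measurable_of_F (M.measurable_noise n k)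
  have hexp : ∀ θ : M.E, ‖θ‖ = |l| → ∫⁻ ω, ENNReal.ofReal (Real.exp ⟪θ, M.noise n ω k⟫) ∂M.P ≤
      ENNReal.ofReal (Real.exp (c.κ₇ / 2 * c.κ₆ ^ 2)) := by
    intro θ hθ
    calc _ ≤ ∫⁻ ω, ENNReal.ofReal (Real.exp (c.κ₇ / 2 * c.κ₆ ^ 2)) * ENNReal.ofReal
          (Real.exp (⟪θ, M.noise n ω k⟫ - c.κ₇ / 2 * M.gramForm n ω k θ θ)) ∂M.P := by
          refine lintegral_mono_ae (M.ae_norm_X_le.mono fun ω hω => ?_)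
          rw [← ENNReal.ofReal_mul (Real.exp_pos _).le, ← Real.exp_add]
          refine ENNReal.ofReal_le_ofReal (Real.exp_le_exp.2 ?_)
          have h1 := M.gramForm_self_le hω n k θ
          rw [hθ, sq_abs, hl2] at h1
          have h2 : (n : ℝ) * (c.κ₆ ^ 2 * (1 / n)) = c.κ₆ ^ 2 := by field_simp
          rw [h2] at h1
          have := mul_le_mul_of_nonneg_left h1 (by linarith [c.hκ₇] : 0 ≤ c.κ₇ / 2)
          linarith
      _ ≤ ENNReal.ofReal (Real.exp (c.κ₇ / 2 * c.κ₆ ^ 2)) * 1 := by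
          rw [lintegral_const_mul' _ _ ENNReal.ofReal_ne_top]
          gcongr
          exact M.lintegral_exp_noise_sum_le_one n k θ
      _ = _ := mul_one _
  -- The Cauchy–Schwarz inequality reduces to coordinates at the cost of a factor `d`; the scaling
  -- by `l` is undone by the factor `n ^ 2`.
  have hpt : ∀ ω, ‖M.noise n ω k‖ ^ 4 ≤ M.d * ∑ i, (24 * n ^ 2) *
      (Real.exp ⟪l • e i, M.noise n ω k⟫ + Real.exp ⟪-(l • e i), M.noise n ω k⟫) := by
    intro ω
    have h1 : ‖M.noise n ω k‖ ^ 4 = (∑ i, M.noise n ω k i ^ 2) ^ 2 := by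
      rw [← EuclideanSpace.real_norm_sq_eq]; ring
    rw [h1]
    have h2 := sq_sum_le_card_mul_sum_sq (s := Finset.univ) (f := fun i => M.noise n ω k i ^ 2)
    rw [Finset.card_univ, Fintype.card_fin] at h2
    refine h2.trans ?_
    gcongr with i
    have h3 := pow_four_le_exp (l * M.noise n ω k i)
    have h4 : ⟪e i, M.noise n ω k⟫ = M.noise n ω k i := by simp [e, EuclideanSpace.inner_single_left]
    rw [inner_neg_left, inner_smul_left, h4]
    simp only [conj_trivial]
    have h5 : (l * M.noise n ω k i) ^ 4 = (1 / n) ^ 2 * (M.noise n ω k i ^ 2) ^ 2 := by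
      rw [← hl2]; ring
    rw [h5] at h3
    have h6 := mul_le_mul_of_nonneg_left h3 (by positivity : (0 : ℝ) ≤ n ^ 2)
    have h7 : (n : ℝ) ^ 2 * ((1 / n) ^ 2 * (M.noise n ω k i ^ 2) ^ 2) =
      (M.noise n ω k i ^ 2) ^ 2 := by field_simp
    rw [h7] at h6
    exact h6.trans_eq (by ring)
  calc _ ≤ ∫⁻ ω, ENNReal.ofReal (M.d * (24 * n ^ 2)) * ∑ i,
      (ENNReal.ofReal (Real.exp ⟪l • e i, M.noise n ω k⟫) +
        ENNReal.ofReal (Real.exp ⟪-(l • e i), M.noise n ω k⟫)) ∂M.P := by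
        refine lintegral_mono fun ω => ?_
        refine (ENNReal.ofReal_le_ofReal (hpt ω)).trans_eq ?_
        rw [← Finset.mul_sum, ← mul_assoc, ENNReal.ofReal_mul (by positivity),
          ENNReal.ofReal_sum_of_nonneg (fun i _ => by positivity)]
        congr 1
        exact Finset.sum_congr rfl fun i _ => ENNReal.ofReal_add (by positivity) (by positivity)
    _ = ENNReal.ofReal (M.d * (24 * n ^ 2)) * ∑ i,
      (∫⁻ ω, ENNReal.ofReal (Real.exp ⟪l • e i, M.noise n ω k⟫) ∂M.P +
        ∫⁻ ω, ENNReal.ofReal (Real.exp ⟪-(l • e i), M.noise n ω k⟫) ∂M.P) := by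
        have hm : ∀ θ : M.E, Measurable fun ω =>
            ENNReal.ofReal (Real.exp ⟪θ, M.noise n ω k⟫) := fun θ =>
          ENNReal.measurable_ofReal.comp (Real.measurable_exp.comp (measurable_const.inner hN))
        rw [lintegral_const_mul' _ _ ENNReal.ofReal_ne_top, lintegral_finsetSum]
        · congr 1
          exact Finset.sum_congr rfl fun i _ => lintegral_add_left (hm _) _
        · exact fun i _ => (hm _).add (hm _)
    _ ≤ ENNReal.ofReal (M.d * (24 * n ^ 2)) * ∑ i : Fin M.d,
      (ENNReal.ofReal (Real.exp (c.κ₇ / 2 * c.κ₆ ^ 2)) +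
        ENNReal.ofReal (Real.exp (c.κ₇ / 2 * c.κ₆ ^ 2))) := by
        gcongr with i
        · exact hexp _ (by simp [e, norm_smul])
        · exact hexp _ (by simp [e, norm_smul])
    _ = _ := by
        rw [← ENNReal.ofReal_add (by positivity) (by positivity), Finset.sum_const,
          Finset.card_univ, Fintype.card_fin, nsmul_eq_mul, ← ENNReal.ofReal_natCast,
          ← ENNReal.ofReal_mul (by positivity), ← ENNReal.ofReal_mul (by positivity)]
        congr 1; ring

end Model

/-! ### Concentration around conditional means, and its use for Gram forms. -/

/-- A crude form of Hoeffding's lemma. -/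
lemma lintegral_exp_mean_sub_le {Ω : Type*} [MeasurableSpace Ω] {P : Measure Ω}
    [IsProbabilityMeasure P] {Y : Ω → ℝ} (hY : AEStronglyMeasurable Y P) {B t : ℝ}
    (hB : ∀ᵐ ω ∂P, |Y ω| ≤ B) (ht : 0 ≤ t) (hBt : 2 * B * t ≤ 1) :
    ∫⁻ ω, ENNReal.ofReal (Real.exp (t * (∫ ω', Y ω' ∂P - Y ω))) ∂P ≤
      ENNReal.ofReal (Real.exp (4 * B ^ 2 * t ^ 2)) := by
  have hint : Integrable Y P := Integrable.of_bound hY B hB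
  set y := ∫ ω', Y ω' ∂P with hy
  have hyB : |y| ≤ B := by
    have := norm_integral_le_of_norm_le_const (μ := P) (f := Y) (C := B) (by simpa using hB)
    simpa using this
  -- This is `exp u ≤ 1 + u + u ^ 2` for `|u| ≤ 1`; the condition `2 * B * t ≤ 1` provides `|u| ≤
  -- 1`.
  have hle : ∀ᵐ ω ∂P, Real.exp (t * (y - Y ω)) ≤
      (1 + 4 * B ^ 2 * t ^ 2) + t * (y - Y ω) := by
    filter_upwards [hB] with ω hω
    have h1 : |y - Y ω| ≤ 2 * B := (abs_sub _ _).trans (by linarith)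
    have h2 : |t * (y - Y ω)| ≤ 2 * B * t := by
      rw [abs_mul, abs_of_nonneg ht]; nlinarith
    have h3 := (abs_le.1 (Real.abs_exp_sub_one_sub_id_le (h2.trans hBt))).2
    have h4 : (t * (y - Y ω)) ^ 2 ≤ (2 * B * t) ^ 2 := by
      rw [← sq_abs]; exact pow_le_pow_left₀ (abs_nonneg _) h2 2
    nlinarith
  have hint2 : Integrable (fun ω => (1 + 4 * B ^ 2 * t ^ 2) + t * (y - Y ω)) P :=
    (integrable_const _).add (((integrable_const _).sub hint).const_mul t)
  have hpos : 0 ≤ᵐ[P] fun ω => (1 + 4 * B ^ 2 * t ^ 2) + t * (y - Y ω) :=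
    hle.mono fun ω hω => (Real.exp_pos _).le.trans hω
  calc _ ≤ ∫⁻ ω, ENNReal.ofReal ((1 + 4 * B ^ 2 * t ^ 2) + t * (y - Y ω)) ∂P :=
        lintegral_mono_ae (hle.mono fun ω hω => ENNReal.ofReal_le_ofReal hω)
    _ = ENNReal.ofReal (∫ ω, ((1 + 4 * B ^ 2 * t ^ 2) + t * (y - Y ω)) ∂P) :=
        (ofReal_integral_eq_lintegral_ofReal hint2 hpos).symm
    _ ≤ _ := by
        refine ENNReal.ofReal_le_ofReal ?_
        have hint1 : Integrable (fun ω => t * (y - Y ω)) P :=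
          ((integrable_const _).sub hint).const_mul t
        rw [integral_add (integrable_const _) hint1,
          integral_const_mul, integral_sub (integrable_const _) hint]
        simp only [integral_const, probReal_univ, smul_eq_mul, one_mul, ← hy, sub_self, mul_zero,
          add_zero]
        linarith [Real.add_one_le_exp (4 * B ^ 2 * t ^ 2)]

lemma measurable_uncurry_exp_sub {α β γ : Type*} [MeasurableSpace α] [MeasurableSpace β]
    [MeasurableSpace γ] {f : α → β → ℝ} (hf : Measurable (Function.uncurry f)) {φ : α → ℝ}
    (hφ : Measurable φ) (t : ℝ) :
    Measurable (Function.uncurry fun (s : α) (z : β × γ) =>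
      ENNReal.ofReal (Real.exp (t * (φ s - f s z.1)))) := by
  have h1 : Measurable fun q : α × (β × γ) => Function.uncurry f (q.1, q.2.1) :=
    hf.comp (measurable_fst.prodMk measurable_snd.fst)
  have h2 : Measurable fun q : α × (β × γ) => φ q.1 := hφ.comp measurable_fst
  exact ENNReal.measurable_ofReal.comp (Real.measurable_exp.comp (measurable_const.mul (h2.sub h1)))

lemma measurable_uncurry_apply {Ω α β : Type*} [MeasurableSpace Ω] [MeasurableSpace α]
    [MeasurableSpace β] {f : α → β → ℝ} (hf : Measurable (Function.uncurry f)) {a : Ω → α}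
    {b : Ω → β} (ha : Measurable a) (hb : Measurable b) : Measurable fun ω => f (a ω) (b ω) :=
  hf.comp (ha.prodMk hb)

lemma measurable_exp_mul_sum {Ω : Type*} [MeasurableSpace Ω] (s : Finset ℕ) (f : ℕ → Ω → ℝ)
    (hf : ∀ m ∈ s, Measurable (f m)) (t : ℝ) :
    Measurable fun ω => ENNReal.ofReal (Real.exp (t * ∑ m ∈ s, f m ω)) :=
  ENNReal.measurable_ofReal.comp (Real.measurable_exp.comp
    (measurable_const.mul (Finset.measurable_fun_sum _ hf)))

namespace Model

variable {c : Constants} (M : Model.{u} c)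

instance : IsProbabilityMeasure M.ν := by
  rw [← M.obs.law 0]
  exact Measure.isProbabilityMeasure_map (M.measurable_X 0).aemeasurable

lemma integral_X (n : ℕ) {f : M.E → ℝ} (hf : Measurable f) :
    ∫ ω, f (M.X n ω) ∂M.P = ∫ x, f x ∂M.ν := by
  rw [← M.obs.law n, integral_map (M.measurable_X n).aemeasurable hf.aestronglyMeasurable]

lemma measurable_integral_ν {α : Type*} [MeasurableSpace α] {f : α → M.E → ℝ}
    (hf : Measurable (Function.uncurry f)) : Measurable fun s => ∫ x, f s x ∂M.ν :=
  hf.stronglyMeasurable.integral_prod_right.measurable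

/-- Exponential moments of sums of conditionally centred bounded variables. -/
lemma lintegral_exp_sum_mean_sub_le {f : ℕ → M.Ctrl → M.E → ℝ}
    (hf : ∀ m, Measurable (Function.uncurry (f m))) {B : ℝ}
    (hB : ∀ m s x, ‖x‖ ≤ c.κ₆ → |f m s x| ≤ B) {t : ℝ} (ht : 0 ≤ t) (hBt : 2 * B * t ≤ 1)
    (A : Finset ℕ) (n : ℕ) :
    ∫⁻ ω, ENNReal.ofReal (Real.exp (t * ∑ m ∈ (Finset.range n).filter (· ∈ A),
      (∫ x, f m (M.ctrl m ω) x ∂M.ν - f m (M.ctrl m ω) (M.X m ω)))) ∂M.P ≤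
      ENNReal.ofReal (Real.exp (4 * B ^ 2 * t ^ 2 * ((Finset.range n).filter (· ∈ A)).card)) := by
  -- The induction runs over all periods, so that the past is always `F n`; a period outside `A`
  -- leaves the sum unchanged.
  induction n with
  | zero => simp
  | succ n ih =>
    by_cases hn : n ∈ A
    swap
    · rw [Finset.range_add_one, Finset.filter_insert, if_neg hn]
      exact ih
    · rw [Finset.range_add_one, Finset.filter_insert, if_pos hn,
        Finset.card_insert_of_notMem (by simp)]
      have hmean := M.measurable_integral_ν (hf n)
      have hh : Measurable (Function.uncurry fun (s : M.Ctrl) (z : M.E × (Fin M.K → ℝ)) =>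
          ENNReal.ofReal (Real.exp (t * (∫ x, f n s x ∂M.ν - f n s z.1)))) :=
        measurable_uncurry_exp_sub (hf n) hmean t
      have hw : Measurable[M.F n] fun ω => ENNReal.ofReal (Real.exp (t *
          ∑ m ∈ (Finset.range n).filter (· ∈ A),
            (∫ x, f m (M.ctrl m ω) x ∂M.ν - f m (M.ctrl m ω) (M.X m ω)))) := by
        refine @measurable_exp_mul_sum M.Ω (M.F n) ((Finset.range n).filter (· ∈ A))
          (fun m ω => ∫ x, f m (M.ctrl m ω) x ∂M.ν - f m (M.ctrl m ω) (M.X m ω))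
          (fun m hm => ?_) t
        have hm : m < n := Finset.mem_range.1 (Finset.mem_filter.1 hm).1
        have hc := M.measurable_F_mono hm.le (M.measurable_ctrl m)
        have h1 : Measurable[M.F n] fun ω => f m (M.ctrl m ω) (M.X m ω) :=
          @measurable_uncurry_apply M.Ω _ _ (M.F n) _ _ _ (hf m) _ _ hc (M.measurable_X_F hm)
        have h2 : Measurable[M.F n] fun ω => ∫ x, f m (M.ctrl m ω) x ∂M.ν :=
          (M.measurable_integral_ν (hf m)).comp hc
        exact h2.sub h1
      calc _ = ∫⁻ ω, ENNReal.ofReal (Real.exp (t * ∑ m ∈ (Finset.range n).filter (· ∈ A),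
            (∫ x, f m (M.ctrl m ω) x ∂M.ν - f m (M.ctrl m ω) (M.X m ω)))) *
            (fun (s : M.Ctrl) (z : M.E × (Fin M.K → ℝ)) => ENNReal.ofReal (Real.exp (t *
              (∫ x, f n s x ∂M.ν - f n s z.1)))) (M.ctrl n ω) (M.Z n ω) ∂M.P := by
            refine lintegral_congr fun ω => ?_
            rw [Finset.sum_insert (by simp), ← ENNReal.ofReal_mul (Real.exp_pos _).le,
              ← Real.exp_add]
            congr 2
            simp only [Z]; ring
        _ = _ := M.lintegral_period n hw (M.measurable_ctrl n) hh
        _ ≤ ∫⁻ ω, ENNReal.ofReal (Real.exp (t * ∑ m ∈ (Finset.range n).filter (· ∈ A),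
            (∫ x, f m (M.ctrl m ω) x ∂M.ν - f m (M.ctrl m ω) (M.X m ω)))) *
            ENNReal.ofReal (Real.exp (4 * B ^ 2 * t ^ 2)) ∂M.P := by
            gcongr with ω
            have hfs : Measurable (f n (M.ctrl n ω)) := (hf n).of_uncurry_left
            rw [← M.integral_X n hfs]
            refine lintegral_exp_mean_sub_le (P := M.P)
              (Y := fun ω' => f n (M.ctrl n ω) (M.X n ω')) ?_ ?_ ht hBt
            · exact (hfs.comp (M.measurable_X n)).aestronglyMeasurable
            · exact M.ae_norm_X_le.mono fun ω' h => hB n _ _ (h n)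
        _ ≤ _ := by
            rw [lintegral_mul_const' _ _ ENNReal.ofReal_ne_top]
            refine (mul_le_mul_left ih _).trans_eq ?_
            rw [← ENNReal.ofReal_mul (Real.exp_pos _).le, ← Real.exp_add]
            congr 2
            push_cast; ring

/-- Concentration of sums of bounded variables around the sum of their conditional means. -/
lemma measure_sum_mean_sub_ge_le {f : ℕ → M.Ctrl → M.E → ℝ}
    (hf : ∀ m, Measurable (Function.uncurry (f m))) {B : ℝ} (hB0 : 0 < B)
    (hB : ∀ m s x, ‖x‖ ≤ c.κ₆ → |f m s x| ≤ B) {η : ℝ} (hη : 0 ≤ η) (hηB : η ≤ 4 * B)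
    (A : Finset ℕ) :
    M.P {ω | η * A.card ≤ ∑ m ∈ A,
      (∫ x, f m (M.ctrl m ω) x ∂M.ν - f m (M.ctrl m ω) (M.X m ω))} ≤
      ENNReal.ofReal (Real.exp (-(η ^ 2 / (16 * B ^ 2) * A.card))) := by
  obtain ⟨n, hn⟩ : ∃ n, A ⊆ Finset.range n := A.exists_nat_subset_range
  have hA : (Finset.range n).filter (· ∈ A) = A := by
    ext m
    simp only [Finset.mem_filter, and_iff_right_iff_imp]
    exact fun h => hn h
  -- The minimizer of `4 * B ^ 2 * t ^ 2 - η * t`; it satisfies `2 * B * t ≤ 1` exactly because `η ≤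
  -- 4 * B`.
  set t := η / (8 * B ^ 2) with ht
  have ht0 : 0 ≤ t := by positivity
  have hBt : 2 * B * t ≤ 1 := by
    rw [ht, mul_div_assoc', div_le_one (by positivity)]; nlinarith
  have h := M.lintegral_exp_sum_mean_sub_le hf hB ht0 hBt A n
  rw [hA] at h
  have hmeas : Measurable fun ω => ENNReal.ofReal (Real.exp (t * ∑ m ∈ A,
      (∫ x, f m (M.ctrl m ω) x ∂M.ν - f m (M.ctrl m ω) (M.X m ω)))) := by
    refine measurable_exp_mul_sum A
      (fun m ω => ∫ x, f m (M.ctrl m ω) x ∂M.ν - f m (M.ctrl m ω) (M.X m ω)) (fun m _ => ?_) t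
    have hc := M.measurable_of_F (M.measurable_ctrl m)
    exact ((M.measurable_integral_ν (hf m)).comp hc).sub
      (measurable_uncurry_apply (hf m) hc (M.measurable_X m))
  have h1 := meas_ge_le_lintegral_div (μ := M.P) hmeas.aemeasurable
    (ε := ENNReal.ofReal (Real.exp (t * (η * A.card)))) (by simp [Real.exp_pos])
    ENNReal.ofReal_ne_top
  refine (measure_mono fun ω hω => ?_).trans (h1.trans ?_)
  · exact ENNReal.ofReal_le_ofReal (Real.exp_le_exp.2 (mul_le_mul_of_nonneg_left hω ht0))
  · refine (ENNReal.div_le_div_right h _).trans_eq ?_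
    rw [← ENNReal.ofReal_div_of_pos (Real.exp_pos _), ← Real.exp_sub]
    congr 2
    rw [ht]; field_simp; ring

/-- The second moment of the context in the direction `v`, on the event that `k` is sampled. -/
def infoForm (m : ℕ) (s : M.Ctrl) (k : Fin M.K) (v : M.E) : ℝ :=
  ∫ x, (if M.pick m s x = k then ⟪x, v⟫ ^ 2 else 0) ∂M.ν

lemma abs_apply_le {d : ℕ} (x : EuclideanSpace ℝ (Fin d)) (i : Fin d) : |x i| ≤ ‖x‖ := by
  simpa using PiLp.norm_apply_le x i

lemma measurable_entry (m : ℕ) (k : Fin M.K) (i j : Fin M.d) :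
    Measurable (Function.uncurry fun (s : M.Ctrl) (x : M.E) =>
      if M.pick m s x = k then x i * x j else 0) :=
  Measurable.ite (M.measurable_pick m (measurableSet_singleton k))
    ((by fun_prop : Measurable fun x : M.E => x i * x j).comp measurable_snd) measurable_const

lemma abs_entry_le (m : ℕ) (s : M.Ctrl) (k : Fin M.K) (i j : Fin M.d) {x : M.E}
    (hx : ‖x‖ ≤ c.κ₆) : |if M.pick m s x = k then x i * x j else 0| ≤ c.κ₆ ^ 2 := by
  split_ifs
  · rw [abs_mul, sq]
    exact mul_le_mul ((abs_apply_le x i).trans hx) ((abs_apply_le x j).trans hx) (abs_nonneg _)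
      c.hκ₆.le
  · simp; positivity

lemma inner_sq_eq_sum {d : ℕ} (x v : EuclideanSpace ℝ (Fin d)) :
    ⟪x, v⟫ ^ 2 = ∑ i, ∑ j, v i * v j * (x i * x j) := by
  have : ⟪x, v⟫ = ∑ i, v i * x i := by
    rw [EuclideanSpace.inner_eq_star_dotProduct]; simp [dotProduct]
  rw [this, sq, Finset.sum_mul_sum]
  exact Finset.sum_congr rfl fun i _ => Finset.sum_congr rfl fun j _ => by ring

lemma integrable_entry (m : ℕ) (s : M.Ctrl) (k : Fin M.K) (i j : Fin M.d) :
    Integrable (fun x : M.E => if M.pick m s x = k then x i * x j else 0) M.ν :=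
  Integrable.of_bound (M.measurable_entry m k i j).of_uncurry_left.aestronglyMeasurable
    (c.κ₆ ^ 2) (M.margin.bounded.mono fun _ hx => M.abs_entry_le m s k i j hx)

lemma infoForm_eq_sum (m : ℕ) (s : M.Ctrl) (k : Fin M.K) (v : M.E) :
    M.infoForm m s k v =
      ∑ i, ∑ j, v i * v j * ∫ x, (if M.pick m s x = k then x i * x j else 0) ∂M.ν := by
  simp only [← integral_const_mul]
  have h := fun i j => (M.integrable_entry m s k i j).const_mul (v i * v j)
  rw [infoForm]
  calc _ = ∫ x, ∑ i, ∑ j, v i * v j * (if M.pick m s x = k then x i * x j else 0) ∂M.ν := by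
        refine integral_congr_ae (Filter.Eventually.of_forall fun x => ?_)
        simp only
        split_ifs
        · exact inner_sq_eq_sum x v
        · simp
    _ = _ := by
        rw [integral_finsetSum _ fun i _ => integrable_finsetSum _ fun j _ => h i j]
        exact Finset.sum_congr rfl fun i _ => integral_finsetSum _ fun j _ => h i j

/-- Concentration of the Gram form, uniformly over directions. -/
lemma measure_gramForm_lt_le (n : ℕ) (k : Fin M.K) (A : Finset ℕ) (hA : A ⊆ Finset.range n) {η : ℝ}
    (hη : 0 ≤ η) (hη6 : η ≤ 4 * c.κ₆ ^ 2) :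
    M.P {ω | ∃ v : M.E, M.gramForm n ω k v v <
      ∑ m ∈ A, M.infoForm m (M.ctrl m ω) k v - η * M.d * A.card * ‖v‖ ^ 2} ≤
      ENNReal.ofReal (2 * M.d ^ 2 * Real.exp (-(η ^ 2 / (16 * c.κ₆ ^ 4) * A.card))) := by
  set f : Fin M.d → Fin M.d → ℕ → M.Ctrl → M.E → ℝ := fun i j m s x =>
    if M.pick m s x = k then x i * x j else 0 with hf
  set Dev : Fin M.d → Fin M.d → M.Ω → ℝ := fun i j ω => ∑ m ∈ A,
      (∫ x, f i j m (M.ctrl m ω) x ∂M.ν - f i j m (M.ctrl m ω) (M.X m ω)) with hDev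
  set b := ENNReal.ofReal (Real.exp (-(η ^ 2 / (16 * (c.κ₆ ^ 2) ^ 2) * A.card))) with hb
  have h1 : ∀ i j, M.P {ω | η * A.card ≤ Dev i j ω} ≤ b := fun i j =>
    M.measure_sum_mean_sub_ge_le (f := f i j) (fun m => M.measurable_entry m k i j)
      (B := c.κ₆ ^ 2) (by have := c.hκ₆; positivity) (fun m s x hx => M.abs_entry_le m s k i j hx)
      hη hη6 A
  have h2 : ∀ i j, M.P {ω | η * A.card ≤ -Dev i j ω} ≤ b := fun i j => by
    have := M.measure_sum_mean_sub_ge_le (f := fun m s x => -f i j m s x)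
      (fun m => (M.measurable_entry m k i j).neg)
      (B := c.κ₆ ^ 2) (by have := c.hκ₆; positivity) (fun m s x hx => by
        rw [abs_neg]; exact M.abs_entry_le m s k i j hx) hη hη6 A
    refine (measure_mono fun ω hω => ?_).trans this
    refine le_trans (α := ℝ) hω (le_of_eq ?_)
    simp only [Dev, ← Finset.sum_neg_distrib, integral_neg]
    exact Finset.sum_congr rfl fun m _ => by ring
  -- If all `d ^ 2` entries deviate by less than `η * A.card`, in both directions, then the form in
  -- direction `v` deviates by at most `(∑ |v i|) ^ 2 * η * A.card`, and `(∑ |v i|) ^ 2 ≤ d * ‖v‖ ^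
  -- 2`. Uniformity in `v` thus needs no net.
  have hsub : {ω | ∃ v : M.E, M.gramForm n ω k v v <
      ∑ m ∈ A, M.infoForm m (M.ctrl m ω) k v - η * M.d * A.card * ‖v‖ ^ 2} ⊆
      ⋃ i, ⋃ j, ({ω | η * A.card ≤ Dev i j ω} ∪ {ω | η * A.card ≤ -Dev i j ω}) := by
    rintro ω ⟨v, hv⟩
    by_contra hcon
    simp only [Set.mem_iUnion, Set.mem_union, Set.mem_ofPred_eq, not_exists, not_or, not_le] at hcon
    have habs : ∀ i j, |Dev i j ω| ≤ η * A.card := fun i j =>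
      abs_le.2 ⟨by linarith [(hcon i j).2], (hcon i j).1.le⟩
    -- Periods outside `A` only add squares to the Gram form.
    have hgram : ∑ m ∈ A, (if M.arm m ω = k then ⟪M.X m ω, v⟫ ^ 2 else 0) ≤
        M.gramForm n ω k v v := by
      simp only [gramForm, ← sq]
      refine Finset.sum_le_sum_of_subset_of_nonneg hA fun m _ _ => ?_
      split_ifs <;> positivity
    have hsum : ∑ m ∈ A, M.infoForm m (M.ctrl m ω) k v -
        ∑ m ∈ A, (if M.arm m ω = k then ⟪M.X m ω, v⟫ ^ 2 else 0) =
        ∑ i, ∑ j, v i * v j * Dev i j ω := by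
      rw [← Finset.sum_sub_distrib]
      simp only [Dev, Finset.mul_sum]
      rw [Finset.sum_congr rfl fun i _ => Finset.sum_comm, Finset.sum_comm]
      refine Finset.sum_congr rfl fun m _ => ?_
      have harm : ∀ i j, f i j m (M.ctrl m ω) (M.X m ω) =
        if M.arm m ω = k then M.X m ω i * M.X m ω j else 0 := fun i j => rfl
      simp only [harm, mul_sub, Finset.sum_sub_distrib, infoForm_eq_sum]
      congr 1
      split_ifs
      · exact inner_sq_eq_sum _ v
      · simp
    have hbound : ∑ i, ∑ j, v i * v j * Dev i j ω ≤ η * A.card * (M.d * ‖v‖ ^ 2) := by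
      calc _ ≤ ∑ i, ∑ j, |v i| * |v j| * (η * A.card) := by
            refine Finset.sum_le_sum fun i _ => Finset.sum_le_sum fun j _ => ?_
            refine (le_abs_self _).trans ?_
            rw [abs_mul, abs_mul]
            exact mul_le_mul_of_nonneg_left (habs i j) (by positivity)
        _ = (∑ i, |v i|) ^ 2 * (η * A.card) := by
            simp only [← Finset.sum_mul]
            rw [sq, Finset.sum_mul_sum]
        _ ≤ (M.d * ‖v‖ ^ 2) * (η * A.card) := by
            gcongr
            have := sq_sum_le_card_mul_sum_sq (s := Finset.univ) (f := fun i => |v i|)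
            simp only [Finset.card_univ, Fintype.card_fin, sq_abs] at this
            rwa [← EuclideanSpace.real_norm_sq_eq] at this
        _ = _ := by ring
    linarith
  refine (measure_mono hsub).trans ?_
  refine (measure_iUnion_fintype_le _ _).trans ?_
  calc _ ≤ ∑ _i : Fin M.d, ∑ _j : Fin M.d, (b + b) := by
        gcongr with i
        refine (measure_iUnion_fintype_le _ _).trans ?_
        gcongr with j
        exact (measure_union_le _ _).trans (add_le_add (h1 i j) (h2 i j))
    _ = _ := by
        rw [hb, ← ENNReal.ofReal_add (by positivity) (by positivity)]
        simp only [Finset.sum_const, Finset.card_univ, Fintype.card_fin, nsmul_eq_mul]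
        rw [← ENNReal.ofReal_natCast, ← ENNReal.ofReal_mul (by positivity),
          ← ENNReal.ofReal_mul (by positivity)]
        congr 1
        rw [show (c.κ₆ ^ 2) ^ 2 = c.κ₆ ^ 4 by ring]; ring

end Model

/-! ### Geometry of the decision rule: continuity, optimality, drift and information. -/

namespace Model

variable {c : Constants} (M : Model.{u} c)

lemma measurable_opt : Measurable M.opt :=
  measurable_decision M.argmin measurable_const measurable_const measurable_id

lemma measurable_adjCost (b : Fin M.K → M.E) (g : Fin M.K → ℝ) (j : Fin M.K) :
    Measurable fun x => adjCost b g x j :=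
  (measurable_const.inner measurable_id).sub measurable_const

lemma measurable_gap (g : Fin M.K → ℝ) (j k : Fin M.K) : Measurable (gap M.β g j k) :=
  (M.measurable_adjCost _ _ _).sub (M.measurable_adjCost _ _ _)

lemma measurable_dec_right (s : M.Ctrl) : Measurable (M.dec s) := M.measurable_dec.of_uncurry_left

lemma decision_le (b : Fin M.K → M.E) (g : Fin M.K → ℝ) (x : M.E) (j : Fin M.K) :
    adjCost b g x (decision M.I.sel b g x) ≤ adjCost b g x j := M.argmin.le _ j

lemma gap_measure_le {j k : Fin M.K} (hjk : j ≠ k) {u w : ℝ} (hu : -c.κ₁ ≤ u) (huw : u ≤ w)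
    (hw : w ≤ c.κ₁) :
    M.ν.real {x | u ≤ gap M.β M.gstar j k x ∧ gap M.β M.gstar j k x ≤ w} ≤ c.κ₃ * (w - u) := by
  obtain ⟨f, hf, hmap, hb⟩ := M.margin.density j k hjk
  have h1 : M.ν {x | u ≤ gap M.β M.gstar j k x ∧ gap M.β M.gstar j k x ≤ w} =
      ∫⁻ z in Set.Icc u w, f z := by
    rw [← withDensity_apply _ measurableSet_Icc, ← hmap,
      Measure.map_apply (M.measurable_gap _ j k) measurableSet_Icc]
    rfl
  have h2 : ∫⁻ z in Set.Icc u w, f z ≤ ENNReal.ofReal c.κ₃ * volume (Set.Icc u w) := by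
    rw [← setLIntegral_const]
    exact setLIntegral_mono measurable_const fun z hz =>
      (hb z ⟨hu.trans hz.1, hz.2.trans hw⟩).2
  rw [Real.volume_Icc, ← ENNReal.ofReal_mul c.hκ₃.le] at h2
  rw [measureReal_def, h1]
  exact ENNReal.toReal_le_of_le_ofReal (mul_nonneg c.hκ₃.le (by linarith)) h2

lemma le_gap_measure {j k : Fin M.K} (hjk : j ≠ k) {w : ℝ} (hw0 : 0 ≤ w) (hw : w ≤ c.κ₁) :
    c.κ₂ * w ≤ M.ν.real {x | 0 < gap M.β M.gstar j k x ∧ gap M.β M.gstar j k x ≤ w} := by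
  obtain ⟨f, hf, hmap, hb⟩ := M.margin.density j k hjk
  have h1 : M.ν {x | 0 < gap M.β M.gstar j k x ∧ gap M.β M.gstar j k x ≤ w} =
      ∫⁻ z in Set.Ioc 0 w, f z := by
    rw [← withDensity_apply _ measurableSet_Ioc, ← hmap,
      Measure.map_apply (M.measurable_gap _ j k) measurableSet_Ioc]
    rfl
  have h2 : ENNReal.ofReal c.κ₂ * volume (Set.Ioc 0 w) ≤ ∫⁻ z in Set.Ioc 0 w, f z := by
    rw [← setLIntegral_const]
    exact setLIntegral_mono hf fun z hz =>
      (hb z ⟨by linarith [hz.1, c.hκ₁], hz.2.trans hw⟩).1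
  rw [Real.volume_Ioc, ← ENNReal.ofReal_mul c.hκ₂.le, sub_zero, ← h1] at h2
  rw [measureReal_def]
  exact (ENNReal.ofReal_le_iff_le_toReal (measure_ne_top _ _)).1 h2

lemma abs_inner_sub_le {x : M.E} (hx : ‖x‖ ≤ c.κ₆) {b b' : M.E} {δ : ℝ} (h : ‖b - b'‖ ≤ δ) :
    |⟪b, x⟫ - ⟪b', x⟫| ≤ c.κ₆ * δ := by
  rw [← inner_sub_left, mul_comm]
  exact (abs_real_inner_le_norm _ _).trans (mul_le_mul h hx (norm_nonneg _)
    ((norm_nonneg _).trans h))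

/-- Continuity of the decision rule in its parameters. -/
lemma measure_decision_ne_le {b : Fin M.K → M.E} {g g' : Fin M.K → ℝ} {δ Δ r : ℝ} (hδ : 0 ≤ δ)
    (hr : 0 ≤ r) (hb : ∀ j, ‖b j - M.β j‖ ≤ δ)
    (hg : ∀ j k, |(g j - M.gstar j) - (g k - M.gstar k)| ≤ Δ)
    (hg' : ∀ j k, (g' j - g j) - (g' k - g k) ≤ r) (hsmall : Δ + 2 * c.κ₆ * δ + r ≤ c.κ₁) :
    M.ν.real {x | M.dec (g, M.β) x ≠ M.dec (g', b) x} ≤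
      (M.K : ℝ) ^ 2 * (c.κ₃ * (2 * c.κ₆ * δ + r)) := by
  set q := 2 * c.κ₆ * δ + r with hq
  have hq0 : 0 ≤ q := by have := c.hκ₆; positivity
  -- If `(g, β)` chooses `j` and `(g', b)` chooses `k`, both minimality inequalities trap the
  -- optimal gap of `k` over `j` in a window of length `q`. By `hsmall` the window lies in `[-κ₁,
  -- κ₁]`, where the density is at most `κ₃`.
  let B : Fin M.K → Fin M.K → Set M.E := fun k j => if k = j then ∅ else
    {x | (g k - M.gstar k) - (g j - M.gstar j) ≤ gap M.β M.gstar k j x ∧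
      gap M.β M.gstar k j x ≤ (g k - M.gstar k) - (g j - M.gstar j) + q}
  have hB : ∀ k j, M.ν.real (B k j) ≤ c.κ₃ * q := by
    intro k j
    by_cases hkj : k = j
    · simp only [B, if_pos hkj, measureReal_empty]
      exact mul_nonneg c.hκ₃.le hq0
    · simp only [B, if_neg hkj]
      have h1 := abs_le.1 (hg k j)
      refine (M.gap_measure_le hkj (by linarith) (by linarith) (by linarith)).trans_eq ?_
      ring
  have hsub : {x | M.dec (g, M.β) x ≠ M.dec (g', b) x} ≤ᵐ[M.ν] ⋃ k, ⋃ j, B k j := by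
    filter_upwards [M.margin.bounded] with x hx hne
    have hne : M.dec (g, M.β) x ≠ M.dec (g', b) x := hne
    refine Set.mem_iUnion.2 ⟨M.dec (g', b) x, Set.mem_iUnion.2 ⟨M.dec (g, M.β) x, ?_⟩⟩
    have hne' : ¬ M.dec (g', b) x = M.dec (g, M.β) x := fun h => hne h.symm
    simp only [B, if_neg hne']
    have h1 : adjCost M.β g x (M.dec (g, M.β) x) ≤ _ :=
      M.decision_le M.β g x (M.dec (g', b) x)
    have h2 : adjCost b g' x (M.dec (g', b) x) ≤ _ := M.decision_le b g' x (M.dec (g, M.β) x)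
    have h3 := hg' (M.dec (g', b) x) (M.dec (g, M.β) x)
    generalize M.dec (g', b) x = k at *
    generalize M.dec (g, M.β) x = j at *
    have h4 := abs_le.1 (M.abs_inner_sub_le hx (hb k))
    have h5 := abs_le.1 (M.abs_inner_sub_le hx (hb j))
    simp only [adjCost] at h1 h2
    refine ⟨?_, ?_⟩ <;> simp only [gap, adjCost] <;> linarith [h4.1, h4.2, h5.1, h5.2]
  calc _ ≤ M.ν.real (⋃ k, ⋃ j, B k j) := by
        rw [measureReal_def, measureReal_def]
        exact ENNReal.toReal_mono (measure_ne_top _ _) (measure_mono_ae hsub)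
    _ ≤ ∑ k, ∑ j, M.ν.real (B k j) :=
        (measureReal_iUnion_fintype_le _).trans
          (Finset.sum_le_sum fun k _ => measureReal_iUnion_fintype_le _)
    _ ≤ ∑ _k : Fin M.K, ∑ _j : Fin M.K, c.κ₃ * q :=
        Finset.sum_le_sum fun k _ => Finset.sum_le_sum fun j _ => hB k j
    _ = _ := by simp; ring

lemma measure_dec_ne_opt_le {b : Fin M.K → M.E} {g : Fin M.K → ℝ} {δ r : ℝ} (hδ : 0 ≤ δ)
    (hr : 0 ≤ r) (hb : ∀ j, ‖b j - M.β j‖ ≤ δ)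
    (hg : ∀ j k, (g j - M.gstar j) - (g k - M.gstar k) ≤ r) (hsmall : 2 * c.κ₆ * δ + r ≤ c.κ₁) :
    M.ν.real {x | M.dec (g, b) x ≠ M.opt x} ≤
      (M.K : ℝ) ^ 2 * (c.κ₃ * (2 * c.κ₆ * δ + r)) := by
  have := M.measure_decision_ne_le (g := M.gstar) (g' := g) (Δ := 0) hδ hr hb (by simp) hg
    (by linarith)
  have e : {x | M.dec (g, b) x ≠ M.opt x} = {x | M.dec (M.gstar, M.β) x ≠ M.dec (g, b) x} := by
    ext x; exact ne_comm
  rw [e]; exact this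

lemma integrable_comp_index (y : Fin M.K → ℝ) {f : M.E → Fin M.K} (hf : Measurable f) :
    Integrable (fun x => y (f x)) M.ν := by
  refine Integrable.of_bound ((measurable_of_finite y).comp hf).aestronglyMeasurable (∑ k, |y k|) ?_
  refine Filter.Eventually.of_forall fun x => ?_
  exact Finset.single_le_sum (f := fun k => |y k|) (fun k _ => abs_nonneg _) (Finset.mem_univ _)

lemma integral_index_sub_le (y : Fin M.K → ℝ) {f f' : M.E → Fin M.K} (hf : Measurable f)
    (hf' : Measurable f') {Y : ℝ} (hY : ∀ j k, y j - y k ≤ Y) :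
    ∫ x, (y (f x) - y (f' x)) ∂M.ν ≤ Y * M.ν.real {x | f x ≠ f' x} := by
  have hms : MeasurableSet {x | f x ≠ f' x} := (measurableSet_eq_fun hf hf').compl
  calc _ ≤ ∫ x, {x | f x ≠ f' x}.indicator (fun _ => Y) x ∂M.ν := by
        refine integral_mono ((M.integrable_comp_index y hf).sub (M.integrable_comp_index y hf'))
          ((integrable_const Y).indicator hms) fun x => ?_
        by_cases h : f x = f' x
        · simp [h]
        · rw [Set.indicator_of_mem (by exact h)]; exact hY _ _
    _ = _ := by rw [integral_indicator_const _ hms, smul_eq_mul, mul_comm]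

lemma iInf_adjCost (b : Fin M.K → M.E) (g : Fin M.K → ℝ) (x : M.E) :
    ⨅ j, adjCost b g x j = adjCost b g x (decision M.I.sel b g x) :=
  le_antisymm (ciInf_le (Set.finite_range _).bddBelow _) (le_ciInf fun j => M.decision_le b g x j)

lemma integrable_iInf_adjCost (g : Fin M.K → ℝ) :
    Integrable (fun x => ⨅ j, adjCost M.β g x j) M.ν := by
  refine Integrable.of_bound
    (Measurable.iInf fun j => M.measurable_adjCost M.β g j).aestronglyMeasurable
    (c.κ₆ * c.R + ∑ k, |g k|) ?_
  filter_upwards [M.margin.bounded] with x hx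
  rw [iInf_adjCost, adjCost]
  refine (norm_sub_le _ _).trans (add_le_add ?_ ?_)
  · simpa using M.abs_inner_sub_le hx (b' := 0) (b := M.β _) (by simpa using M.norm_β _)
  · exact Finset.single_le_sum (f := fun k => |g k|) (fun k _ => abs_nonneg _) (Finset.mem_univ _)

/-- First-order optimality, as an inequality for all directions. -/
lemma sum_p_mul_le (y : Fin M.K → ℝ) : ∑ k, M.I.p k * y k ≤ ∫ x, y (M.opt x) ∂M.ν := by
  set Y := 2 * ∑ k, |y k| with hYdef
  have hY0 : 0 ≤ Y := by positivity
  have hY : ∀ j k, y j - y k ≤ Y := fun j k => by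
    have h := fun j => Finset.single_le_sum (f := fun k => |y k|) (fun k _ => abs_nonneg _)
      (Finset.mem_univ j)
    linarith [h j, h k, le_abs_self (y j), neg_abs_le (y k)]
  -- The optimum is compared with `gstar + t * y`. The decision there differs from the optimal one
  -- with probability of order `t`, so the inequality holds up to an error that vanishes with `t`.
  have key : ∀ t, 0 < t → t * Y ≤ c.κ₁ → ∑ k, M.I.p k * y k ≤
      ∫ x, y (M.opt x) ∂M.ν + t * (Y * ((M.K : ℝ) ^ 2 * (c.κ₃ * Y))) := by
    intro t ht htY
    set g := fun k => M.gstar k + t * y k with hg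
    have h1 := M.optimal g
    have hp : ∑ k, M.I.p k * g k = ∑ k, M.I.p k * M.gstar k + t * ∑ k, M.I.p k * y k := by
      simp only [hg, mul_add, Finset.sum_add_distrib, Finset.mul_sum]
      congr 1
      exact Finset.sum_congr rfl fun k _ => by ring
    have hmd := M.measurable_dec_right (g, M.β)
    -- At the perturbed vector the minimum is attained by `dec (g, β)`, which is a competitor for
    -- the minimum at `gstar`.
    have h2 : ∫ x, (⨅ j, adjCost M.β M.gstar x j) ∂M.ν - t * ∫ x, y (M.dec (g, M.β) x) ∂M.ν ≤
        ∫ x, (⨅ j, adjCost M.β g x j) ∂M.ν := by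
      rw [← integral_const_mul, ← integral_sub (M.integrable_iInf_adjCost _)
        ((M.integrable_comp_index y hmd).const_mul t)]
      refine integral_mono ((M.integrable_iInf_adjCost _).sub
        ((M.integrable_comp_index y hmd).const_mul t)) (M.integrable_iInf_adjCost _) fun x => ?_
      simp only [iInf_adjCost]
      have := M.decision_le M.β M.gstar x (M.dec (g, M.β) x)
      change _ ≤ adjCost M.β g x (M.dec (g, M.β) x)
      simp only [adjCost, hg] at this ⊢
      linarith
    rw [dualObjective, dualObjective, hp] at h1
    have h3 : ∑ k, M.I.p k * y k ≤ ∫ x, y (M.dec (g, M.β) x) ∂M.ν := by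
      have : t * ∑ k, M.I.p k * y k ≤ t * ∫ x, y (M.dec (g, M.β) x) ∂M.ν := by linarith
      exact le_of_mul_le_mul_left this ht
    have h4 := M.integral_index_sub_le y hmd M.measurable_opt hY
    have h5 := M.measure_dec_ne_opt_le (b := M.β) (g := g) (δ := 0) (r := t * Y) le_rfl
      (by positivity) (by simp) (fun j k => by
        simp only [hg]
        have := mul_le_mul_of_nonneg_left (hY j k) ht.le
        linarith) (by linarith)
    rw [integral_sub (M.integrable_comp_index y hmd) (M.integrable_comp_index y M.measurable_opt)]
      at h4
    have h6 := mul_le_mul_of_nonneg_left h5 hY0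
    have e : Y * ((M.K : ℝ) ^ 2 * (c.κ₃ * (2 * c.κ₆ * 0 + t * Y))) =
      t * (Y * ((M.K : ℝ) ^ 2 * (c.κ₃ * Y))) := by ring
    linarith
  have hlim : Filter.Tendsto (fun t : ℝ => ∫ x, y (M.opt x) ∂M.ν +
      t * (Y * ((M.K : ℝ) ^ 2 * (c.κ₃ * Y)))) (nhdsWithin 0 (Set.Ioi 0))
      (nhds (∫ x, y (M.opt x) ∂M.ν + 0 * (Y * ((M.K : ℝ) ^ 2 * (c.κ₃ * Y))))) := by
    refine Filter.Tendsto.mono_left ?_ nhdsWithin_le_nhds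
    exact (Continuous.tendsto (by fun_prop) 0)
  rw [zero_mul, add_zero] at hlim
  refine ge_of_tendsto hlim ?_
  have h1 : ∀ᶠ t : ℝ in nhdsWithin 0 (Set.Ioi 0), t * Y < c.κ₁ := by
    refine Filter.Eventually.filter_mono nhdsWithin_le_nhds ?_
    exact (Continuous.tendsto' (f := fun t : ℝ => t * Y) (by fun_prop) 0 0 (by simp)).eventually_lt_const
      c.hκ₁
  filter_upwards [h1, self_mem_nhdsWithin] with t ht ht0
  exact key t ht0 ht.le

/-- Equality follows from the one-sided condition for `y` and `-y`. For an indicator `y` it says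
that the optimal decision equals `k` with probability `p k`. -/
lemma sum_p_mul (y : Fin M.K → ℝ) : ∑ k, M.I.p k * y k = ∫ x, y (M.opt x) ∂M.ν := by
  refine le_antisymm (M.sum_p_mul_le y) ?_
  have := M.sum_p_mul_le (fun k => -y k)
  simp only [mul_neg, Finset.sum_neg_distrib, integral_neg] at this
  linarith

/-- The drift of the dual vector in the direction `g - gstar`. -/
def drift (s : M.Ctrl) : ℝ :=
  ∫ x, ((s.1 (M.opt x) - M.gstar (M.opt x)) - (s.1 (M.dec s x) - M.gstar (M.dec s x))) ∂M.ν

lemma opt_eq_of_gap_pos {x : M.E} {k : Fin M.K} (h : ∀ l, l ≠ k → 0 < gap M.β M.gstar l k x) :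
    M.opt x = k := by
  by_contra hne
  have h1 := h _ hne
  have h2 : adjCost M.β M.gstar x (M.opt x) ≤ _ := M.decision_le M.β M.gstar x k
  simp only [gap] at h1
  linarith

/-- The gap of `j` over `k` lies in `(0, w]` with probability at least `κ₂ * w`. By richness, on a
fraction `κ₅` of this event all other alternatives cost more than `k` by at least `κ₄ > 0`; there
`k` is optimal and `j` is a close second. -/
lemma le_measure_opt_near {j k : Fin M.K} (hjk : j ≠ k) {w : ℝ} (hw0 : 0 < w) (hw : w < c.κ₁) :
    c.κ₂ * c.κ₅ * w ≤ M.ν.real {x | M.opt x = k ∧ gap M.β M.gstar j k x ≤ w} := by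
  set A := {x | 0 < gap M.β M.gstar j k x ∧ gap M.β M.gstar j k x ≤ w} with hA
  set B := {x | ∀ l : Fin M.K, l ≠ j → l ≠ k → c.κ₄ ≤ gap M.β M.gstar l k x}
  have h1 : c.κ₂ * w ≤ M.ν.real A := M.le_gap_measure hjk hw0.le hw.le
  have h2 : c.κ₅ ≤ (M.ν[|A]).real B := M.margin.rich j k hjk w hw0 hw
  have hAm : MeasurableSet A := (measurableSet_lt measurable_const (M.measurable_gap _ j k)).inter
    (measurableSet_le (M.measurable_gap _ j k) measurable_const)
  have hpos : 0 < M.ν.real A := lt_of_lt_of_le (mul_pos c.hκ₂ hw0) h1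
  rw [measureReal_def, cond_apply hAm, ENNReal.toReal_mul, ENNReal.toReal_inv] at h2
  change c.κ₅ ≤ (M.ν.real A)⁻¹ * M.ν.real (A ∩ B) at h2
  have h3 : c.κ₅ * M.ν.real A ≤ M.ν.real (A ∩ B) := by
    rw [inv_mul_eq_div, le_div_iff₀ hpos] at h2
    exact h2
  have h4 : A ∩ B ⊆ {x | M.opt x = k ∧ gap M.β M.gstar j k x ≤ w} := by
    rintro x ⟨hxA, hxB⟩
    refine ⟨M.opt_eq_of_gap_pos fun l hl => ?_, hxA.2⟩
    by_cases hlj : l = j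
    · rw [hlj]; exact hxA.1
    · exact c.hκ₄.trans_le (hxB l hlj hl)
  have h5 : M.ν.real (A ∩ B) ≤ _ := measureReal_mono h4
  have := mul_le_mul_of_nonneg_left h1 c.hκ₅.le
  linarith

/-- Global bound on the drift. -/
lemma drift_le (s : M.Ctrl) {δ : ℝ} (hb : ∀ j, ‖s.2 j - M.β j‖ ≤ δ) (j k : Fin M.K)
    {Δ : ℝ} (hΔ : 0 ≤ Δ) (hjk : Δ ≤ (s.1 j - M.gstar j) - (s.1 k - M.gstar k)) :
    M.drift s ≤ 2 * c.κ₆ * δ - c.κ₂ * c.κ₅ / 4 * (Δ * min Δ c.κ₁) := by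
  have hδ : 0 ≤ δ := (norm_nonneg _).trans (hb 0)
  set y : Fin M.K → ℝ := fun l => s.1 l - M.gstar l with hy
  have hint : Integrable (fun x => y (M.opt x) - y (M.dec s x)) M.ν :=
    (M.integrable_comp_index y M.measurable_opt).sub
      (M.integrable_comp_index y (M.measurable_dec_right s))
  -- The myopic choice is compared with an arbitrary alternative `l`. Taking `l` optimal bounds the
  -- integrand by `2 * κ₆ * δ`; a better `l` is used on the set `A` below.
  have hpt : ∀ x : M.E, ‖x‖ ≤ c.κ₆ → ∀ l, y (M.opt x) - y (M.dec s x) ≤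
      y (M.opt x) - y l + gap M.β M.gstar l (M.opt x) x + 2 * c.κ₆ * δ := by
    intro x hx l
    have h1 : adjCost s.2 s.1 x (M.dec s x) ≤ _ := M.decision_le s.2 s.1 x l
    have h2 : adjCost M.β M.gstar x (M.opt x) ≤ _ := M.decision_le M.β M.gstar x (M.dec s x)
    generalize M.dec s x = i at *
    generalize M.opt x = o at *
    have h4 := abs_le.1 (M.abs_inner_sub_le hx (hb i))
    have h5 := abs_le.1 (M.abs_inner_sub_le hx (hb l))
    simp only [adjCost, gap, hy] at *
    linarith [h4.1, h4.2, h5.1, h5.2]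
  rcases hΔ.eq_or_lt with rfl | hpos
  · simp only [zero_mul, mul_zero, sub_zero]
    have : M.drift s ≤ ∫ _x, 2 * c.κ₆ * δ ∂M.ν := by
      refine integral_mono_ae hint (integrable_const _) ?_
      filter_upwards [M.margin.bounded] with x hx
      have h1 := hpt x hx (M.opt x)
      simp only [gap] at h1
      simp only [hy] at h1
      linarith
    simpa using this
  -- The window must stay in the range where the density is bounded below; halving it also gives the
  -- strict inequality with `κ₁` that richness requires.
  set D := min Δ c.κ₁ with hD
  have hD0 : 0 < D := lt_min hpos c.hκ₁
  have hDκ : D ≤ c.κ₁ := min_le_right _ _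
  have hDΔ : D ≤ Δ := min_le_left _ _
  have hne : j ≠ k := by
    rintro rfl; simp at hjk; linarith
  -- On `A` the choice `l = j` gains `Δ` and costs at most `D / 2 ≤ Δ / 2`, a net gain of `Δ / 2` on
  -- a set of mass at least `κ₂ * κ₅ * D / 2`.
  set A := {x | M.opt x = k ∧ gap M.β M.gstar j k x ≤ D / 2} with hA
  have hAm : MeasurableSet A := (M.measurable_opt (measurableSet_singleton k)).inter
    (measurableSet_le (M.measurable_gap _ j k) measurable_const)
  have h1 := M.le_measure_opt_near hne (w := D / 2) (by linarith) (by linarith)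
  have h2 : M.drift s ≤ ∫ x, (2 * c.κ₆ * δ - A.indicator (fun _ => Δ / 2) x) ∂M.ν := by
    refine integral_mono_ae hint ((integrable_const _).sub ((integrable_const _).indicator hAm)) ?_
    filter_upwards [M.margin.bounded] with x hx
    by_cases hxA : x ∈ A
    · rw [Set.indicator_of_mem hxA]
      have h3 := hpt x hx j
      have h4 := hxA.2
      rw [← hxA.1] at h4 hjk
      simp only [hy] at h3 ⊢
      linarith
    · rw [Set.indicator_of_notMem hxA]
      have h1 := hpt x hx (M.opt x)
      simp only [gap] at h1
      simp only [hy] at h1 ⊢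
      linarith
  rw [integral_sub (integrable_const _) ((integrable_const _).indicator hAm),
    integral_indicator_const _ hAm] at h2
  simp only [integral_const, probReal_univ, smul_eq_mul, one_mul] at h2
  have h3 := mul_le_mul_of_nonneg_right h1 (by linarith : 0 ≤ Δ / 2)
  have e : c.κ₂ * c.κ₅ * (D / 2) * (Δ / 2) = c.κ₂ * c.κ₅ / 4 * (Δ * D) := by ring
  linarith

/-- Local bound on the drift, with an error that is quadratic near the optimum. -/
lemma drift_le_of_near (s : M.Ctrl) {δ : ℝ} (hb : ∀ j, ‖s.2 j - M.β j‖ ≤ δ) (j k : Fin M.K)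
    {Δ : ℝ} (hjk : Δ = (s.1 j - M.gstar j) - (s.1 k - M.gstar k))
    (hΔ : ∀ i l, (s.1 i - M.gstar i) - (s.1 l - M.gstar l) ≤ Δ)
    (hsmall : Δ + 2 * c.κ₆ * δ ≤ c.κ₁) :
    M.drift s ≤ Δ * ((M.K : ℝ) ^ 2 * (c.κ₃ * (2 * c.κ₆ * δ))) - c.κ₂ * c.κ₅ / 4 * Δ ^ 2 := by
  have hδ : 0 ≤ δ := (norm_nonneg _).trans (hb 0)
  have hΔ0 : 0 ≤ Δ := by simpa using hΔ j j
  have hΔκ : Δ ≤ c.κ₁ := by have := c.hκ₆; nlinarith [mul_nonneg this.le hδ]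
  set y : Fin M.K → ℝ := fun l => s.1 l - M.gstar l with hy
  -- The drift with the true coefficients has no error term. Passing to the estimates changes the
  -- decision on a set of measure of order `δ`, and each change costs at most `Δ`.
  have h1 := M.drift_le (s.1, M.β) (δ := 0) (by simp) j k hΔ0 hjk.le
  rw [min_eq_left hΔκ, mul_zero, zero_sub, ← sq] at h1
  have h2 : M.drift s = M.drift (s.1, M.β) +
      ∫ x, (y (M.dec (s.1, M.β) x) - y (M.dec s x)) ∂M.ν := by
    have i1 := M.integrable_comp_index y M.measurable_opt
    have i2 := M.integrable_comp_index y (M.measurable_dec_right s)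
    have i3 := M.integrable_comp_index y (M.measurable_dec_right (s.1, M.β))
    rw [drift, drift]
    change ∫ x, (y (M.opt x) - y (M.dec s x)) ∂M.ν =
      ∫ x, (y (M.opt x) - y (M.dec (s.1, M.β) x)) ∂M.ν + _
    rw [integral_sub i1 i2, integral_sub i1 i3, integral_sub i3 i2]
    ring
  have h3 := M.integral_index_sub_le y (M.measurable_dec_right (s.1, M.β))
    (M.measurable_dec_right s) (Y := Δ) hΔ
  have h4 := M.measure_decision_ne_le (b := s.2) (g := s.1) (g' := s.1) (Δ := Δ) (r := 0) hδ le_rfl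
    hb (fun i l => abs_le.2 ⟨by linarith [hΔ l i], hΔ i l⟩) (by simp) (by linarith)
  rw [add_zero] at h4
  have h5 := mul_le_mul_of_nonneg_left h4 hΔ0
  change Δ * M.ν.real {x | M.dec (s.1, M.β) x ≠ M.dec s x} ≤ _ at h5
  linarith

/-- The minimum-eigenvalue condition as a lower bound on a quadratic form. -/
lemma le_infoForm_opt (k : Fin M.K) (v : M.E) :
    c.κ₈ * ‖v‖ ^ 2 ≤ ∫ x, (if M.opt x = k then ⟪x, v⟫ ^ 2 else 0) ∂M.ν := by
  set A := infoMatrix M.ν M.I.sel M.β M.gstar k with hA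
  have hint : ∀ i j, Integrable (fun x : M.E => if M.opt x = k then x i * x j else 0) M.ν := by
    intro i j
    refine Integrable.of_bound (Measurable.ite (M.measurable_opt (measurableSet_singleton k))
      (by fun_prop) measurable_const).aestronglyMeasurable (c.κ₆ ^ 2) ?_
    filter_upwards [M.margin.bounded] with x hx
    rw [Real.norm_eq_abs]
    split_ifs
    · rw [abs_mul, sq]
      exact mul_le_mul ((abs_apply_le x i).trans hx) ((abs_apply_le x j).trans hx) (abs_nonneg _)
        c.hκ₆.le
    · simp; positivity
  have hquad : ∫ x, (if M.opt x = k then ⟪x, v⟫ ^ 2 else 0) ∂M.ν = v.ofLp ⬝ᵥ A *ᵥ v.ofLp := by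
    have h := fun i j => (hint i j).const_mul (v i * v j)
    calc _ = ∫ x, ∑ i, ∑ j, v i * v j * (if M.opt x = k then x i * x j else 0) ∂M.ν := by
          refine integral_congr_ae (Filter.Eventually.of_forall fun x => ?_)
          simp only
          split_ifs
          · exact inner_sq_eq_sum x v
          · simp
      _ = ∑ i, ∑ j, v i * v j * ∫ x, (if M.opt x = k then x i * x j else 0) ∂M.ν := by
          simp only [← integral_const_mul]
          rw [integral_finsetSum _ fun i _ => integrable_finsetSum _ fun j _ => h i j]
          exact Finset.sum_congr rfl fun i _ => integral_finsetSum _ fun j _ => h i j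
      _ = _ := by
          simp only [dotProduct, Matrix.mulVec, Finset.mul_sum]
          refine Finset.sum_congr rfl fun i _ => Finset.sum_congr rfl fun j _ => ?_
          have : A i j = ∫ x, (if M.opt x = k then x i * x j else 0) ∂M.ν := rfl
          rw [this]; ring
  have hherm : A.IsHermitian := by
    ext i j
    simp only [Matrix.conjTranspose_apply, star_trivial]
    simp only [hA, infoMatrix, Matrix.of_apply, mul_comm]
  -- An eigenvector of `B` is an eigenvector of `A` with eigenvalue larger by `κ₈`, so the condition
  -- on the spectrum of `A` makes `B` positive semidefinite.
  set B := A - c.κ₈ • (1 : Matrix (Fin M.d) (Fin M.d) ℝ) with hB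
  have hBh : B.IsHermitian := by
    refine hherm.sub ?_
    ext i j; simp [Matrix.one_apply, eq_comm]
  have hpsd : B.PosSemidef := by
    rw [hBh.posSemidef_iff_eigenvalues_nonneg]
    intro i
    have h1 := hBh.mulVec_eigenvectorBasis i
    set u := hBh.eigenvectorBasis i with hu
    have h2 : A *ᵥ u.ofLp = (hBh.eigenvalues i + c.κ₈) • u.ofLp := by
      have h3 : B *ᵥ u.ofLp = A *ᵥ u.ofLp - c.κ₈ • u.ofLp := by
        rw [hB, Matrix.sub_mulVec, Matrix.smul_mulVec, Matrix.one_mulVec]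
      rw [add_smul, ← h1, h3, sub_add_cancel]
    have h3 : Module.End.HasEigenvalue (Matrix.toLin' A) (hBh.eigenvalues i + c.κ₈) := by
      refine Module.End.hasEigenvalue_of_hasEigenvector (x := u.ofLp) ?_
      refine ⟨Module.End.mem_eigenspace_iff.2 (by rw [Matrix.toLin'_apply]; exact h2), ?_⟩
      intro h0
      have h4 : ‖u‖ = 1 := hBh.eigenvectorBasis.orthonormal.1 i
      have : u = 0 := by ext l; rw [h0]; rfl
      rw [this, norm_zero] at h4
      exact zero_ne_one h4
    have := M.eig k _ h3
    simp only [Pi.zero_apply]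
    linarith
  have h5 := hpsd.dotProduct_mulVec_nonneg v.ofLp
  rw [star_trivial, hB, Matrix.sub_mulVec, Matrix.smul_mulVec, Matrix.one_mulVec, dotProduct_sub,
    dotProduct_smul, ← hquad, smul_eq_mul, ← M.inner_eq_dotProduct, real_inner_self_eq_norm_sq] at h5
  linarith

lemma integrable_ite_inner_sq {A : Set M.E} (hA : MeasurableSet A) [DecidablePred (· ∈ A)]
    (v : M.E) : Integrable (fun x => if x ∈ A then ⟪x, v⟫ ^ 2 else 0) M.ν := by
  refine Integrable.of_bound (Measurable.ite hA
    ((measurable_id.inner measurable_const).pow_const 2)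
    measurable_const).aestronglyMeasurable (c.κ₆ ^ 2 * ‖v‖ ^ 2) ?_
  filter_upwards [M.margin.bounded] with x hx
  rw [Real.norm_eq_abs]
  split_ifs
  · rw [abs_of_nonneg (sq_nonneg _), ← sq_abs, ← mul_pow]
    exact pow_le_pow_left₀ (abs_nonneg _) ((abs_real_inner_le_norm _ _).trans (by gcongr)) 2
  · simp; positivity

/-- The quadratic form remains bounded below under small perturbations of the decision rule. -/
lemma le_infoForm_dec (s : M.Ctrl) (k : Fin M.K) (v : M.E) :
    (c.κ₈ - c.κ₆ ^ 2 * M.ν.real {x | M.dec s x ≠ M.opt x}) * ‖v‖ ^ 2 ≤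
      ∫ x, (if M.dec s x = k then ⟪x, v⟫ ^ 2 else 0) ∂M.ν := by
  have h1 := M.le_infoForm_opt k v
  have hm : MeasurableSet {x | M.dec s x ≠ M.opt x} :=
    (measurableSet_eq_fun (M.measurable_dec_right s) M.measurable_opt).compl
  have i1 : Integrable (fun x => if M.opt x = k then ⟪x, v⟫ ^ 2 else 0) M.ν :=
    M.integrable_ite_inner_sq (A := {x | M.opt x = k}) (M.measurable_opt (measurableSet_singleton k)) v
  have i2 : Integrable (fun x => if M.dec s x = k then ⟪x, v⟫ ^ 2 else 0) M.ν :=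
    M.integrable_ite_inner_sq (A := {x | M.dec s x = k})
      (M.measurable_dec_right s (measurableSet_singleton k)) v
  have h2 : ∫ x, (if M.opt x = k then ⟪x, v⟫ ^ 2 else 0) ∂M.ν ≤
      ∫ x, ((if M.dec s x = k then ⟪x, v⟫ ^ 2 else 0) +
        {x | M.dec s x ≠ M.opt x}.indicator (fun _ => c.κ₆ ^ 2 * ‖v‖ ^ 2) x) ∂M.ν := by
    refine integral_mono_ae i1 (i2.add ((integrable_const _).indicator hm)) ?_
    filter_upwards [M.margin.bounded] with x hx
    have hb : ⟪x, v⟫ ^ 2 ≤ c.κ₆ ^ 2 * ‖v‖ ^ 2 := by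
      rw [← sq_abs, ← mul_pow]
      exact pow_le_pow_left₀ (abs_nonneg _) ((abs_real_inner_le_norm _ _).trans (by gcongr)) 2
    by_cases h : M.dec s x = M.opt x
    · simp [h]
    · rw [Set.indicator_of_mem (by exact h)]
      have h3 : 0 ≤ ⟪x, v⟫ ^ 2 := sq_nonneg _
      split_ifs <;> linarith
  rw [integral_add i2 ((integrable_const _).indicator hm), integral_indicator_const _ hm,
    smul_eq_mul] at h2
  linarith

/-! ### Bounds on the number of alternatives and on the dimension. -/

lemma subsingleton_K_of_d_eq_zero (hd : M.d = 0) : M.K ≤ 1 := by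
  by_contra hK
  obtain ⟨f, hf, hmap, -⟩ := M.margin.density ⟨0, by omega⟩ ⟨1, by omega⟩ (by simp)
  have : IsEmpty (Fin M.d) := by rw [hd]; infer_instance
  set j : Fin M.K := ⟨0, by omega⟩
  set k : Fin M.K := ⟨1, by omega⟩
  -- In dimension zero the gap is constant, and a law with a density has no atom.
  have h1 : M.ν.map (gap M.β M.gstar j k) {gap M.β M.gstar j k 0} = 0 := by
    rw [hmap]; exact withDensity_absolutelyContinuous _ _ (by simp)
  rw [Measure.map_apply (M.measurable_gap _ _ _) (measurableSet_singleton _)] at h1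
  have h2 : gap M.β M.gstar j k ⁻¹' {gap M.β M.gstar j k 0} = Set.univ := by
    ext x
    simp [Subsingleton.elim x 0]
  rw [h2, measure_univ] at h1
  exact one_ne_zero h1

/-- Summed over the cells of the optimal decision and over the coordinate directions, the
information is `E ‖X‖ ^ 2`, while each summand is at least `κ₈`. This keeps all constants
independent of `K` and `d`. -/
lemma card_mul_dim_le : (M.K : ℝ) * M.d * c.κ₈ ≤ c.κ₆ ^ 2 := by
  set e : Fin M.d → M.E := fun i => EuclideanSpace.single i 1
  have h1 : ∀ k i, c.κ₈ ≤ ∫ x, (if M.opt x = k then ⟪x, e i⟫ ^ 2 else 0) ∂M.ν := fun k i => by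
    simpa [e] using M.le_infoForm_opt k (e i)
  have hi : ∀ k i, Integrable (fun x => if M.opt x = k then ⟪x, e i⟫ ^ 2 else 0) M.ν :=
    fun k i => M.integrable_ite_inner_sq (A := {x | M.opt x = k})
      (M.measurable_opt (measurableSet_singleton k)) (e i)
  calc (M.K : ℝ) * M.d * c.κ₈ = ∑ _k : Fin M.K, ∑ _i : Fin M.d, c.κ₈ := by simp; ring
    _ ≤ ∑ k, ∑ i, ∫ x, (if M.opt x = k then ⟪x, e i⟫ ^ 2 else 0) ∂M.ν :=
        Finset.sum_le_sum fun k _ => Finset.sum_le_sum fun i _ => h1 k i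
    _ = ∫ x, ∑ k, ∑ i, (if M.opt x = k then ⟪x, e i⟫ ^ 2 else 0) ∂M.ν := by
        rw [integral_finsetSum _ fun k _ => integrable_finsetSum _ fun i _ => hi k i]
        exact Finset.sum_congr rfl fun k _ => (integral_finsetSum _ fun i _ => hi k i).symm
    _ ≤ ∫ _x, c.κ₆ ^ 2 ∂M.ν := by
        refine integral_mono_ae (integrable_finsetSum _ fun k _ =>
          integrable_finsetSum _ fun i _ => hi k i) (integrable_const _) ?_
        filter_upwards [M.margin.bounded] with x hx
        rw [Finset.sum_comm]
        simp only [Finset.sum_ite_eq, Finset.mem_univ, if_true]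
        have : ∀ i, ⟪x, e i⟫ = x i := fun i => by simp [e, EuclideanSpace.inner_single_right]
        simp only [this]
        rw [← EuclideanSpace.real_norm_sq_eq]
        exact pow_le_pow_left₀ (norm_nonneg _) hx 2
    _ = _ := by simp

end Model

/-- A bound on the number of alternatives and on the dimension. -/
def Constants.size (c : Constants) : ℝ := 1 + c.κ₆ ^ 2 / c.κ₈

lemma Constants.one_le_size (c : Constants) : 1 ≤ c.size := by
  have := c.hκ₈
  have : 0 ≤ c.κ₆ ^ 2 / c.κ₈ := by positivity
  unfold Constants.size; linarith

namespace Model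

variable {c : Constants} (M : Model.{u} c)

lemma one_le_K : (1 : ℝ) ≤ M.K := by exact_mod_cast Nat.one_le_iff_ne_zero.2 (NeZero.ne M.K)

lemma K_le_size : (M.K : ℝ) ≤ c.size := by
  rcases Nat.eq_zero_or_pos M.d with h | h
  · have h1 : (M.K : ℝ) ≤ 1 := by exact_mod_cast M.subsingleton_K_of_d_eq_zero h
    exact h1.trans c.one_le_size
  · have h1 : (1 : ℝ) ≤ M.d := by exact_mod_cast h
    have h2 := M.card_mul_dim_le
    have h3 : (M.K : ℝ) ≤ c.κ₆ ^ 2 / c.κ₈ := by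
      rw [le_div_iff₀ c.hκ₈]
      refine le_trans ?_ h2
      have := c.hκ₈
      have : (M.K : ℝ) * 1 ≤ M.K * M.d := by gcongr
      nlinarith
    unfold Constants.size; linarith

lemma d_le_size : (M.d : ℝ) ≤ c.size := by
  have h1 := M.one_le_K
  have h2 := M.card_mul_dim_le
  have h3 : (M.d : ℝ) ≤ c.κ₆ ^ 2 / c.κ₈ := by
    rw [le_div_iff₀ c.hκ₈]
    refine le_trans ?_ h2
    have := c.hκ₈
    have : 1 * (M.d : ℝ) ≤ M.K * M.d := by gcongr
    nlinarith
  unfold Constants.size; linarith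

end Model

/-! ### Exploration times: distinctness, and counts from above and below. -/

lemma tendsto_log_natCast : Filter.Tendsto (fun n : ℕ => Real.log n) Filter.atTop Filter.atTop :=
  Real.tendsto_log_atTop.comp tendsto_natCast_atTop_atTop

/-- The `j`-th candidate exploration time. -/
def exploreTime (a : ℝ) (j : ℕ) : ℕ := ⌈Real.exp (a * (j : ℝ) ^ ((1 : ℝ) / 9))⌉₊

lemma exploreTime_mono {a : ℝ} (ha : 0 < a) : Monotone (exploreTime a) := by
  intro i j hij
  refine Nat.ceil_mono (Real.exp_le_exp.2 ?_)
  gcongr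

/-- The increments of `exp (a * j ^ (1 / 9))` are eventually at least `1`, so rounding up cannot
merge consecutive times. -/
lemma exploreTime_lt_succ {a : ℝ} (ha : 0 < a) :
    ∃ J : ℕ, ∀ j ≥ J, exploreTime a j < exploreTime a (j + 1) := by
  have hlim : Filter.Tendsto (fun j : ℕ => Real.exp (a * (j : ℝ) ^ ((1 : ℝ) / 9)) /
      ((j : ℝ) ^ ((1 : ℝ) / 9)) ^ 9) Filter.atTop Filter.atTop := by
    have h1 : Filter.Tendsto (fun j : ℕ => (j : ℝ) ^ ((1 : ℝ) / 9)) Filter.atTop Filter.atTop :=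
      (tendsto_rpow_atTop (by norm_num)).comp tendsto_natCast_atTop_atTop
    have h2 := tendsto_exp_mul_div_rpow_atTop 9 a ha
    have h3 := h2.comp h1
    refine h3.congr fun j => ?_
    simp only [Function.comp_apply]
    congr 1
    exact_mod_cast Real.rpow_natCast _ 9
  -- With `v`, `w` the ninth roots of `j`, `j + 1`, one has `w - v ≥ 1 / (9 * (j + 1)) ≥ 1 / (18 *
  -- j)`. Hence `exp (a * v) ≥ 18 * j / a` makes the increment at least `exp (a * v) * a * (w - v) ≥
  -- 1`.
  obtain ⟨J, hJ⟩ := Filter.eventually_atTop.1 (hlim.eventually_ge_atTop (18 / a))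
  refine ⟨max J 1, fun j hj => ?_⟩
  have hj1 : (1 : ℝ) ≤ j := by exact_mod_cast (le_max_right J 1).trans hj
  have h1 := hJ j ((le_max_left J 1).trans hj)
  set v := (j : ℝ) ^ ((1 : ℝ) / 9) with hv
  set w := ((j + 1 : ℕ) : ℝ) ^ ((1 : ℝ) / 9) with hw
  have pow9 : ∀ x : ℝ, 0 ≤ x → (x ^ ((1 : ℝ) / 9)) ^ 9 = x := fun x hx => by
    rw [← Real.rpow_natCast, ← Real.rpow_mul hx]; norm_num
  have hv9 : v ^ 9 = j := pow9 _ (by positivity)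
  have hw9 : w ^ 9 = j + 1 := by rw [hw, pow9 _ (by positivity)]; push_cast; ring
  have hv0 : 0 ≤ v := by positivity
  have hw1 : 1 ≤ w := Real.one_le_rpow (by push_cast; linarith) (by norm_num)
  have hvw : v ≤ w := by
    refine Real.rpow_le_rpow (by positivity) (by push_cast; linarith) (by norm_num)
  rw [hv9, le_div_iff₀ (by linarith)] at h1
  have h2 : 1 ≤ (w - v) * (9 * w ^ 9) := by
    have e : w ^ 9 - v ^ 9 = (w - v) * ∑ i ∈ Finset.range 9, w ^ i * v ^ (8 - i) := by
      simp [Finset.sum_range_succ]; ring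
    have h3 : ∑ i ∈ Finset.range 9, w ^ i * v ^ (8 - i) ≤ ∑ _i ∈ Finset.range 9, w ^ 9 := by
      refine Finset.sum_le_sum fun i hi => ?_
      have hi : i ≤ 8 := by have := Finset.mem_range.1 hi; omega
      calc w ^ i * v ^ (8 - i) ≤ w ^ i * w ^ (8 - i) := by gcongr
        _ = w ^ 8 := by rw [← pow_add]; congr 1; omega
        _ ≤ w ^ 9 := pow_le_pow_right₀ hw1 (by norm_num)
    have h4 : w ^ 9 - v ^ 9 = 1 := by rw [hv9, hw9]; ring
    rw [← h4, e]
    refine mul_le_mul_of_nonneg_left (h3.trans_eq (by simp)) (by linarith)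
  have h5 : Real.exp (a * v) + 1 ≤ Real.exp (a * w) := by
    have h6 : Real.exp (a * w) = Real.exp (a * v) * Real.exp (a * (w - v)) := by
      rw [← Real.exp_add]; congr 1; ring
    have h7 := Real.add_one_le_exp (a * (w - v))
    have h8 : 1 ≤ Real.exp (a * v) * (a * (w - v)) := by
      have h9 : 18 / a * j * (a * (w - v)) ≤ Real.exp (a * v) * (a * (w - v)) :=
        mul_le_mul_of_nonneg_right h1 (mul_nonneg ha.le (by linarith))
      have h10 : 18 / a * j * (a * (w - v)) = (w - v) * (9 * (2 * j)) := by field_simp; ring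
      rw [hw9] at h2
      have : (w - v) * (9 * ((j : ℝ) + 1)) ≤ (w - v) * (9 * (2 * j)) :=
        mul_le_mul_of_nonneg_left (by linarith) (by linarith)
      linarith
    have := mul_le_mul_of_nonneg_left h7 (Real.exp_pos (a * v)).le
    rw [h6]; linarith
  have h11 := Nat.ceil_mono h5
  rw [Nat.ceil_add_one (Real.exp_pos _).le] at h11
  exact h11

lemma mem_exploreSet {K : ℕ} {a : ℝ} {n : ℕ} {k : Fin K} : k ∈ exploreSet K a n ↔
    ∃ m : ℕ, 0 < m ∧ ((k : ℕ) + 2) ∣ m ∧ n = exploreTime a m := by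
  classical
  unfold exploreSet
  rw [Finset.mem_filter]
  exact ⟨fun h => h.2, fun h => ⟨Finset.mem_univ _, h⟩⟩

namespace Model

/-- Inverting `m ↦ exp (a * m ^ (1 / 9))`: an exploration before `n` has index at most `(log n / a)
^ 9`. -/
lemma card_explore_le (c : Constants) (M : Model.{u} c) {n : ℕ} (hn : 1 ≤ n) :
    (((Finset.range n).filter fun m => (exploreSet M.K M.I.a m).Nonempty).card : ℝ) ≤
      (Real.log n / c.a) ^ 9 := by
  have hn' : (0 : ℝ) < n := by exact_mod_cast hn
  set J := ⌊(Real.log n / c.a) ^ 9⌋₊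
  have hlog : 0 ≤ Real.log n / c.a := div_nonneg (Real.log_natCast_nonneg n) c.ha.le
  have hsub : ((Finset.range n).filter fun m => (exploreSet M.K M.I.a m).Nonempty) ⊆
      (Finset.Icc 1 J).image (exploreTime c.a) := by
    intro m hm
    obtain ⟨hmn, k, hk⟩ := Finset.mem_filter.1 hm
    rw [M.ha, mem_exploreSet] at hk
    obtain ⟨j, hj0, -, hj⟩ := hk
    refine Finset.mem_image.2 ⟨j, Finset.mem_Icc.2 ⟨hj0, Nat.le_floor ?_⟩, hj.symm⟩
    have h1 : Real.exp (c.a * (j : ℝ) ^ ((1 : ℝ) / 9)) ≤ n := by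
      refine (Nat.le_ceil _).trans ?_
      rw [exploreTime] at hj
      rw [← hj]
      exact_mod_cast (Finset.mem_range.1 hmn).le
    have h2 : (j : ℝ) ^ ((1 : ℝ) / 9) ≤ Real.log n / c.a := by
      rw [le_div_iff₀ c.ha, mul_comm]
      exact (Real.le_log_iff_exp_le hn').2 h1
    calc (j : ℝ) = ((j : ℝ) ^ ((1 : ℝ) / 9)) ^ 9 := by
          rw [← Real.rpow_natCast, ← Real.rpow_mul (by positivity)]; norm_num
      _ ≤ _ := by gcongr
  have h := (Finset.card_le_card hsub).trans Finset.card_image_le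
  rw [Nat.card_Icc, Nat.add_sub_cancel] at h
  calc _ ≤ (J : ℝ) := by exact_mod_cast h
    _ ≤ _ := Nat.floor_le (by positivity)

/-- Every alternative is explored at least of the order of `(log n) ^ 9` times. -/
lemma exists_explore (c : Constants) : ∃ γ : ℝ, 0 < γ ∧ ∃ n₀ : ℕ, ∀ M : Model.{u} c, ∀ n ≥ n₀,
    ∀ k : Fin M.K, ∃ A ⊆ Finset.range n, γ * Real.log n ^ 9 ≤ A.card ∧
      ∀ m ∈ A, ∀ s x, M.pick m s x = k := by
  obtain ⟨J, hJ⟩ := exploreTime_lt_succ c.ha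
  have ha := c.ha
  set Km := ⌈c.size⌉₊ with hKm
  set L := (Km + 1).factorial with hL
  have hL0 : 0 < L := Nat.factorial_pos _
  set Q : ℝ := (Km + 1) * L with hQ
  have hQ0 : 0 < Q := by positivity
  -- With this value `Q * N` is at most half of `(log n / (2 * a)) ^ 9`; the other half covers the
  -- constant part of the indices, by `ev1`.
  set γ₁ : ℝ := 1 / (2 * Q * (2 * c.a) ^ 9) with hγ₁
  have hγ₁0 : 0 < γ₁ := by positivity
  have ev1 : ∀ᶠ n : ℕ in Filter.atTop,
      ((Km + 1) * (1 + L * (J + 1)) : ℝ) * (2 * (2 * c.a) ^ 9) ≤ Real.log n ^ 9 :=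
    ((Filter.tendsto_pow_atTop (by norm_num)).comp tendsto_log_natCast).eventually_ge_atTop _
  have ev2 : ∀ᶠ n : ℕ in Filter.atTop, 2 / γ₁ ≤ Real.log n ^ 9 :=
    ((Filter.tendsto_pow_atTop (by norm_num)).comp tendsto_log_natCast).eventually_ge_atTop _
  obtain ⟨n₀, hn₀⟩ := Filter.eventually_atTop.1 (ev1.and ev2)
  refine ⟨γ₁ / 2, by positivity, max n₀ 4, fun M n hn k => ?_⟩
  obtain ⟨h1, h2⟩ := hn₀ n ((le_max_left _ _).trans hn)
  have hn4 : (4 : ℝ) ≤ n := by exact_mod_cast (le_max_right n₀ 4).trans hn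
  have hlog0 : 0 ≤ Real.log n := Real.log_natCast_nonneg n
  have hKKm : M.K ≤ Km := by exact_mod_cast M.K_le_size.trans (Nat.le_ceil _)
  set N := ⌊γ₁ * Real.log n ^ 9⌋₊ with hN
  -- The second factor is coprime to `L = (Km + 1)!`, hence to every `k' + 2`. So `k'` is explored
  -- at this time only if `k' + 2` divides `k + 2`, and the rule of the largest index selects `k`.
  -- The shift `J + 1` keeps the index in the range where the times are distinct.
  let idx : ℕ → ℕ := fun i => ((k : ℕ) + 2) * (1 + L * (J + 1 + i))
  have hidxJ : ∀ i, J < idx i := by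
    intro i
    have : J + 1 ≤ L * (J + 1 + i) := by nlinarith
    simp only [idx]; nlinarith
  have hinj : ∀ i j, J < i → exploreTime c.a i = exploreTime c.a j → i = j := by
    intro i j hi hij
    have hmono := exploreTime_mono c.ha
    rcases lt_trichotomy i j with h | h | h
    · have h3 := hJ i hi.le
      have h4 : exploreTime c.a (i + 1) ≤ exploreTime c.a j := hmono h
      omega
    · exact h
    · obtain ⟨i', rfl⟩ : ∃ i', i = i' + 1 := ⟨i - 1, by omega⟩
      have h3 := hJ i' (by omega)
      have h4 : exploreTime c.a j ≤ exploreTime c.a i' := hmono (by omega)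
      omega
  have hmem : ∀ i, ∀ k' : Fin M.K,
      k' ∈ exploreSet M.K M.I.a (exploreTime c.a (idx i)) ↔ (k' : ℕ) + 2 ∣ idx i := by
    intro i k'
    rw [M.ha, mem_exploreSet]
    constructor
    · rintro ⟨m, -, hm, hm2⟩
      rwa [hinj (idx i) m (hidxJ i) hm2]
    · intro h
      exact ⟨idx i, by have := hidxJ i; omega, h, rfl⟩
  have hpick : ∀ i s x, M.pick (exploreTime c.a (idx i)) s x = k := by
    intro i s x
    have hk : k ∈ exploreSet M.K M.I.a (exploreTime c.a (idx i)) :=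
      (hmem i k).2 (Dvd.intro _ rfl)
    have hne : (exploreSet M.K M.I.a (exploreTime c.a (idx i))).Nonempty := ⟨k, hk⟩
    simp only [pick, sampled, hne, dif_pos]
    refine le_antisymm (Finset.max'_le _ _ _ fun k' hk' => ?_) (Finset.le_max' _ _ hk)
    have h3 := (hmem i k').1 hk'
    have h4 : (k' : ℕ) + 2 ∣ L := Nat.dvd_factorial (by omega) (by have := k'.2; omega)
    have h5 : Nat.Coprime ((k' : ℕ) + 2) (1 + L * (J + 1 + i)) := by
      obtain ⟨l, hl⟩ := h4
      rw [hl, mul_assoc]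
      simp
    have h6 := Nat.le_of_dvd (by omega) (h5.dvd_of_dvd_mul_right h3)
    exact Fin.le_def.2 (by omega)
  refine ⟨(Finset.range N).image fun i => exploreTime c.a (idx i), ?_, ?_, ?_⟩
  · intro m hm
    obtain ⟨i, hi, rfl⟩ := Finset.mem_image.1 hm
    have hiN : i < N := Finset.mem_range.1 hi
    have h3 : (idx i : ℝ) ≤ (Real.log n / (2 * c.a)) ^ 9 := by
      have h4 : idx i ≤ (Km + 1) * (1 + L * (J + 1)) + (Km + 1) * L * N := by
        have : (k : ℕ) + 2 ≤ Km + 1 := by have := k.2; omega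
        calc idx i ≤ (Km + 1) * (1 + L * (J + 1 + N)) := by simp only [idx]; gcongr
          _ = _ := by ring
      have h5 : (idx i : ℝ) ≤ (Km + 1) * (1 + L * (J + 1)) + Q * N := by
        rw [hQ]; exact_mod_cast h4
      have h6 : (N : ℝ) ≤ γ₁ * Real.log n ^ 9 := Nat.floor_le (by positivity)
      have h7 : Q * (γ₁ * Real.log n ^ 9) = Real.log n ^ 9 / (2 * (2 * c.a) ^ 9) := by
        rw [hγ₁]; field_simp
      have h8 := mul_le_mul_of_nonneg_left h6 hQ0.le
      rw [h7] at h8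
      have h9 : ((Km + 1) * (1 + L * (J + 1)) : ℝ) ≤ Real.log n ^ 9 / (2 * (2 * c.a) ^ 9) := by
        rw [le_div_iff₀ (by positivity)]; exact h1
      rw [div_pow]
      have h10 : Real.log n ^ 9 / (2 * c.a) ^ 9 = Real.log n ^ 9 / (2 * (2 * c.a) ^ 9) +
        Real.log n ^ 9 / (2 * (2 * c.a) ^ 9) := by field_simp; ring
      linarith
    have h4 : (idx i : ℝ) ^ ((1 : ℝ) / 9) ≤ Real.log n / (2 * c.a) := by
      calc _ ≤ ((Real.log n / (2 * c.a)) ^ 9) ^ ((1 : ℝ) / 9) :=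
            Real.rpow_le_rpow (by positivity) h3 (by norm_num)
        _ = _ := by
            rw [← Real.rpow_natCast, ← Real.rpow_mul (by positivity)]; norm_num
    -- The denominator `2 * a` instead of `a` puts the time below `√n ≤ n - 1`, which leaves room
    -- for rounding up.
    have h5 : Real.exp (c.a * (idx i : ℝ) ^ ((1 : ℝ) / 9)) ≤ Real.sqrt n := by
      rw [Real.sqrt_eq_rpow, Real.rpow_def_of_pos (by linarith : (0 : ℝ) < n)]
      refine Real.exp_le_exp.2 ?_
      calc _ ≤ c.a * (Real.log n / (2 * c.a)) := by gcongr
        _ = _ := by field_simp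
    have h6 : Real.sqrt n ≤ ((n - 1 : ℕ) : ℝ) := by
      rw [Nat.cast_sub (by have := (le_max_right n₀ 4).trans hn; omega), Real.sqrt_le_left]
      · push_cast; nlinarith
      · push_cast; linarith
    have h7 : exploreTime c.a (idx i) ≤ n - 1 := Nat.ceil_le.2 (h5.trans h6)
    have := (le_max_right n₀ 4).trans hn
    exact Finset.mem_range.2 (by omega)
  · rw [Finset.card_image_of_injective, Finset.card_range]
    · have h3 := Nat.lt_floor_add_one (γ₁ * Real.log n ^ 9)
      rw [← hN] at h3
      rw [div_le_iff₀ hγ₁0] at h2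
      linarith
    · intro i j hij
      have h3 := hinj _ _ (hidxJ i) hij
      have h4 := Nat.eq_of_mul_eq_mul_left (by omega) h3
      have h5 : L * (J + 1 + i) = L * (J + 1 + j) := by omega
      have := Nat.eq_of_mul_eq_mul_left hL0 h5
      omega
  · intro m hm s x
    obtain ⟨i, -, rfl⟩ := Finset.mem_image.1 hm
    exact hpick i s x

end Model

/-! ### Consistency of the estimates from forced exploration. -/

/-- A finite `1 / n`-net of a ball, of polynomial size in `n`. -/
lemma exists_net (d n : ℕ) (hn : 1 ≤ n) {B : ℝ} (hB : 0 ≤ B) :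
    ∃ G : Finset (EuclideanSpace ℝ (Fin d)), (G.card : ℝ) ≤ (n * (2 * B * d + 5)) ^ d ∧
      ∀ w : EuclideanSpace ℝ (Fin d), ‖w‖ ≤ B → ∃ θ ∈ G, ‖w - θ‖ ≤ 1 / n := by
  have hn1 : (1 : ℝ) ≤ n := by exact_mod_cast hn
  set N : ℕ := ⌈B * (n * d)⌉₊ + 1 with hN
  let φ : (Fin d → ℤ) → EuclideanSpace ℝ (Fin d) := fun z =>
    WithLp.toLp 2 fun i => (z i : ℝ) / (n * d)
  refine ⟨(Fintype.piFinset fun _ => Finset.Icc (-(N : ℤ)) N).image φ, ?_, fun w hw => ?_⟩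
  · have h1 : ((Fintype.piFinset fun _ : Fin d => Finset.Icc (-(N : ℤ)) N).image φ).card ≤
        (2 * N + 1) ^ d := by
      refine Finset.card_image_le.trans ?_
      rw [Fintype.card_piFinset_const, Int.card_Icc]
      gcongr
      omega
    have h2 : ((2 * N + 1 : ℕ) : ℝ) ≤ n * (2 * B * d + 5) := by
      have h3 : (⌈B * (n * d)⌉₊ : ℝ) < B * (n * d) + 1 := Nat.ceil_lt_add_one (by positivity)
      push_cast [hN]
      nlinarith
    calc _ ≤ (((2 * N + 1) ^ d : ℕ) : ℝ) := by exact_mod_cast h1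
      _ = ((2 * N + 1 : ℕ) : ℝ) ^ d := by push_cast; ring
      _ ≤ _ := by gcongr
  · refine ⟨φ fun i => ⌊w i * (n * d)⌋, Finset.mem_image_of_mem _ ?_, ?_⟩
    · rw [Fintype.mem_piFinset]
      intro i
      have hwi := abs_le.1 ((Model.abs_apply_le w i).trans hw)
      have h3 : B * (n * d) ≤ ⌈B * (n * d)⌉₊ := Nat.le_ceil _
      have h4 : w i * (n * d) ≤ B * (n * d) := by gcongr; exact hwi.2
      have h5 : -(B * (n * d)) ≤ w i * (n * d) := by
        rw [← neg_mul]; gcongr; exact hwi.1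
      rw [Finset.mem_Icc]
      constructor
      · rw [Int.le_floor]; push_cast [hN]; linarith
      · refine Int.floor_le_iff.2 ?_
        push_cast [hN]; linarith
    · rcases Nat.eq_zero_or_pos d with rfl | hd
      · rw [Subsingleton.elim (w - _) 0]; simp
      have hd0 : (0 : ℝ) < d := by exact_mod_cast hd
      have hnd : (0 : ℝ) < n * d := by positivity
      have h6 : ∀ i, |(w - φ fun i => ⌊w i * (n * d)⌋) i| ≤ 1 / (n * d) := by
        intro i
        have e : (w - φ fun i => ⌊w i * (n * d)⌋) i =
            (w i * (n * d) - ⌊w i * (n * d)⌋) / (n * d) := by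
          simp only [φ, PiLp.sub_apply]
          field_simp
        rw [e, abs_div, abs_of_pos hnd]
        gcongr
        rw [abs_of_nonneg (by linarith [Int.floor_le (w i * (n * d))])]
        linarith [Int.lt_floor_add_one (w i * (n * d))]
      have h7 : ‖w - φ fun i => ⌊w i * (n * d)⌋‖ ^ 2 ≤ (1 / n : ℝ) ^ 2 := by
        rw [EuclideanSpace.real_norm_sq_eq]
        calc _ ≤ ∑ _i : Fin d, (1 / (n * d) : ℝ) ^ 2 := by
              refine Finset.sum_le_sum fun i _ => ?_
              rw [← sq_abs]
              exact pow_le_pow_left₀ (abs_nonneg _) (h6 i) 2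
          _ = (1 / n : ℝ) ^ 2 * (1 / d) := by
              simp only [Finset.sum_const, Finset.card_univ, Fintype.card_fin, nsmul_eq_mul]
              field_simp
          _ ≤ (1 / n : ℝ) ^ 2 * 1 := by
              gcongr
              rw [div_le_one hd0]
              exact_mod_cast hd
          _ = _ := mul_one _
      exact (pow_le_pow_iff_left₀ (norm_nonneg _) (by positivity) two_ne_zero).1 h7

namespace Model

variable {c : Constants} (M : Model.{u} c)

lemma gramForm_self_le_two_mul (n : ℕ) (ω : M.Ω) (k : Fin M.K) (v w : M.E) :
    M.gramForm n ω k v v ≤ 2 * M.gramForm n ω k w w + 2 * M.gramForm n ω k (w - v) (w - v) := by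
  simp only [gramForm, Finset.mul_sum, ← Finset.sum_add_distrib]
  refine Finset.sum_le_sum fun m _ => ?_
  split_ifs
  · rw [inner_sub_right]
    nlinarith [sq_nonneg (2 * ⟪M.X m ω, w⟫ - ⟪M.X m ω, v⟫)]
  · simp

lemma gramForm_smul_self (n : ℕ) (ω : M.Ω) (k : Fin M.K) (l : ℝ) (v : M.E) :
    M.gramForm n ω k (l • v) (l • v) = l ^ 2 * M.gramForm n ω k v v := by
  simp only [gramForm, Finset.mul_sum, inner_smul_right]
  refine Finset.sum_congr rfl fun m _ => ?_
  split_ifs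
  · ring
  · simp

lemma gramForm_le {ω : M.Ω} (hω : ∀ n, ‖M.X n ω‖ ≤ c.κ₆) (n : ℕ) (k : Fin M.K) (v w : M.E) :
    M.gramForm n ω k v w ≤ n * (c.κ₆ ^ 2 * (‖v‖ * ‖w‖)) := by
  have : ∀ m ∈ Finset.range n, (if M.arm m ω = k then ⟪M.X m ω, v⟫ * ⟪M.X m ω, w⟫ else 0) ≤
      c.κ₆ ^ 2 * (‖v‖ * ‖w‖) := by
    intro m _
    have h := fun v => (abs_real_inner_le_norm (M.X m ω) v).trans
      (mul_le_mul_of_nonneg_right (hω m) (norm_nonneg v))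
    split_ifs
    · refine (le_abs_self _).trans ?_
      rw [abs_mul]
      refine (mul_le_mul (h v) (h w) (abs_nonneg _) ((abs_nonneg _).trans (h v))).trans_eq (by ring)
    · positivity
  simpa [gramForm] using Finset.sum_le_sum this

/-- If the Gram form is large and the noise does not deviate on a net, then the error is small. -/
lemma norm_err_le_of_net {ω : M.Ω} (hω : ∀ n, ‖M.X n ω‖ ≤ c.κ₆) {n : ℕ} (hn : 1 ≤ n)
    (hρ : rho n ≤ n) (k : Fin M.K) {Λ T δ : ℝ} (hΛ : 0 < Λ) (hT0 : 0 ≤ T) (hδ : 0 < δ)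
    (hgram : ∀ v, Λ * ‖v‖ ^ 2 ≤ M.gramForm n ω k v v) {G : Finset M.E}
    (hG : ∀ w : M.E, ‖w‖ ≤ δ / (2 * c.κ₇) → ∃ θ ∈ G, ‖w - θ‖ ≤ 1 / n)
    (hdev : ∀ θ ∈ G, ⟪θ, M.noise n ω k⟫ - c.κ₇ / 2 * M.gramForm n ω k θ θ < T)
    (hnum : rho n * c.R * (δ / (2 * c.κ₇)) + c.κ₇ * c.κ₆ ^ 2 + T + c.R ≤
      δ * (δ / (2 * c.κ₇) * Λ / 2 - 1 - c.κ₆ ^ 2)) :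
    ‖M.err n ω k‖ ≤ δ := by
  have hκ₇ := c.hκ₇
  have hκ₆ := c.hκ₆
  have hR := c.hR
  have hn0 : (0 : ℝ) < n := by exact_mod_cast hn
  set B := δ / (2 * c.κ₇) with hB
  have hB0 : 0 < B := by positivity
  set v := M.err n ω k with hv
  set e := ‖v‖ with he
  rcases M.err_equation n ω k with ⟨h0, -⟩ | ⟨r, hr1, hr2, heq⟩
  -- An alternative that was never sampled has a vanishing Gram form, which contradicts the lower
  -- bound unless the error is zero.
  · have h1 := hgram v
    have h2 : M.gramForm n ω k v v = 0 :=
      Finset.sum_eq_zero fun m hm => if_neg (h0 m (Finset.mem_range.1 hm))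
    rw [h2] at h1
    have h3 : e ^ 2 ≤ 0 := by
      by_contra hcon
      have := mul_pos hΛ (not_le.1 hcon)
      linarith
    have : e = 0 := by nlinarith [norm_nonneg v]
    linarith
  by_contra hcon
  have hcon : δ < e := not_le.1 hcon
  have he0 : 0 < e := hδ.trans hcon
  set Q := M.gramForm n ω k v v with hQ
  set z := M.noise n ω k with hz
  -- The error is rescaled to length `B = δ / (2 * κ₇)`. If it exceeded `δ`, then `κ₇ * l ≤ 1 / 2`,
  -- and the quadratic compensator would consume at most half of `l * Q`; the other half contradicts
  -- `hnum`.
  set l := B / e with hl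
  have hl0 : 0 < l := by positivity
  have hle : l * e = B := by rw [hl]; field_simp
  have hr0 : 0 ≤ r := by linarith
  have hrn : r ≤ n := hr2.trans hρ
  have hw : ‖l • v‖ = B := by rw [norm_smul, Real.norm_of_nonneg hl0.le]; exact hle
  obtain ⟨θ, hθG, hθ⟩ := hG (l • v) hw.le
  have hβ : ∀ x : M.E, |⟪M.β k, x⟫| ≤ c.R * ‖x‖ := fun x =>
    (abs_real_inner_le_norm _ _).trans (by gcongr; exact M.norm_β k)
  have hQΛ : Λ * e ^ 2 ≤ Q := hgram v
  -- A crude bound on the noise, from testing the normal equation with the noise itself. It is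
  -- needed only to round `l • v` to the net, where the mesh `1 / n` compensates the factor `n`.
  have hz1 : ‖z‖ ≤ (r + n * c.κ₆ ^ 2) * e + r * c.R := by
    by_contra hcz
    have hcz := not_le.1 hcz
    have hz0 : 0 < ‖z‖ := lt_of_le_of_lt (by positivity) hcz
    have h1 := heq z
    rw [real_inner_self_eq_norm_sq] at h1
    have h2 : ⟪v, z⟫ ≤ e * ‖z‖ := real_inner_le_norm _ _
    have h3 := M.gramForm_le hω n k v z
    have h4 := (le_abs_self _).trans (hβ z)
    have h5 := mul_le_mul_of_nonneg_left h2 hr0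
    have h6 := mul_le_mul_of_nonneg_left h4 hr0
    have h7 : ‖z‖ ^ 2 ≤ ((r + n * c.κ₆ ^ 2) * e + r * c.R) * ‖z‖ := by nlinarith
    have h8 := mul_lt_mul_of_pos_right hcz hz0
    nlinarith
  have hv1 := heq v
  rw [real_inner_self_eq_norm_sq] at hv1
  have h1 : ⟪l • v, z⟫ = l * (r * e ^ 2 + Q + r * ⟪M.β k, v⟫) := by
    rw [real_inner_smul_left, real_inner_comm]
    congr 1; linarith
  have h2 : ⟪l • v, z⟫ = ⟪θ, z⟫ + ⟪l • v - θ, z⟫ := by rw [inner_sub_left]; ring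
  have h3 : ⟪l • v - θ, z⟫ ≤ 1 / n * ((r + n * c.κ₆ ^ 2) * e + r * c.R) :=
    (real_inner_le_norm _ _).trans (mul_le_mul hθ hz1 (norm_nonneg _) (by positivity))
  have h4 : M.gramForm n ω k θ θ ≤ 2 * (l ^ 2 * Q) + 2 * (n * (c.κ₆ ^ 2 * (1 / n) ^ 2)) := by
    refine (M.gramForm_self_le_two_mul n ω k θ (l • v)).trans ?_
    rw [gramForm_smul_self]
    have := M.gramForm_self_le hω n k (l • v - θ)
    have h5 : ‖l • v - θ‖ ^ 2 ≤ (1 / n : ℝ) ^ 2 := pow_le_pow_left₀ (norm_nonneg _) hθ 2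
    have h6 : (n : ℝ) * (c.κ₆ ^ 2 * ‖l • v - θ‖ ^ 2) ≤ n * (c.κ₆ ^ 2 * (1 / n) ^ 2) := by gcongr
    linarith
  have h5 := hdev θ hθG
  have h6 := mul_le_mul_of_nonneg_left h4 (by positivity : 0 ≤ c.κ₇ / 2)
  have h7 : (n : ℝ) * (c.κ₆ ^ 2 * (1 / n) ^ 2) = c.κ₆ ^ 2 * (1 / n) := by field_simp
  have h8 : (1 : ℝ) / n ≤ 1 := by
    rw [div_le_one hn0]; exact_mod_cast hn
  have h9 : 1 / (n : ℝ) * ((r + n * c.κ₆ ^ 2) * e + r * c.R) =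
      (r / n) * e + c.κ₆ ^ 2 * e + (r / n) * c.R := by field_simp
  have h10 : r / n ≤ 1 := by rwa [div_le_one hn0]
  have h11 : c.κ₇ * l ≤ 1 / 2 := by
    have : l ≤ B / δ := by rw [hl]; gcongr
    calc c.κ₇ * l ≤ c.κ₇ * (B / δ) := by gcongr
      _ = 1 / 2 := by rw [hB]; field_simp
  have hQ0 : 0 ≤ Q := (by positivity : 0 ≤ Λ * e ^ 2).trans hQΛ
  have h12 : c.κ₇ * l * (l * Q) ≤ 1 / 2 * (l * Q) := by gcongr
  have h13 : -(c.R * e) ≤ ⟪M.β k, v⟫ := (abs_le.1 (hβ v)).1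
  have h14 : l * (r * -(c.R * e)) ≤ l * (r * ⟪M.β k, v⟫) := by gcongr
  have h15 : l * (r * -(c.R * e)) = -(r * c.R * B) := by rw [← hle]; ring
  have h16 : r * c.R * B ≤ rho n * c.R * B := by gcongr
  have h17 : B * Λ * e ≤ l * Q := by
    calc B * Λ * e = l * (Λ * e ^ 2) := by rw [← hle]; ring
      _ ≤ l * Q := by gcongr
  have h18 : 0 ≤ l * (r * e ^ 2) := by positivity
  have h19 : c.κ₇ * (c.κ₆ ^ 2 * (1 / n)) ≤ c.κ₇ * (c.κ₆ ^ 2 * 1) := by gcongr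
  have h20 : r / n * e ≤ 1 * e := by gcongr
  have h21 : r / n * c.R ≤ 1 * c.R := by gcongr
  have key : e * (B * Λ / 2 - 1 - c.κ₆ ^ 2) < rho n * c.R * B + c.κ₇ * c.κ₆ ^ 2 + T + c.R := by
    rw [h7] at h6
    rw [h9] at h3
    have e1 : l * (r * e ^ 2 + Q + r * ⟪M.β k, v⟫) =
      l * (r * e ^ 2) + l * Q + l * (r * ⟪M.β k, v⟫) := by ring
    have e2 : c.κ₇ / 2 * (2 * (l ^ 2 * Q) + 2 * (c.κ₆ ^ 2 * (1 / n))) =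
      c.κ₇ * l * (l * Q) + c.κ₇ * (c.κ₆ ^ 2 * (1 / n)) := by ring
    have e3 : e * (B * Λ / 2 - 1 - c.κ₆ ^ 2) = B * Λ * e / 2 - e - c.κ₆ ^ 2 * e := by ring
    rw [e1] at h1
    rw [e2] at h6
    rw [e3]
    linarith
  have hT : 0 ≤ B * Λ / 2 - 1 - c.κ₆ ^ 2 := by
    by_contra hneg
    have hneg := not_le.1 hneg
    have h22 := mul_neg_of_pos_of_neg hδ hneg
    have h23 : 0 ≤ rho n * c.R * B := by have := one_le_rho n; positivity
    have h24 : 0 ≤ c.κ₇ * c.κ₆ ^ 2 := by positivity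
    linarith
  have := mul_le_mul_of_nonneg_right hcon.le hT
  linarith

/-- In a forced period the alternative is sampled for every context, in particular on its optimal
cell, which alone carries information `κ₈`. -/
lemma le_infoForm_of_pick (m : ℕ) (k : Fin M.K) (hk : ∀ s x, M.pick m s x = k) (s : M.Ctrl)
    (v : M.E) : c.κ₈ * ‖v‖ ^ 2 ≤ M.infoForm m s k v := by
  refine (M.le_infoForm_opt k v).trans ?_
  simp only [infoForm, hk, if_true]
  refine integral_mono (M.integrable_ite_inner_sq (A := {x | M.opt x = k})
    (M.measurable_opt (measurableSet_singleton k)) v) ?_ fun x => ?_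
  · simpa using M.integrable_ite_inner_sq (A := Set.univ) MeasurableSet.univ v
  · simp only
    split_ifs
    · exact le_rfl
    · positivity

/-- Consistency of the estimates, with a probability of failure that decreases faster than any
power of `n`. -/
lemma measure_err_gt_le (c : Constants) {δ : ℝ} (hδ : 0 < δ) : ∃ n₀ : ℕ, ∀ M : Model.{u} c,
    ∀ n ≥ n₀, M.P {ω | ∃ k, δ < ‖M.err n ω k‖} ≤
      ENNReal.ofReal (Real.exp (-(Real.log n ^ 7))) := by
  obtain ⟨γ, hγ, n₁, hexp⟩ := exists_explore.{u} c
  have hκ₇ := c.hκ₇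
  have hκ₆ := c.hκ₆
  have hκ₈ := c.hκ₈
  have hR := c.hR
  have hsz := c.one_le_size
  set B := δ / (2 * c.κ₇) with hB
  have hB0 : 0 < B := by positivity
  -- The deviation `η * d * A.card` takes at most half of the expected information `κ₈ * A.card`;
  -- the second bound is the one required for the concentration inequality.
  set η := min (c.κ₈ / (2 * c.size)) (4 * c.κ₆ ^ 2) with hη
  have hη0 : 0 < η := lt_min (by positivity) (by positivity)
  have hη1 : η * c.size ≤ c.κ₈ / 2 := by
    calc η * c.size ≤ c.κ₈ / (2 * c.size) * c.size := by gcongr; exact min_le_left _ _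
      _ = _ := by field_simp
  set γ' := η ^ 2 / (16 * c.κ₆ ^ 4) * γ with hγ'
  have hγ'0 : 0 < γ' := by positivity
  set D := ⌈c.size⌉₊ with hD
  set C₁ := 2 * B * c.size + 5 with hC₁
  have hC₁1 : 1 ≤ C₁ := by nlinarith
  have ev1 : ∀ᶠ n : ℕ in Filter.atTop, max 1 (max
      (2 * ((2 * c.R * B + c.κ₇ * c.κ₆ ^ 2 + 1 + c.R) + δ * (1 + c.κ₆ ^ 2)) / (δ * B * (c.κ₈ * γ / 2)))
      (max (Real.log (2 * c.size) + D * Real.log C₁ + D + 1)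
        ((Real.log (4 * c.size ^ 3) + 1) / γ'))) ≤ Real.log n :=
    (tendsto_log_natCast.eventually_ge_atTop _)
  have ev2 : ∀ᶠ n : ℕ in Filter.atTop, rho n ≤ n := by
    have h1 : (fun x : ℝ => Real.log x ^ 3) =o[Filter.atTop] (id : ℝ → ℝ) :=
      Real.isLittleO_pow_log_id_atTop
    have h2 := (h1.comp_tendsto tendsto_natCast_atTop_atTop).bound (c := 1 / 2) (by norm_num)
    filter_upwards [h2, Filter.eventually_ge_atTop 2] with n hn hn2
    have hn2' : (2 : ℝ) ≤ n := by exact_mod_cast hn2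
    simp only [Function.comp_apply, id, Real.norm_eq_abs] at hn
    rw [abs_of_nonneg (by linarith : (0 : ℝ) ≤ n)] at hn
    have := (le_abs_self _).trans hn
    unfold rho; linarith
  obtain ⟨n₂, hn₂⟩ := Filter.eventually_atTop.1 (ev1.and ev2)
  refine ⟨max (max n₁ n₂) 1, fun M n hn => ?_⟩
  have hnn₁ : n₁ ≤ n := (le_max_left _ _).trans ((le_max_left _ _).trans hn)
  have hnn₂ : n₂ ≤ n := (le_max_right _ _).trans ((le_max_left _ _).trans hn)
  have hn1 : 1 ≤ n := (le_max_right _ _).trans hn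
  obtain ⟨hl', hρ⟩ := hn₂ n hnn₂
  have hn0 : (0 : ℝ) < n := by exact_mod_cast hn1
  simp only [max_le_iff] at hl'
  obtain ⟨hl1, hl2, hl3, hl4⟩ := hl'
  have hnexp : (n : ℝ) = Real.exp (Real.log n) := (Real.exp_log hn0).symm
  have hrho : rho n = 1 + Real.log n ^ 3 := rfl
  set l := Real.log n with hl
  have hl0 : 0 < l := by linarith
  have hle : ∀ i j : ℕ, i ≤ j → l ^ i ≤ l ^ j := fun i j hij => pow_le_pow_right₀ hl1 hij
  have hKs := M.K_le_size
  have hds := M.d_le_size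
  obtain ⟨G, hGcard, hG⟩ := exists_net M.d n hn1 hB0.le
  choose A hAn hAcard hApick using hexp M n hnn₁
  -- The noise threshold `l ^ 8` lies below the information, of order `l ^ 9`, and above the
  -- regularization, of order `l ^ 3`. The net has only `exp (O(l))` points, so the union bound
  -- preserves the decay `exp (-(l ^ 7))`.
  set U : Fin M.K → Set M.Ω := fun k => ⋃ θ ∈ G, {ω | l ^ 8 ≤ ⟪θ, M.noise n ω k⟫ -
    c.κ₇ / 2 * M.gramForm n ω k θ θ} with hU
  set V : Fin M.K → Set M.Ω := fun k => {ω | ∃ v : M.E, M.gramForm n ω k v v <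
      ∑ m ∈ A k, M.infoForm m (M.ctrl m ω) k v - η * M.d * (A k).card * ‖v‖ ^ 2} with hV
  have hUm : ∀ k, M.P (U k) ≤ ENNReal.ofReal ((n * C₁) ^ D * Real.exp (-(l ^ 8))) := by
    intro k
    refine (measure_biUnion_finset_le _ _).trans ?_
    refine (Finset.sum_le_sum fun θ _ => M.measure_noise_deviation_le n k θ (l ^ 8)).trans ?_
    rw [Finset.sum_const, nsmul_eq_mul, ← ENNReal.ofReal_natCast,
      ← ENNReal.ofReal_mul (Nat.cast_nonneg _)]
    refine ENNReal.ofReal_le_ofReal ?_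
    refine mul_le_mul_of_nonneg_right (hGcard.trans ?_) (Real.exp_pos _).le
    have h1 : (n : ℝ) * (2 * B * M.d + 5) ≤ n * C₁ := by rw [hC₁]; gcongr
    have h2 : M.d ≤ D := by exact_mod_cast hds.trans (Nat.le_ceil _)
    refine (pow_le_pow_left₀ (by positivity) h1 _).trans (pow_le_pow_right₀ ?_ h2)
    have : (1 : ℝ) ≤ n := by exact_mod_cast hn1
    nlinarith
  have hVm : ∀ k, M.P (V k) ≤ ENNReal.ofReal (2 * c.size ^ 2 * Real.exp (-(γ' * l ^ 9))) := by
    intro k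
    refine (M.measure_gramForm_lt_le n k (A k) (hAn k) hη0.le (min_le_right _ _)).trans ?_
    refine ENNReal.ofReal_le_ofReal ?_
    have h1 : γ' * l ^ 9 ≤ η ^ 2 / (16 * c.κ₆ ^ 4) * (A k).card := by
      rw [hγ', mul_assoc]
      exact mul_le_mul_of_nonneg_left (hAcard k) (by positivity)
    gcongr
  have hcover : {ω | ∃ k, δ < ‖M.err n ω k‖} ≤ᵐ[M.P] ⋃ k, (U k ∪ V k) := by
    filter_upwards [M.ae_norm_X_le] with ω hω hex
    obtain ⟨k, hk⟩ := hex
    by_contra hcon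
    have hUV : ω ∉ U k ∪ V k := fun h => hcon (Set.mem_iUnion.2 ⟨k, h⟩)
    have hωU : ω ∉ U k := fun h => hUV (Or.inl h)
    have hωV : ω ∉ V k := fun h => hUV (Or.inr h)
    refine absurd hk (not_lt.2 ?_)
    refine M.norm_err_le_of_net hω hn1 hρ k (Λ := c.κ₈ / 2 * (γ * l ^ 9)) (T := l ^ 8)
      (by positivity) (by positivity) hδ (fun v => ?_) hG (fun θ hθ => ?_) ?_
    · by_contra hv
      refine hωV ⟨v, lt_of_lt_of_le (not_le.1 hv) ?_⟩
      have h1 : ((A k).card : ℝ) * (c.κ₈ * ‖v‖ ^ 2) ≤ ∑ m ∈ A k, M.infoForm m (M.ctrl m ω) k v := by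
        rw [← nsmul_eq_mul]
        exact Finset.card_nsmul_le_sum _ _ _ fun m hm =>
          M.le_infoForm_of_pick m k (hApick k m hm) _ v
      have h2 : η * M.d ≤ c.κ₈ / 2 := le_trans (by gcongr) hη1
      have hA0 : (0 : ℝ) ≤ (A k).card := Nat.cast_nonneg _
      have hA1 := hAcard k
      generalize ((A k).card : ℝ) = N at *
      have h3 : η * M.d * N * ‖v‖ ^ 2 ≤ c.κ₈ / 2 * N * ‖v‖ ^ 2 := by gcongr
      have h4 : c.κ₈ / 2 * (γ * l ^ 9) * ‖v‖ ^ 2 ≤ c.κ₈ / 2 * N * ‖v‖ ^ 2 := by gcongr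
      nlinarith
    · by_contra hθ'
      exact hωU (Set.mem_biUnion hθ (not_lt.1 hθ'))
    · rw [div_le_iff₀ (by positivity)] at hl2
      have h8 : 0 < l ^ 8 := by positivity
      have h2 := mul_le_mul_of_nonneg_right hl2 h8.le
      have h3 : l * (δ * B * (c.κ₈ * γ / 2)) * l ^ 8 =
        2 * (δ * (B * (c.κ₈ / 2 * (γ * l ^ 9)) / 2)) := by ring
      rw [h3] at h2
      have h38 := hle 3 8 (by norm_num)
      have h08 := hle 0 8 (by norm_num)
      rw [pow_zero] at h08
      have h4 : rho n * c.R * B ≤ 2 * c.R * B * l ^ 8 := by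
        have : rho n ≤ 2 * l ^ 8 := by rw [hrho]; linarith
        calc rho n * c.R * B ≤ 2 * l ^ 8 * c.R * B := by gcongr
          _ = _ := by ring
      have h5 : c.κ₇ * c.κ₆ ^ 2 * 1 ≤ c.κ₇ * c.κ₆ ^ 2 * l ^ 8 := by gcongr
      have h6 : c.R * 1 ≤ c.R * l ^ 8 := by gcongr
      have h7 : δ * (1 + c.κ₆ ^ 2) * 1 ≤ δ * (1 + c.κ₆ ^ 2) * l ^ 8 := by gcongr
      have h9 : 2 * ((2 * c.R * B + c.κ₇ * c.κ₆ ^ 2 + 1 + c.R) + δ * (1 + c.κ₆ ^ 2)) * l ^ 8 =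
        2 * (2 * c.R * B * l ^ 8 + c.κ₇ * c.κ₆ ^ 2 * l ^ 8 + l ^ 8 + c.R * l ^ 8 +
          δ * (1 + c.κ₆ ^ 2) * l ^ 8) := by ring
      rw [h9] at h2
      have h10 : δ * (B * (c.κ₈ / 2 * (γ * l ^ 9)) / 2 - 1 - c.κ₆ ^ 2) =
        δ * (B * (c.κ₈ / 2 * (γ * l ^ 9)) / 2) - δ * (1 + c.κ₆ ^ 2) := by ring
      rw [h10]
      linarith
  refine (measure_mono_ae hcover).trans ?_
  refine (measure_iUnion_fintype_le _ _).trans ?_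
  calc _ ≤ ∑ _k : Fin M.K, (ENNReal.ofReal ((n * C₁) ^ D * Real.exp (-(l ^ 8))) +
        ENNReal.ofReal (2 * c.size ^ 2 * Real.exp (-(γ' * l ^ 9)))) :=
        Finset.sum_le_sum fun k _ => (measure_union_le _ _).trans (add_le_add (hUm k) (hVm k))
    _ = ENNReal.ofReal (M.K * ((n * C₁) ^ D * Real.exp (-(l ^ 8)) +
        2 * c.size ^ 2 * Real.exp (-(γ' * l ^ 9)))) := by
        rw [← ENNReal.ofReal_add (by positivity) (by positivity), Finset.sum_const,
          Finset.card_univ, Fintype.card_fin, nsmul_eq_mul, ← ENNReal.ofReal_natCast,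
          ← ENNReal.ofReal_mul (by positivity)]
    _ ≤ _ := by
        refine ENNReal.ofReal_le_ofReal ?_
        have h7 : 0 < l ^ 7 := by positivity
        have h17 := hle 1 7 (by norm_num)
        have h07 := hle 0 7 (by norm_num)
        rw [pow_zero] at h07
        rw [pow_one] at h17
        have hlogC : 0 ≤ Real.log C₁ := Real.log_nonneg hC₁1
        have b1 : c.size * ((n * C₁) ^ D * Real.exp (-(l ^ 8))) ≤ Real.exp (-(l ^ 7)) / 2 := by
          have e1 : (n * C₁) ^ D = Real.exp (D * (l + Real.log C₁)) := by
            rw [← Real.exp_log (by linarith : 0 < C₁), hnexp, ← Real.exp_add, ← Real.exp_nat_mul,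
              Real.log_exp]
          have e2 : 2 * c.size = Real.exp (Real.log (2 * c.size)) :=
            (Real.exp_log (by linarith)).symm
          have h3 : Real.exp (Real.log (2 * c.size)) * (Real.exp (D * (l + Real.log C₁)) *
              Real.exp (-(l ^ 8))) ≤ Real.exp (-(l ^ 7)) := by
            rw [← Real.exp_add, ← Real.exp_add]
            refine Real.exp_le_exp.2 ?_
            have h4 := mul_le_mul_of_nonneg_right hl3 h7.le
            have h5 : l * l ^ 7 = l ^ 8 := by ring
            have h6 : Real.log (2 * c.size) * 1 ≤ Real.log (2 * c.size) * l ^ 7 := by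
              gcongr; exact Real.log_nonneg (by linarith)
            have h8 : D * Real.log C₁ * 1 ≤ D * Real.log C₁ * l ^ 7 := by gcongr
            have h9 : (D : ℝ) * l ≤ D * l ^ 7 := by gcongr
            linarith
          rw [← e1, ← e2] at h3
          linarith
        have b2 : c.size * (2 * c.size ^ 2 * Real.exp (-(γ' * l ^ 9))) ≤
            Real.exp (-(l ^ 7)) / 2 := by
          have e2 : 4 * c.size ^ 3 = Real.exp (Real.log (4 * c.size ^ 3)) :=
            (Real.exp_log (by positivity)).symm
          have h3 : Real.exp (Real.log (4 * c.size ^ 3)) * Real.exp (-(γ' * l ^ 9)) ≤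
              Real.exp (-(l ^ 7)) := by
            rw [← Real.exp_add]
            refine Real.exp_le_exp.2 ?_
            rw [div_le_iff₀ hγ'0] at hl4
            have h4 := mul_le_mul_of_nonneg_right hl4 h7.le
            have h5 : l * γ' * l ^ 7 = γ' * l ^ 8 := by ring
            have h89 := mul_le_mul_of_nonneg_left (hle 8 9 (by norm_num)) hγ'0.le
            have h6 : Real.log (4 * c.size ^ 3) * 1 ≤ Real.log (4 * c.size ^ 3) * l ^ 7 := by
              gcongr
              refine Real.log_nonneg ?_
              have : 1 ≤ c.size ^ 3 := one_le_pow₀ hsz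
              linarith
            linarith
          rw [← e2] at h3
          linarith
        have h3 : (M.K : ℝ) * ((n * C₁) ^ D * Real.exp (-(l ^ 8)) +
            2 * c.size ^ 2 * Real.exp (-(γ' * l ^ 9))) ≤ c.size * ((n * C₁) ^ D *
            Real.exp (-(l ^ 8)) + 2 * c.size ^ 2 * Real.exp (-(γ' * l ^ 9))) := by gcongr
        linarith

end Model

/-! ### The potential of the dual vector and its exponential moments. -/

lemma measurable_uncurry_fst {α β γ δ : Type*} [MeasurableSpace α] [MeasurableSpace β]
    [MeasurableSpace γ] [MeasurableSpace δ] {f : α → β → δ} (hf : Measurable (Function.uncurry f)) :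
    Measurable (Function.uncurry fun (s : α) (z : β × γ) => f s z.1) :=
  hf.comp (measurable_fst.prodMk measurable_snd.fst)

namespace Model

variable {c : Constants} (M : Model.{u} c)

/-- The average of `g - gstar`, which is preserved by the algorithm. -/
def meanGap : ℝ := (∑ k, (M.I.g₀ k - M.gstar k)) / M.K

/-- The centred deviation of a dual vector from the optimal one. -/
def cen (g : Fin M.K → ℝ) (k : Fin M.K) : ℝ := g k - M.gstar k - M.meanGap

/-- The squared distance to the optimal dual vector, modulo constants. -/
def pot (g : Fin M.K → ℝ) : ℝ := ∑ k, M.cen g k ^ 2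

/-- The update of the dual vector with step size `γ`. -/
def next (γ : ℝ) (s : M.Ctrl) (x : M.E) (k : Fin M.K) : ℝ :=
  s.1 k + γ * (-(if k = M.dec s x then 1 else 0) + M.I.p k)

lemma ctrl_succ (n : ℕ) (ω : M.Ω) : (M.ctrl (n + 1) ω).1 =
    M.next (c.α / ((n : ℝ) + 1)) (M.ctrl n ω) (M.X n ω) := by
  ext k
  simp only [next, ← M.hα]
  exact M.g_succ n ω k

lemma pot_nonneg (g : Fin M.K → ℝ) : 0 ≤ M.pot g := Finset.sum_nonneg fun _ _ => sq_nonneg _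

lemma cen_next (γ : ℝ) (s : M.Ctrl) (x : M.E) (k : Fin M.K) : M.cen (M.next γ s x) k =
    M.cen s.1 k + γ * (-(if k = M.dec s x then 1 else 0) + M.I.p k) := by
  simp only [cen, next]; ring

/-- The increments sum to `-1 + ∑ p = 0`, so the average deviation keeps its initial value. -/
lemma sum_cen (n : ℕ) (ω : M.Ω) : ∑ k, M.cen (M.ctrl n ω).1 k = 0 := by
  induction n with
  | zero =>
    have hK : (M.K : ℝ) ≠ 0 := by have := M.one_le_K; linarith
    have : (M.ctrl 0 ω).1 = M.I.g₀ := rfl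
    simp only [this, cen, meanGap]
    rw [Finset.sum_sub_distrib (g := fun _ => _), Finset.sum_const, Finset.card_univ,
      Fintype.card_fin, nsmul_eq_mul]
    field_simp
    ring
  | succ n ih =>
    rw [ctrl_succ]
    simp only [cen_next]
    rw [Finset.sum_add_distrib, ih, ← Finset.mul_sum, Finset.sum_add_distrib, M.p_sum]
    simp

lemma p_le_one (k : Fin M.K) : M.I.p k ≤ 1 := by
  rw [← M.p_sum]
  exact Finset.single_le_sum (fun k _ => M.p_nonneg k) (Finset.mem_univ k)

lemma abs_step_le (k i : Fin M.K) : |(-(if k = i then 1 else 0) + M.I.p k : ℝ)| ≤ 1 := by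
  have h1 := M.p_nonneg k
  have h2 := M.p_le_one k
  split_ifs <;> rw [abs_le] <;> constructor <;> linarith

/-- A deterministic bound on the centred deviations. -/
def _root_.SemidiscreteOT.Constants.width (c : Constants) (n : ℕ) : ℝ :=
  2 * c.R + c.α * (1 + Real.log n)

/-- A step moves a component by at most `α / (n + 1)`, and the steps add up to a harmonic sum;
initially the deviation and its mean are each at most `R`. -/
lemma abs_cen_le (n : ℕ) (ω : M.Ω) (k : Fin M.K) : |M.cen (M.ctrl n ω).1 k| ≤ c.width n := by
  have hα := c.hα
  have h1 : |M.cen (M.ctrl n ω).1 k| ≤ 2 * c.R + c.α * (harmonic n : ℝ) := by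
    induction n with
    | zero =>
      have h2 : |M.meanGap| ≤ c.R := by
        have hK : (0 : ℝ) < M.K := by have := M.one_le_K; linarith
        rw [meanGap, abs_div, abs_of_pos hK, div_le_iff₀ hK]
        refine (Finset.abs_sum_le_sum_abs _ _).trans ?_
        refine (Finset.sum_le_sum fun k _ => M.abs_g₀ k).trans_eq ?_
        simp [mul_comm]
      have h3 := M.abs_g₀ k
      have h4 : (M.ctrl 0 ω).1 = M.I.g₀ := rfl
      rw [h4, cen]
      simp only [harmonic_zero, Rat.cast_zero, mul_zero, add_zero]
      exact (abs_sub _ _).trans (by linarith)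
    | succ n ih =>
      rw [ctrl_succ, cen_next, harmonic_succ]
      refine (abs_add_le _ _).trans ?_
      have h2 : |c.α / ((n : ℝ) + 1) *
          (-(if k = M.dec (M.ctrl n ω) (M.X n ω) then 1 else 0) + M.I.p k)| ≤
          c.α / ((n : ℝ) + 1) * 1 := by
        rw [abs_mul, abs_of_nonneg (by positivity)]
        exact mul_le_mul_of_nonneg_left (M.abs_step_le _ _) (by positivity)
      push_cast
      have e : c.α * ((harmonic n : ℝ) + ((n : ℝ) + 1)⁻¹) =
        c.α * (harmonic n : ℝ) + c.α / ((n : ℝ) + 1) * 1 := by ring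
      rw [e]; linarith
  refine h1.trans ?_
  have := mul_le_mul_of_nonneg_left (harmonic_le_one_add_log n) hα.le
  unfold Constants.width; linarith

lemma pot_ctrl_le (n : ℕ) (ω : M.Ω) : M.pot (M.ctrl n ω).1 ≤ c.size * c.width n ^ 2 := by
  calc _ ≤ ∑ _k : Fin M.K, c.width n ^ 2 := by
        refine Finset.sum_le_sum fun k _ => ?_
        rw [← sq_abs]
        exact pow_le_pow_left₀ (abs_nonneg _) (M.abs_cen_le n ω k) 2
    _ ≤ _ := by
        simp only [Finset.sum_const, Finset.card_univ, Fintype.card_fin, nsmul_eq_mul]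
        have := M.K_le_size
        gcongr

lemma measurable_cen (k : Fin M.K) : Measurable fun g => M.cen g k := by
  unfold cen; fun_prop

lemma measurable_pot : Measurable M.pot :=
  Finset.measurable_fun_sum _ fun k _ => (M.measurable_cen k).pow_const 2

/-- First-order optimality replaces the integral over the optimal decision by a `p`-average. The
centring constant cancels, so the drift is the mean increment direction paired with the centred
deviation. -/
lemma drift_eq (s : M.Ctrl) :
    M.drift s = ∑ k, M.I.p k * M.cen s.1 k - ∫ x, M.cen s.1 (M.dec s x) ∂M.ν := by
  rw [M.sum_p_mul, ← integral_sub (M.integrable_comp_index _ M.measurable_opt)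
    (M.integrable_comp_index _ (M.measurable_dec_right s)), drift]
  refine integral_congr_ae (Filter.Eventually.of_forall fun x => ?_)
  simp only [cen]; ring

/-- Expansion of the square: the linear term is the drift plus a fluctuation of mean zero, and the
squared increment is at most `∑ (1{k = i} + p k) = 2`. -/
lemma pot_next_le (γ : ℝ) (s : M.Ctrl) (x : M.E) : M.pot (M.next γ s x) ≤ M.pot s.1 +
    2 * γ * (M.drift s + (∫ x', M.cen s.1 (M.dec s x') ∂M.ν - M.cen s.1 (M.dec s x))) +
      2 * γ ^ 2 := by
  set i := M.dec s x with hi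
  have h1 : M.pot (M.next γ s x) = M.pot s.1 +
      2 * γ * ∑ k, M.cen s.1 k * (-(if k = i then 1 else 0) + M.I.p k) +
      γ ^ 2 * ∑ k, (-(if k = i then 1 else 0) + M.I.p k) ^ 2 := by
    simp only [pot, cen_next, Finset.mul_sum, ← Finset.sum_add_distrib]
    refine Finset.sum_congr rfl fun k _ => ?_
    rw [← hi]; ring
  have h2 : ∑ k, M.cen s.1 k * (-(if k = i then 1 else 0) + M.I.p k) =
      ∑ k, M.I.p k * M.cen s.1 k - M.cen s.1 i := by
    simp only [mul_add, Finset.sum_add_distrib, mul_neg, mul_ite, mul_one, mul_zero,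
      Finset.sum_neg_distrib, Finset.sum_ite_eq', Finset.mem_univ, if_true]
    rw [Finset.sum_congr rfl fun k _ => mul_comm (M.cen s.1 k) (M.I.p k)]
    ring
  have h3 : ∑ k, (-(if k = i then 1 else 0) + M.I.p k : ℝ) ^ 2 ≤ 2 := by
    calc _ ≤ ∑ k, ((if k = i then 1 else 0) + M.I.p k) := by
          refine Finset.sum_le_sum fun k _ => ?_
          have h1 := M.p_nonneg k
          have h2 := M.p_le_one k
          split_ifs <;> nlinarith
      _ = 2 := by
          rw [Finset.sum_add_distrib, M.p_sum]; norm_num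
  have h4 := mul_le_mul_of_nonneg_left h3 (sq_nonneg γ)
  rw [h1, h2, M.drift_eq s]
  linarith

/-- Only the fluctuation in `pot_next_le` is random. It is bounded in terms of `W`, and the crude
Hoeffding bound with tilt `2 * γ * θ` applies. -/
lemma lintegral_exp_pot_next_le (n : ℕ) {γ θ W : ℝ} (hγ : 0 ≤ γ) (hθ : 0 ≤ θ) (s : M.Ctrl)
    (hW : ∀ k, |M.cen s.1 k| ≤ W) (hsmall : 4 * W * γ * θ ≤ 1) :
    ∫⁻ ω, ENNReal.ofReal (Real.exp (θ * M.pot (M.next γ s (M.X n ω)))) ∂M.P ≤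
      ENNReal.ofReal (Real.exp (θ * (M.pot s.1 + 2 * γ * M.drift s + 2 * γ ^ 2) +
        16 * W ^ 2 * γ ^ 2 * θ ^ 2)) := by
  have hmf : Measurable fun x => M.cen s.1 (M.dec s x) :=
    (measurable_of_finite (M.cen s.1)).comp (M.measurable_dec_right s)
  have h := lintegral_exp_mean_sub_le (P := M.P) (Y := fun ω => M.cen s.1 (M.dec s (M.X n ω)))
    (B := W) (t := 2 * γ * θ) (hmf.comp (M.measurable_X n)).aestronglyMeasurable
    (Filter.Eventually.of_forall fun ω => hW _) (by positivity) (by linarith)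
  rw [M.integral_X n hmf] at h
  calc _ ≤ ∫⁻ ω, ENNReal.ofReal (Real.exp (θ * (M.pot s.1 + 2 * γ * M.drift s + 2 * γ ^ 2))) *
        ENNReal.ofReal (Real.exp (2 * γ * θ * (∫ x, M.cen s.1 (M.dec s x) ∂M.ν -
          M.cen s.1 (M.dec s (M.X n ω))))) ∂M.P := by
        refine lintegral_mono fun ω => ?_
        rw [← ENNReal.ofReal_mul (Real.exp_pos _).le, ← Real.exp_add]
        refine ENNReal.ofReal_le_ofReal (Real.exp_le_exp.2 ?_)
        have := mul_le_mul_of_nonneg_left (M.pot_next_le γ s (M.X n ω)) hθ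
        linarith
    _ ≤ _ := by
        rw [lintegral_const_mul' _ _ ENNReal.ofReal_ne_top]
        refine (mul_le_mul_right h _).trans_eq ?_
        rw [← ENNReal.ofReal_mul (Real.exp_pos _).le, ← Real.exp_add]
        congr 2; ring

/-- Deviations with sum zero have a nonnegative maximum and a nonpositive minimum, so each is
bounded by their difference. -/
lemma exists_max_spread {g : Fin M.K → ℝ} (hg : ∑ k, M.cen g k = 0) :
    ∃ j k, (∀ i l, M.cen g i - M.cen g l ≤ M.cen g j - M.cen g k) ∧
      M.pot g ≤ M.K * (M.cen g j - M.cen g k) ^ 2 := by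
  obtain ⟨j, hj⟩ := Finite.exists_max (M.cen g)
  obtain ⟨k, hk⟩ := Finite.exists_min (M.cen g)
  have hj0 : 0 ≤ M.cen g j := by
    by_contra h
    have : ∑ k, M.cen g k < 0 :=
      Finset.sum_neg (fun i _ => (hj i).trans_lt (not_le.1 h)) ⟨j, Finset.mem_univ _⟩
    linarith
  have hk0 : M.cen g k ≤ 0 := by
    by_contra h
    have : 0 < ∑ k, M.cen g k :=
      Finset.sum_pos (fun i _ => (not_le.1 h).trans_le (hk i)) ⟨j, Finset.mem_univ _⟩
    linarith
  refine ⟨j, k, fun i l => by linarith [hj i, hk l], ?_⟩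
  calc M.pot g ≤ ∑ _i : Fin M.K, (M.cen g j - M.cen g k) ^ 2 := by
        refine Finset.sum_le_sum fun i _ => ?_
        rw [← sq_abs (M.cen g i)]
        refine pow_le_pow_left₀ (abs_nonneg _) (abs_le.2 ⟨?_, ?_⟩) 2 <;> linarith [hj i, hk i]
    _ = _ := by simp

lemma cen_sub (g : Fin M.K → ℝ) (j k : Fin M.K) :
    M.cen g j - M.cen g k = (g j - M.gstar j) - (g k - M.gstar k) := by
  simp only [cen]; ring

lemma measurable_err (n : ℕ) (k : Fin M.K) : Measurable[M.F n] fun ω => M.err n ω k := by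
  have h1 : Measurable fun s : M.Ctrl => s.2 k - M.β k :=
    ((measurable_pi_apply k).comp measurable_snd).sub measurable_const
  exact h1.comp (M.measurable_ctrl n)

/-- The event that the estimates are accurate between the times `N` and `m`. -/
def accurate (δ : ℝ) (N m : ℕ) : Set M.Ω :=
  ⋂ i ∈ Finset.Ico N m, ⋂ k, {ω | ‖M.err i ω k‖ ≤ δ}

lemma mem_accurate {δ : ℝ} {N m : ℕ} {ω : M.Ω} :
    ω ∈ M.accurate δ N m ↔ ∀ i, N ≤ i → i < m → ∀ k, ‖M.err i ω k‖ ≤ δ := by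
  simp only [accurate, Finset.mem_Ico, Set.mem_iInter, Set.mem_ofPred_eq, and_imp]

/-- The event up to `m` excludes time `m`, so the event up to `n + 1` is known after `n` periods;
this lets it serve as a weight when period `n` is integrated. -/
lemma measurableSet_accurate (δ : ℝ) (N m n : ℕ) (hmn : m ≤ n + 1) :
    MeasurableSet[M.F n] (M.accurate δ N m) := by
  refine @Finset.measurableSet_biInter _ _ (M.F n) _ _ fun i hi => ?_
  refine @MeasurableSet.iInter _ _ (M.F n) _ _ fun k => ?_
  have h1 : Measurable[M.F n] fun ω => M.err i ω k :=
    M.measurable_F_mono (by have := (Finset.mem_Ico.1 hi).2; omega) (M.measurable_err i k)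
  have h2 : MeasurableSet {v : M.E | ‖v‖ ≤ δ} := measurableSet_le measurable_norm measurable_const
  exact h1 h2

lemma measurableSet_dec_eq (k : Fin M.K) :
    MeasurableSet {q : M.Ctrl × M.E | k = M.dec q.1 q.2} := by
  have e : {q : M.Ctrl × M.E | k = M.dec q.1 q.2} = (fun q => M.dec q.1 q.2) ⁻¹' {k} := by
    ext q; simp [eq_comm]
  rw [e]
  exact M.measurable_dec (measurableSet_singleton k)

lemma measurable_next (γ : ℝ) : Measurable fun q : M.Ctrl × M.E => M.next γ q.1 q.2 := by
  refine measurable_pi_lambda _ fun k => ?_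
  have h1 : Measurable fun q : M.Ctrl × M.E => q.1.1 k :=
    (measurable_pi_apply k).comp measurable_fst.fst
  have h2 : Measurable fun q : M.Ctrl × M.E => (if k = M.dec q.1 q.2 then 1 else 0 : ℝ) :=
    Measurable.ite (M.measurableSet_dec_eq k) measurable_const measurable_const
  exact h1.add (measurable_const.mul (h2.neg.add measurable_const))

/-- One step of the exponential recursion for the potential. -/
lemma lintegral_exp_pot_succ_le {δ s₀ c₁ θ : ℝ} (hθ : 0 ≤ θ)
    (hdrift : ∀ m ω, (∀ k, ‖M.err m ω k‖ ≤ δ) → s₀ ≤ M.pot (M.ctrl m ω).1 →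
      M.drift (M.ctrl m ω) ≤ -c₁)
    {N m : ℕ} (hNm : N ≤ m)
    (h1 : 4 * c.width m * (c.α / ((m : ℝ) + 1)) * θ ≤ 1)
    (h2 : c.α / ((m : ℝ) + 1) * (2 + 16 * c.width m ^ 2 * θ) ≤ c₁)
    (h3 : c.α / ((m : ℝ) + 1) * (4 * c.κ₆ * δ + c₁) ≤ s₀) :
    ∫⁻ ω in M.accurate δ N (m + 1), ENNReal.ofReal (Real.exp (θ * M.pot (M.ctrl (m + 1) ω).1)) ∂M.P
      ≤ ENNReal.ofReal (Real.exp (-(θ * c.α * c₁ / ((m : ℝ) + 1)))) *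
        ∫⁻ ω in M.accurate δ N m, ENNReal.ofReal (Real.exp (θ * M.pot (M.ctrl m ω).1)) ∂M.P +
        ENNReal.ofReal (Real.exp (2 * θ * s₀)) := by
  set γ := c.α / ((m : ℝ) + 1) with hγ
  have hγ0 : 0 ≤ γ := by have := c.hα; positivity
  have hacc := M.measurableSet_accurate δ N (m + 1) m le_rfl
  have hacc' : MeasurableSet (M.accurate δ N (m + 1)) := M.F_le m _ hacc
  have haccm : MeasurableSet (M.accurate δ N m) :=
    M.F_le m _ (M.measurableSet_accurate δ N m m (by omega))
  have hw : Measurable[M.F m] ((M.accurate δ N (m + 1)).indicator (fun _ => (1 : ℝ≥0∞))) :=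
    (@measurable_const _ _ _ (M.F m) (1 : ℝ≥0∞)).indicator hacc
  have hh : Measurable (Function.uncurry fun (s : M.Ctrl) (z : M.E × (Fin M.K → ℝ)) =>
      ENNReal.ofReal (Real.exp (θ * M.pot (M.next γ s z.1)))) := by
    have h4 : Measurable (Function.uncurry fun (s : M.Ctrl) (x : M.E) =>
        ENNReal.ofReal (Real.exp (θ * M.pot (M.next γ s x)))) :=
      ENNReal.measurable_ofReal.comp (Real.measurable_exp.comp
        (measurable_const.mul (M.measurable_pot.comp (M.measurable_next γ))))
    exact measurable_uncurry_fst h4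
  calc _ = ∫⁻ ω, (M.accurate δ N (m + 1)).indicator (fun _ => (1 : ℝ≥0∞)) ω *
        (fun (s : M.Ctrl) (z : M.E × (Fin M.K → ℝ)) =>
          ENNReal.ofReal (Real.exp (θ * M.pot (M.next γ s z.1)))) (M.ctrl m ω) (M.Z m ω) ∂M.P := by
        rw [← lintegral_indicator hacc']
        refine lintegral_congr fun ω => ?_
        by_cases hω : ω ∈ M.accurate δ N (m + 1)
        · simp only [Set.indicator_of_mem hω, one_mul, ctrl_succ]; rfl
        · simp only [Set.indicator_of_notMem hω, zero_mul]
    _ = ∫⁻ ω, (M.accurate δ N (m + 1)).indicator (fun _ => (1 : ℝ≥0∞)) ω *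
        ∫⁻ ω', ENNReal.ofReal (Real.exp (θ * M.pot (M.next γ (M.ctrl m ω) (M.X m ω')))) ∂M.P
          ∂M.P := M.lintegral_period m hw (M.measurable_ctrl m) hh
    _ ≤ ∫⁻ ω, (ENNReal.ofReal (Real.exp (-(θ * c.α * c₁ / ((m : ℝ) + 1)))) *
        (M.accurate δ N m).indicator
          (fun ω => ENNReal.ofReal (Real.exp (θ * M.pot (M.ctrl m ω).1))) ω +
        ENNReal.ofReal (Real.exp (2 * θ * s₀))) ∂M.P := by
        refine lintegral_mono fun ω => ?_
        by_cases hω : ω ∈ M.accurate δ N (m + 1)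
        · have hω' : ω ∈ M.accurate δ N m :=
            M.mem_accurate.2 fun i h4 h5 => M.mem_accurate.1 hω i h4 (by omega)
          have herr := M.mem_accurate.1 hω m hNm (Nat.lt_succ_self m)
          simp only [Set.indicator_of_mem hω, Set.indicator_of_mem hω', one_mul]
          refine (M.lintegral_exp_pot_next_le m hγ0 hθ (M.ctrl m ω) (M.abs_cen_le m ω) h1).trans ?_
          have hb : 0 ≤ 16 * c.width m ^ 2 * θ := by positivity
          -- Above level `s₀` the drift is at most `-c₁`, and half of it pays for the second-order
          -- terms, by `h2`. Below `s₀` no contraction is available, but by `h2` and `h3` the bound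
          -- on the exponent stays below `2 * θ * s₀`.
          by_cases hpot : s₀ ≤ M.pot (M.ctrl m ω).1
          · refine le_add_right ?_
            rw [← ENNReal.ofReal_mul (Real.exp_pos _).le, ← Real.exp_add]
            refine ENNReal.ofReal_le_ofReal (Real.exp_le_exp.2 ?_)
            have h4 := hdrift m ω herr hpot
            have h5 := mul_le_mul_of_nonneg_left h4 (by positivity : 0 ≤ θ * (2 * γ))
            have h6 := mul_le_mul_of_nonneg_left h2 (by positivity : 0 ≤ θ * γ)
            have e : θ * c.α * c₁ / ((m : ℝ) + 1) = θ * γ * c₁ := by rw [hγ]; ring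
            rw [e]
            linarith
          · refine le_add_left ?_
            refine ENNReal.ofReal_le_ofReal (Real.exp_le_exp.2 ?_)
            have h4 := M.drift_le (M.ctrl m ω) (δ := δ) herr 0 0 le_rfl (by simp)
            rw [zero_mul, mul_zero, sub_zero] at h4
            have h5 := mul_le_mul_of_nonneg_left h4 (by positivity : 0 ≤ θ * (2 * γ))
            have h6 := mul_le_mul_of_nonneg_left h2 (by positivity : 0 ≤ θ * γ)
            have h7 := mul_le_mul_of_nonneg_left h3 hθ
            have h8 := mul_le_mul_of_nonneg_left (not_le.1 hpot).le hθ
            linarith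
        · simp only [Set.indicator_of_notMem hω, zero_mul]
          exact zero_le
    _ = _ := by
        rw [lintegral_add_right _ measurable_const, lintegral_const_mul' _ _ ENNReal.ofReal_ne_top,
          lintegral_indicator haccm]
        simp

end Model

/-- Iteration of a recursive inequality with contraction factors `exp (-L / (m + 1))`. -/
lemma iterate_exp_contraction {a : ℕ → ℝ≥0∞} {E : ℝ≥0∞} {L : ℝ} (hL : 0 ≤ L) {N n : ℕ}
    (h : ∀ m, N ≤ m → m < n →
      a (m + 1) ≤ ENNReal.ofReal (Real.exp (-(L / ((m : ℝ) + 1)))) * a m + E) :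
    ∀ m, N ≤ m → m ≤ n → a m ≤ ENNReal.ofReal
      (Real.exp (-(L * (Real.log ((m : ℝ) + 1) - Real.log ((N : ℝ) + 1))))) * a N +
        (m - N : ℕ) * E := by
  intro m hm
  induction m, hm using Nat.le_induction with
  | base => intro _; simp
  | succ m hm ih =>
    intro hmn
    have hm0 : (0 : ℝ) < (m : ℝ) + 1 := by positivity
    have hle1 : ENNReal.ofReal (Real.exp (-(L / ((m : ℝ) + 1)))) ≤ 1 := by
      rw [ENNReal.ofReal_le_one, Real.exp_le_one_iff]
      have : 0 ≤ L / ((m : ℝ) + 1) := by positivity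
      linarith
    -- The factors `exp (-L / (m + 1))` multiply to a power of the ratio of the times, since `1 / (m
    -- + 1)` dominates the increment of the logarithm.
    have hlog : Real.log ((m : ℝ) + 1 + 1) - Real.log ((m : ℝ) + 1) ≤ 1 / ((m : ℝ) + 1) := by
      rw [← Real.log_div (by positivity) (by positivity)]
      refine (Real.log_le_sub_one_of_pos (by positivity)).trans_eq ?_
      field_simp; ring
    have hmul := mul_le_mul_of_nonneg_left hlog hL
    calc a (m + 1) ≤ ENNReal.ofReal (Real.exp (-(L / ((m : ℝ) + 1)))) * (ENNReal.ofReal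
          (Real.exp (-(L * (Real.log ((m : ℝ) + 1) - Real.log ((N : ℝ) + 1))))) * a N +
          (m - N : ℕ) * E) + E := by
          refine (h m hm (by omega)).trans ?_
          gcongr
          exact ih (by omega)
      _ ≤ ENNReal.ofReal (Real.exp (-(L / ((m : ℝ) + 1))) *
          Real.exp (-(L * (Real.log ((m : ℝ) + 1) - Real.log ((N : ℝ) + 1))))) * a N +
          1 * ((m - N : ℕ) * E) + E := by
          rw [mul_add, ← mul_assoc, ← ENNReal.ofReal_mul (Real.exp_pos _).le]
          gcongr
      _ = ENNReal.ofReal (Real.exp (-(L / ((m : ℝ) + 1))) *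
          Real.exp (-(L * (Real.log ((m : ℝ) + 1) - Real.log ((N : ℝ) + 1))))) * a N +
          (m + 1 - N : ℕ) * E := by
          rw [show m + 1 - N = (m - N) + 1 by omega]
          push_cast; ring
      _ ≤ _ := by
          rw [← Real.exp_add]
          gcongr
          push_cast
          have e : L / ((m : ℝ) + 1) = L * (1 / ((m : ℝ) + 1)) := by ring
          rw [e]; linarith

namespace Model

variable {c : Constants} (M : Model.{u} c)

/-- A large potential forces a large spread, as `pot ≤ K * spread ^ 2`. The negative part of
`drift_le` is then at least `2 * c₁`, and the estimation error uses up at most `c₁`. -/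
lemma drift_le_of_pot_ge {s₀ c₁ δ Δ₀ : ℝ} (hΔ₀ : 0 ≤ Δ₀) (hs : c.size * Δ₀ ^ 2 ≤ s₀)
    (hc₁ : c₁ ≤ c.κ₂ * c.κ₅ / 8 * (Δ₀ * min Δ₀ c.κ₁)) (hδ : 2 * c.κ₆ * δ ≤ c₁) (m : ℕ) (ω : M.Ω)
    (herr : ∀ k, ‖M.err m ω k‖ ≤ δ) (hpot : s₀ ≤ M.pot (M.ctrl m ω).1) :
    M.drift (M.ctrl m ω) ≤ -c₁ := by
  obtain ⟨j, k, hmax, hle⟩ := M.exists_max_spread (M.sum_cen m ω)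
  have hK := M.K_le_size
  have hK1 := M.one_le_K
  set Δ := M.cen (M.ctrl m ω).1 j - M.cen (M.ctrl m ω).1 k with hΔ
  have hΔ0 : 0 ≤ Δ := by simpa using hmax j j
  have h1 : Δ₀ ≤ Δ := by
    have h2 : c.size * Δ₀ ^ 2 ≤ c.size * Δ ^ 2 := by
      refine hs.trans (hpot.trans (hle.trans ?_))
      gcongr
    have h3 := le_of_mul_le_mul_left h2 (by linarith)
    exact (pow_le_pow_iff_left₀ hΔ₀ hΔ0 two_ne_zero).1 h3
  rw [hΔ, M.cen_sub] at h1
  have h2 := M.drift_le (M.ctrl m ω) herr j k hΔ₀ h1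
  linarith

lemma _root_.SemidiscreteOT.Constants.width_mono (c : Constants) {m n : ℕ} (h : m ≤ n) :
    c.width m ≤ c.width n := by
  have hα := c.hα
  have : Real.log m ≤ Real.log n := by
    rcases Nat.eq_zero_or_pos m with rfl | hm
    · simpa using Real.log_natCast_nonneg n
    · exact Real.log_le_log (by exact_mod_cast hm) (by exact_mod_cast h)
  unfold Constants.width
  gcongr

lemma _root_.SemidiscreteOT.Constants.width_nonneg (c : Constants) (n : ℕ) : 0 ≤ c.width n := by
  have hα := c.hα
  have hR := c.hR
  have := Real.log_natCast_nonneg n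
  unfold Constants.width
  positivity

/-- The exponential recursion iterated up to time `n`. -/
lemma measure_pot_ge_inter_le {δ s₀ c₁ θ : ℝ} (hθ : 0 ≤ θ) (hs₀ : 0 ≤ s₀) (hc₁ : 0 ≤ c₁)
    (hδ : 0 ≤ δ)
    (hdrift : ∀ m ω, (∀ k, ‖M.err m ω k‖ ≤ δ) → s₀ ≤ M.pot (M.ctrl m ω).1 →
      M.drift (M.ctrl m ω) ≤ -c₁)
    {N n : ℕ} (hNn : N ≤ n) {ν₀ : ℝ} (hν₀ : 0 < ν₀) (hN : ν₀ ≤ N)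
    (h1 : 4 * c.width n * c.α * θ ≤ ν₀)
    (h2 : c.α * (2 + 16 * c.width n ^ 2 * θ) ≤ c₁ * ν₀)
    (h3 : c.α * (4 * c.κ₆ * δ + c₁) ≤ s₀ * ν₀)
    (h4 : c.size * c.width N ^ 2 ≤
      c.α * c₁ * (Real.log ((n : ℝ) + 1) - Real.log ((N : ℝ) + 1))) :
    M.P (M.accurate δ N n ∩ {ω | 3 * s₀ ≤ M.pot (M.ctrl n ω).1}) ≤
      ENNReal.ofReal ((n + 1) * Real.exp (-(θ * s₀))) := by
  have hα := c.hα
  have hκ₆ := c.hκ₆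
  have hwn := c.width_nonneg n
  have hrec := iterate_exp_contraction
    (a := fun m => ∫⁻ ω in M.accurate δ N m,
      ENNReal.ofReal (Real.exp (θ * M.pot (M.ctrl m ω).1)) ∂M.P)
    (E := ENNReal.ofReal (Real.exp (2 * θ * s₀))) (L := θ * c.α * c₁) (by positivity)
    (N := N) (n := n) (fun m hNm hmn => by
      have hwm := c.width_mono hmn.le
      have hwm0 := c.width_nonneg m
      have hm : ν₀ ≤ (m : ℝ) + 1 := by
        have : (N : ℝ) ≤ m := by exact_mod_cast hNm
        linarith
      have hm0 : (0 : ℝ) < (m : ℝ) + 1 := by positivity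
      refine M.lintegral_exp_pot_succ_le hθ hdrift hNm ?_ ?_ ?_
      · calc 4 * c.width m * (c.α / ((m : ℝ) + 1)) * θ ≤ 4 * c.width n * (c.α / ν₀) * θ := by
              gcongr
          _ = 4 * c.width n * c.α * θ / ν₀ := by ring
          _ ≤ 1 := by rwa [div_le_one hν₀]
      · calc c.α / ((m : ℝ) + 1) * (2 + 16 * c.width m ^ 2 * θ) ≤
              c.α / ν₀ * (2 + 16 * c.width n ^ 2 * θ) := by gcongr
          _ = c.α * (2 + 16 * c.width n ^ 2 * θ) / ν₀ := by ring
          _ ≤ c₁ := by rwa [div_le_iff₀ hν₀]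
      · calc c.α / ((m : ℝ) + 1) * (4 * c.κ₆ * δ + c₁) ≤ c.α / ν₀ * (4 * c.κ₆ * δ + c₁) := by
              gcongr
          _ = c.α * (4 * c.κ₆ * δ + c₁) / ν₀ := by ring
          _ ≤ s₀ := by rwa [div_le_iff₀ hν₀])
    n hNn le_rfl
  have hN0 : ∫⁻ ω in M.accurate δ N N, ENNReal.ofReal (Real.exp (θ * M.pot (M.ctrl N ω).1)) ∂M.P ≤
      ENNReal.ofReal (Real.exp (θ * (c.size * c.width N ^ 2))) := by
    refine (setLIntegral_le_lintegral _ _).trans ?_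
    calc _ ≤ ∫⁻ _ω, ENNReal.ofReal (Real.exp (θ * (c.size * c.width N ^ 2))) ∂M.P := by
          refine lintegral_mono fun ω => ENNReal.ofReal_le_ofReal (Real.exp_le_exp.2 ?_)
          exact mul_le_mul_of_nonneg_left (M.pot_ctrl_le N ω) hθ
      _ = _ := by simp
  have hbound : ∫⁻ ω in M.accurate δ N n,
      ENNReal.ofReal (Real.exp (θ * M.pot (M.ctrl n ω).1)) ∂M.P ≤
      ENNReal.ofReal ((n + 1) * Real.exp (2 * θ * s₀)) := by
    refine hrec.trans ?_
    calc _ ≤ 1 + (n : ℝ≥0∞) * ENNReal.ofReal (Real.exp (2 * θ * s₀)) := by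
          gcongr
          -- By `h4` the contraction between `N` and `n` outweighs the deterministic bound on the
          -- potential at time `N`.
          · refine (mul_le_mul_right hN0 _).trans ?_
            rw [← ENNReal.ofReal_mul (Real.exp_pos _).le, ← Real.exp_add, ENNReal.ofReal_le_one,
              Real.exp_le_one_iff]
            have := mul_le_mul_of_nonneg_left h4 hθ
            linarith
          · omega
      _ = ENNReal.ofReal (1 + n * Real.exp (2 * θ * s₀)) := by
          rw [ENNReal.ofReal_add zero_le_one (by positivity), ENNReal.ofReal_one,
            ENNReal.ofReal_mul (by positivity), ENNReal.ofReal_natCast]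
      _ ≤ _ := by
          refine ENNReal.ofReal_le_ofReal ?_
          have : 1 ≤ Real.exp (2 * θ * s₀) := Real.one_le_exp (by positivity)
          linarith
  have hacc : MeasurableSet (M.accurate δ N n) :=
    M.F_le n _ (M.measurableSet_accurate δ N n n (by omega))
  have hpm : Measurable fun ω => M.pot (M.ctrl n ω).1 :=
    M.measurable_pot.comp (M.measurable_of_F (M.measurable_ctrl n)).fst
  have hset : MeasurableSet {ω | 3 * s₀ ≤ M.pot (M.ctrl n ω).1} :=
    measurableSet_le measurable_const hpm
  -- Markov's inequality at level `3 * s₀` against the moment bound of order `exp (2 * θ * s₀)`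
  -- leaves `exp (-(θ * s₀))`.
  have hmark : ENNReal.ofReal (Real.exp (θ * (3 * s₀))) *
      M.P (M.accurate δ N n ∩ {ω | 3 * s₀ ≤ M.pot (M.ctrl n ω).1}) ≤
      ENNReal.ofReal ((n + 1) * Real.exp (2 * θ * s₀)) := by
    refine le_trans ?_ hbound
    rw [← setLIntegral_const]
    refine (setLIntegral_mono (by fun_prop) fun ω hω => ?_).trans
      (lintegral_mono_set Set.inter_subset_left)
    exact ENNReal.ofReal_le_ofReal (Real.exp_le_exp.2 (mul_le_mul_of_nonneg_left hω.2 hθ))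
  have hfin : M.P (M.accurate δ N n ∩ {ω | 3 * s₀ ≤ M.pot (M.ctrl n ω).1}) =
      ENNReal.ofReal (Real.exp (-(θ * (3 * s₀)))) * (ENNReal.ofReal (Real.exp (θ * (3 * s₀))) *
      M.P (M.accurate δ N n ∩ {ω | 3 * s₀ ≤ M.pot (M.ctrl n ω).1})) := by
    rw [← mul_assoc, ← ENNReal.ofReal_mul (Real.exp_pos _).le, ← Real.exp_add]
    simp
  rw [hfin]
  refine (mul_le_mul_right hmark _).trans_eq ?_
  rw [← ENNReal.ofReal_mul (Real.exp_pos _).le]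
  congr 1
  rw [mul_left_comm, ← Real.exp_add]
  congr 2; ring

set_option maxHeartbeats 1000000 in
/-- The dual vector is close to the optimal one, with a probability of failure that decreases
faster than any power of `n`. -/
lemma measure_pot_ge_le (c : Constants) {s : ℝ} (hs : 0 < s) (q : ℕ) : ∃ n₀ : ℕ,
    ∀ M : Model.{u} c, ∀ n ≥ n₀, M.P {ω | s ≤ M.pot (M.ctrl n ω).1} ≤
      ENNReal.ofReal (Real.exp (-(q * Real.log n))) := by
  have hκ₁ := c.hκ₁
  have hκ₂ := c.hκ₂
  have hκ₅ := c.hκ₅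
  have hκ₆ := c.hκ₆
  have hα := c.hα
  have hR := c.hR
  have hsz := c.one_le_size
  set s₀ := s / 3 with hs₀
  have hs₀0 : 0 < s₀ := by positivity
  set Δ₀ := Real.sqrt (s₀ / c.size) with hΔ₀
  have hΔ₀0 : 0 < Δ₀ := Real.sqrt_pos.2 (by positivity)
  have hΔsq : c.size * Δ₀ ^ 2 ≤ s₀ := by
    rw [hΔ₀, Real.sq_sqrt (by positivity)]
    exact (by field_simp : c.size * (s₀ / c.size) = s₀).le
  set c₁ := c.κ₂ * c.κ₅ / 8 * (Δ₀ * min Δ₀ c.κ₁) with hc₁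
  have hmin : 0 < min Δ₀ c.κ₁ := lt_min hΔ₀0 hκ₁
  have hc₁0 : 0 < c₁ := by positivity
  set δ := c₁ / (2 * c.κ₆) with hδ
  have hδ0 : 0 < δ := by positivity
  have hδc : 2 * c.κ₆ * δ ≤ c₁ := (by rw [hδ]; field_simp : 2 * c.κ₆ * δ = c₁).le
  obtain ⟨n₁, hn₁⟩ := measure_err_gt_le.{u} c hδ0
  set w := 2 * c.R + 2 * c.α with hw
  have hw0 : 0 < w := by positivity
  -- With `x = (log n) ^ (1 / 3)` the recursion starts at `N ≈ exp x`. The initial potential is of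
  -- order `x ^ 2`, the available contraction of order `x ^ 3 = log n`. The estimates fail after `N`
  -- with probability at most `n * exp (-(x ^ 7))`, and `θ = x ^ 6` gives `exp (-(x ^ 6 * s₀))`;
  -- both are smaller than any power of `n`.
  have hx : Filter.Tendsto (fun n : ℕ => Real.log n ^ ((1 : ℝ) / 3)) Filter.atTop Filter.atTop :=
    (tendsto_rpow_atTop (by norm_num)).comp tendsto_log_natCast
  -- From `N` on the steps are at most `α / exp x`. As the width is of order `x ^ 3` and `θ = x ^
  -- 6`, the quantity `width ^ 2 * θ` is of order `x ^ 12`, which explains the exponent.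
  have evx : ∀ᶠ x : ℝ in Filter.atTop,
      2 ≤ x ∧ 2 * c.size * (2 * c.R + 4 * c.α) ^ 2 / (c.α * c₁) ≤ x ∧ (q + 4 : ℝ) ≤ x ∧
      (q + 4 : ℝ) / s₀ ≤ x ∧ (n₁ : ℝ) ≤ x ∧
      4 * w * c.α ≤ Real.exp x / x ^ 12 ∧ c.α * (2 + 16 * w ^ 2) / c₁ ≤ Real.exp x / x ^ 12 ∧
      c.α * (4 * c.κ₆ * δ + c₁) / s₀ ≤ Real.exp x / x ^ 12 := by
    have he := Real.tendsto_exp_div_pow_atTop 12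
    filter_upwards [Filter.eventually_ge_atTop (2 : ℝ),
      Filter.eventually_ge_atTop (2 * c.size * (2 * c.R + 4 * c.α) ^ 2 / (c.α * c₁)),
      Filter.eventually_ge_atTop (q + 4 : ℝ), Filter.eventually_ge_atTop ((q + 4 : ℝ) / s₀),
      Filter.eventually_ge_atTop (n₁ : ℝ), he.eventually_ge_atTop (4 * w * c.α),
      he.eventually_ge_atTop (c.α * (2 + 16 * w ^ 2) / c₁),
      he.eventually_ge_atTop (c.α * (4 * c.κ₆ * δ + c₁) / s₀)] with x h1 h2 h3 h4 h5 h6 h7 h8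
    exact ⟨h1, h2, h3, h4, h5, h6, h7, h8⟩
  obtain ⟨n₀, hn₀⟩ := Filter.eventually_atTop.1 (hx.eventually evx)
  refine ⟨max n₀ 1, fun M n hn => ?_⟩
  obtain ⟨hx2, hx4, hxq, hxqs, hxn₁, e1, e2, e3⟩ := hn₀ n ((le_max_left _ _).trans hn)
  have hn1 : 1 ≤ n := (le_max_right _ _).trans hn
  have hn0 : (0 : ℝ) < n := by exact_mod_cast hn1
  have hx3 : (Real.log n ^ ((1 : ℝ) / 3)) ^ 3 = Real.log n := by
    rw [← Real.rpow_natCast, ← Real.rpow_mul (Real.log_natCast_nonneg n)]; norm_num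
  set x := Real.log n ^ ((1 : ℝ) / 3) with hxdef
  have hx0 : 0 < x := by linarith
  have hx1 : 1 ≤ x := by linarith
  have hle : ∀ i j : ℕ, i ≤ j → x ^ i ≤ x ^ j := fun i j hij => pow_le_pow_right₀ hx1 hij
  have hnexp : (n : ℝ) = Real.exp (x ^ 3) := by rw [hx3, Real.exp_log hn0]
  set N := ⌈Real.exp x⌉₊ with hN
  have hNx : Real.exp x ≤ N := Nat.le_ceil _
  have hN0 : (0 : ℝ) < N := (Real.exp_pos x).trans_le hNx
  have hexp1 : 1 ≤ Real.exp x := Real.one_le_exp hx0.le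
  have hexp2 : (4 : ℝ) ≤ Real.exp 2 := by
    have h := Real.add_one_le_exp (1 : ℝ)
    have h2 : Real.exp 2 = Real.exp 1 * Real.exp 1 := by rw [← Real.exp_add]; norm_num
    rw [h2]
    have := mul_self_le_mul_self (by norm_num) h
    linarith
  have hN2 : (N : ℝ) + 1 ≤ Real.exp (x + 2) := by
    have h1 : (N : ℝ) < Real.exp x + 1 := Nat.ceil_lt_add_one (Real.exp_pos x).le
    rw [Real.exp_add]
    have := mul_le_mul_of_nonneg_left hexp2 (Real.exp_pos x).le
    linarith
  have hlogN1 : Real.log ((N : ℝ) + 1) ≤ x + 2 := by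
    rw [Real.log_le_iff_le_exp (by positivity)]; exact hN2
  have hlogN : Real.log N ≤ x + 2 :=
    (Real.log_le_log hN0 (by linarith)).trans hlogN1
  have hx3' : x + 2 ≤ x ^ 3 / 2 := by
    clear * - hx2
    nlinarith [sq_nonneg (x - 2)]
  have hNn : N ≤ n := by
    have h1 : (N : ℝ) + 1 ≤ n := by
      rw [hnexp]
      exact hN2.trans (Real.exp_le_exp.2 (by linarith [pow_pos hx0 3]))
    exact_mod_cast (by linarith : (N : ℝ) ≤ n)
  have hwidth : c.width n ≤ w * x ^ 3 := by
    have := hle 0 3 (by norm_num)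
    rw [pow_zero] at this
    have := mul_le_mul_of_nonneg_left this (by positivity : 0 ≤ 2 * c.R + c.α)
    rw [Constants.width, ← hx3, hw]; linarith
  have hwidth0 := c.width_nonneg n
  have hx12 : 0 < x ^ 12 := by positivity
  rw [le_div_iff₀ hx12] at e1 e2 e3
  have hmain := M.measure_pot_ge_inter_le (δ := δ) (s₀ := s₀) (c₁ := c₁) (θ := x ^ 6)
    (by positivity) hs₀0.le hc₁0.le hδ0.le
    (M.drift_le_of_pot_ge hΔ₀0.le hΔsq le_rfl hδc) hNn (Real.exp_pos x) hNx
    (by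
      calc 4 * c.width n * c.α * x ^ 6 ≤ 4 * (w * x ^ 3) * c.α * x ^ 6 := by gcongr
        _ = 4 * w * c.α * x ^ 9 := by ring
        _ ≤ 4 * w * c.α * x ^ 12 := by gcongr; norm_num
        _ ≤ _ := e1)
    (by
      have h0 := hle 0 12 (by norm_num)
      rw [pow_zero] at h0
      calc c.α * (2 + 16 * c.width n ^ 2 * x ^ 6) ≤ c.α * (2 + 16 * (w * x ^ 3) ^ 2 * x ^ 6) := by
            gcongr
        _ ≤ c.α * (2 * x ^ 12 + 16 * (w * x ^ 3) ^ 2 * x ^ 6) := by gcongr; linarith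
        _ = c₁ * (c.α * (2 + 16 * w ^ 2) / c₁ * x ^ 12) := by field_simp
        _ ≤ _ := by gcongr)
    (by
      have h0 := hle 0 12 (by norm_num)
      rw [pow_zero] at h0
      calc c.α * (4 * c.κ₆ * δ + c₁) = s₀ * (c.α * (4 * c.κ₆ * δ + c₁) / s₀ * 1) := by field_simp
        _ ≤ s₀ * (c.α * (4 * c.κ₆ * δ + c₁) / s₀ * x ^ 12) := by gcongr
        _ ≤ _ := by gcongr)
    (by
      have h1 : c.width N ≤ (2 * c.R + 4 * c.α) * x := by
        have := mul_le_mul_of_nonneg_left hlogN hα.le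
        have := mul_le_mul_of_nonneg_left hx1 (by positivity : 0 ≤ 2 * c.R + 3 * c.α)
        rw [Constants.width]; linarith
      have h2 : x ^ 3 / 2 ≤ Real.log ((n : ℝ) + 1) - Real.log ((N : ℝ) + 1) := by
        have : Real.log n ≤ Real.log ((n : ℝ) + 1) := Real.log_le_log hn0 (by linarith)
        rw [← hx3] at this
        linarith
      have hwN := c.width_nonneg N
      rw [div_le_iff₀ (by positivity)] at hx4
      calc c.size * c.width N ^ 2 ≤ c.size * ((2 * c.R + 4 * c.α) * x) ^ 2 := by gcongr
        _ = (2 * c.size * (2 * c.R + 4 * c.α) ^ 2) * (x ^ 2 / 2) := by ring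
        _ ≤ (x * (c.α * c₁)) * (x ^ 2 / 2) := by gcongr
        _ = c.α * c₁ * (x ^ 3 / 2) := by ring
        _ ≤ _ := by gcongr)
  have hbad : M.P (M.accurate δ N n)ᶜ ≤ ENNReal.ofReal (n * Real.exp (-(x ^ 7))) := by
    have hsub : (M.accurate δ N n)ᶜ ⊆ ⋃ i ∈ Finset.Ico N n, {ω | ∃ k, δ < ‖M.err i ω k‖} := by
      intro ω hω
      by_contra hcon
      refine hω (M.mem_accurate.2 fun i h1 h2 k => ?_)
      by_contra hk
      exact hcon (Set.mem_biUnion (Finset.mem_Ico.2 ⟨h1, h2⟩) ⟨k, not_le.1 hk⟩)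
    refine (measure_mono hsub).trans ((measure_biUnion_finset_le _ _).trans ?_)
    calc _ ≤ ∑ _i ∈ Finset.Ico N n, ENNReal.ofReal (Real.exp (-(x ^ 7))) := by
          refine Finset.sum_le_sum fun i hi => ?_
          have hNi := (Finset.mem_Ico.1 hi).1
          have hNi' : (N : ℝ) ≤ i := by exact_mod_cast hNi
          have hi1 : n₁ ≤ i := by
            have h1 : (n₁ : ℝ) ≤ i := by
              have := Real.add_one_le_exp x
              linarith
            exact_mod_cast h1
          refine (hn₁ M i hi1).trans (ENNReal.ofReal_le_ofReal (Real.exp_le_exp.2 ?_))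
          have h2 : x ≤ Real.log i := by
            rw [Real.le_log_iff_exp_le (by linarith)]; linarith
          have := pow_le_pow_left₀ hx0.le h2 7
          linarith
      _ = ((n - N : ℕ) : ℝ≥0∞) * ENNReal.ofReal (Real.exp (-(x ^ 7))) := by simp
      _ ≤ (n : ℝ≥0∞) * ENNReal.ofReal (Real.exp (-(x ^ 7))) := by
          gcongr; omega
      _ = _ := by rw [ENNReal.ofReal_mul (by positivity), ENNReal.ofReal_natCast]
  have hs3 : 3 * s₀ = s := by rw [hs₀]; ring
  rw [hs3] at hmain
  have hsplit : {ω | s ≤ M.pot (M.ctrl n ω).1} ⊆ (M.accurate δ N n)ᶜ ∪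
      (M.accurate δ N n ∩ {ω | s ≤ M.pot (M.ctrl n ω).1}) := by
    intro ω hω
    by_cases h : ω ∈ M.accurate δ N n
    · exact Or.inr ⟨h, hω⟩
    · exact Or.inl h
  refine (measure_mono hsplit).trans ((measure_union_le _ _).trans
    ((add_le_add hbad hmain).trans ?_))
  rw [← ENNReal.ofReal_add (by positivity) (by positivity)]
  refine ENNReal.ofReal_le_ofReal ?_
  have h03 := hle 0 3 (by norm_num)
  rw [pow_zero] at h03
  have hx3pos : 0 < x ^ 3 := by positivity
  have f1 : n * Real.exp (-(x ^ 7)) ≤ Real.exp (-(q * Real.log n)) * Real.exp (-2) := by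
    rw [← hx3, hnexp, ← Real.exp_add, ← Real.exp_add]
    refine Real.exp_le_exp.2 ?_
    have h1 := mul_le_mul_of_nonneg_right hxq hx3pos.le
    have h2 : x * x ^ 3 = x ^ 4 := by ring
    have h3 := hle 4 7 (by norm_num)
    linarith
  have f2 : ((n : ℝ) + 1) * Real.exp (-(x ^ 6 * s₀)) ≤
      Real.exp (-(q * Real.log n)) * (2 * Real.exp (-2)) := by
    have h1 : ((n : ℝ) + 1) ≤ 2 * Real.exp (x ^ 3) := by
      have : (1 : ℝ) ≤ n := by exact_mod_cast hn1
      rw [← hnexp]; linarith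
    have h2 : Real.exp (x ^ 3) * Real.exp (-(x ^ 6 * s₀)) ≤
        Real.exp (-(q * Real.log n)) * Real.exp (-2) := by
      rw [← hx3, ← Real.exp_add, ← Real.exp_add]
      refine Real.exp_le_exp.2 ?_
      rw [div_le_iff₀ hs₀0] at hxqs
      have h1 := mul_le_mul_of_nonneg_right hxqs hx3pos.le
      have h2 : x * s₀ * x ^ 3 = x ^ 4 * s₀ := by ring
      have h3 := mul_le_mul_of_nonneg_right (hle 4 6 (by norm_num)) hs₀0.le
      linarith
    calc _ ≤ 2 * Real.exp (x ^ 3) * Real.exp (-(x ^ 6 * s₀)) := by gcongr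
      _ = 2 * (Real.exp (x ^ 3) * Real.exp (-(x ^ 6 * s₀))) := by ring
      _ ≤ 2 * (Real.exp (-(q * Real.log n)) * Real.exp (-2)) := by gcongr
      _ = _ := by ring
  have h4 : Real.exp (-2) * 4 ≤ 1 := by
    rw [Real.exp_neg, inv_mul_eq_div, div_le_one (Real.exp_pos _)]; exact hexp2
  have h5 : 0 < Real.exp (-(q * Real.log n)) := Real.exp_pos _
  have h6 := mul_le_mul_of_nonneg_left h4 h5.le
  linarith [mul_pos h5 (Real.exp_pos (-2))]

end Model

/-! ### Linear growth of information and the rate of the estimates. -/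

/-- A real-valued bound that holds for all large `n` extends to all `n ≥ 1` when probabilities are
bounded. -/
lemma exists_const_of_eventually {ι : Type*} {f : ι → ℕ → ℝ≥0∞} (hf : ∀ i n, f i n ≤ 1) {q n₀ : ℕ}
    {C : ℝ} (hC : 0 ≤ C) (h : ∀ i, ∀ n ≥ n₀, 1 ≤ n → f i n ≤ ENNReal.ofReal (C / (n : ℝ) ^ q)) :
    ∃ C' : ℝ, 0 < C' ∧ ∀ i n, 1 ≤ n → f i n ≤ ENNReal.ofReal (C' / (n : ℝ) ^ q) := by
  refine ⟨C + (n₀ : ℝ) ^ q + 1, by positivity, fun i n hn => ?_⟩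
  have hn0 : (0 : ℝ) < n := by exact_mod_cast hn
  rcases le_total n₀ n with h1 | h1
  · refine (h i n h1 hn).trans (ENNReal.ofReal_le_ofReal ?_)
    gcongr
    have : (0 : ℝ) ≤ (n₀ : ℝ) ^ q := by positivity
    linarith
  · refine (hf i n).trans ?_
    rw [ENNReal.one_le_ofReal, one_le_div (by positivity)]
    have : (n : ℝ) ^ q ≤ (n₀ : ℝ) ^ q := by gcongr
    linarith

lemma exp_neg_mul_log {n : ℕ} (hn : 1 ≤ n) (q : ℕ) :
    Real.exp (-(q * Real.log n)) = 1 / (n : ℝ) ^ q := by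
  have hn0 : (0 : ℝ) < n := by exact_mod_cast hn
  rw [Real.exp_neg, Real.exp_nat_mul, Real.exp_log hn0, one_div]

lemma rho_sq_le {n : ℕ} (hn : 1 ≤ n) : rho n ^ 2 ≤ 217 ^ 2 * n := by
  have hn0 : (0 : ℝ) < n := by exact_mod_cast hn
  set y := Real.log n / 6 with hy
  have hy0 : 0 ≤ y := by have := Real.log_natCast_nonneg n; positivity
  have hly : Real.log n = 6 * y := by rw [hy]; ring
  have h1 : (n : ℝ) = Real.exp y ^ 6 := by
    rw [← Real.exp_nat_mul, ← Real.exp_log hn0, hly]; norm_num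
  have h2 : (y + 1) ^ 6 ≤ n := by
    rw [h1]; gcongr; exact Real.add_one_le_exp y
  -- With `log n = 6 * y` the regularization is `1 + 6 ^ 3 * y ^ 3`, and `217 = 1 + 6 ^ 3`.
  have h3 : rho n ≤ 217 * (y + 1) ^ 3 := by
    have h4 : y ^ 3 ≤ (y + 1) ^ 3 := by gcongr; linarith
    have h5 : 1 ≤ (y + 1) ^ 3 := one_le_pow₀ (by linarith)
    unfold rho; rw [hly]; nlinarith
  calc rho n ^ 2 ≤ (217 * (y + 1) ^ 3) ^ 2 := by
        have : 0 ≤ rho n := zero_le_one.trans (Model.one_le_rho n)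
        gcongr
    _ = 217 ^ 2 * (y + 1) ^ 6 := by ring
    _ ≤ _ := by gcongr

namespace Model

variable {c : Constants} (M : Model.{u} c)

/-- The event that after `n` periods the estimates and the dual vector are close to their limits. -/
def near (δ r : ℝ) (n : ℕ) : Set M.Ω :=
  {ω | (∀ k, ‖M.err n ω k‖ ≤ δ) ∧ M.pot (M.ctrl n ω).1 < (r / 2) ^ 2}

lemma measure_near_compl_le (c : Constants) {δ r : ℝ} (hδ : 0 < δ) (hr : 0 < r) (q : ℕ) :
    ∃ C : ℝ, 0 < C ∧ ∀ M : Model.{u} c, ∀ n, 1 ≤ n →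
      M.P (M.near δ r n)ᶜ ≤ ENNReal.ofReal (C / (n : ℝ) ^ q) := by
  obtain ⟨n₁, h₁⟩ := measure_err_gt_le.{u} c hδ
  obtain ⟨n₂, h₂⟩ := measure_pot_ge_le.{u} c (s := (r / 2) ^ 2) (by positivity) q
  obtain ⟨n₃, h₃⟩ := Filter.eventually_atTop.1
    (tendsto_log_natCast.eventually_ge_atTop (max 1 (q : ℝ)))
  refine exists_const_of_eventually (f := fun (M : Model.{u} c) n => M.P (M.near δ r n)ᶜ)
    (fun M n => prob_le_one) (n₀ := max n₁ (max n₂ n₃)) (C := 2) zero_le_two fun M n hn hn1 => ?_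
  simp only [ge_iff_le, max_le_iff] at hn
  obtain ⟨hn₁, hn₂, hn₃⟩ := hn
  have hl := h₃ n hn₃
  rw [max_le_iff] at hl
  have hsub : (M.near δ r n)ᶜ ⊆ {ω | ∃ k, δ < ‖M.err n ω k‖} ∪
      {ω | (r / 2) ^ 2 ≤ M.pot (M.ctrl n ω).1} := by
    intro ω hω
    by_contra hcon
    simp only [Set.mem_union, Set.mem_ofPred_eq, not_or, not_exists, not_lt, not_le] at hcon
    exact hω hcon
  refine (measure_mono hsub).trans ((measure_union_le _ _).trans
    ((add_le_add (h₁ M n hn₁) (h₂ M n hn₂)).trans ?_))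
  rw [← ENNReal.ofReal_add (Real.exp_pos _).le (Real.exp_pos _).le]
  refine ENNReal.ofReal_le_ofReal ?_
  have h4 : Real.exp (-(Real.log n ^ 7)) ≤ Real.exp (-(q * Real.log n)) := by
    refine Real.exp_le_exp.2 (neg_le_neg ?_)
    calc (q : ℝ) * Real.log n ≤ Real.log n * Real.log n := by
          gcongr
          · linarith
      _ = Real.log n ^ 2 := by ring
      _ ≤ _ := pow_le_pow_right₀ hl.1 (by norm_num)
  rw [exp_neg_mul_log hn1] at h4 ⊢
  have : (2 : ℝ) / (n : ℝ) ^ q = 1 / (n : ℝ) ^ q + 1 / (n : ℝ) ^ q := by ring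
  linarith

lemma spread_le_of_pot_lt {g : Fin M.K → ℝ} {r : ℝ} (hr : 0 ≤ r) (h : M.pot g < (r / 2) ^ 2)
    (j k : Fin M.K) : M.cen g j - M.cen g k ≤ r := by
  have h1 : ∀ i, |M.cen g i| ≤ r / 2 := fun i => by
    refine abs_le_of_sq_le_sq (le_trans ?_ h.le) (by positivity)
    exact Finset.single_le_sum (f := fun k => M.cen g k ^ 2) (fun _ _ => sq_nonneg _)
      (Finset.mem_univ i)
  linarith [(abs_le.1 (h1 j)).2, (abs_le.1 (h1 k)).1]

/-- Outside of the exploration periods the expected information is bounded below, once the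
parameters of the decision rule are close to their limits. -/
lemma le_infoForm_of_near {δ r t : ℝ} (hδ : 0 ≤ δ) (hr : 0 ≤ r) (ht : 2 * c.κ₆ * δ + r = t)
    (ht₁ : t ≤ c.κ₁) (ht₂ : c.κ₆ ^ 2 * (c.size ^ 2 * (c.κ₃ * t)) ≤ c.κ₈ / 2) {m : ℕ}
    (hm : ¬ (exploreSet M.K M.I.a m).Nonempty) {ω : M.Ω} (hω : ω ∈ M.near δ r m) (k : Fin M.K)
    (v : M.E) : c.κ₈ / 2 * ‖v‖ ^ 2 ≤ M.infoForm m (M.ctrl m ω) k v := by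
  have hpick : ∀ x, M.pick m (M.ctrl m ω) x = M.dec (M.ctrl m ω) x := fun x => by
    rw [pick, sampled, dif_neg hm]; rfl
  simp only [infoForm, hpick]
  refine le_trans ?_ (M.le_infoForm_dec (M.ctrl m ω) k v)
  have h1 := M.measure_dec_ne_opt_le (b := (M.ctrl m ω).2) (g := (M.ctrl m ω).1) hδ hr hω.1
    (fun j k => by rw [← M.cen_sub]; exact M.spread_le_of_pot_lt hr hω.2 j k) (ht.trans_le ht₁)
  rw [ht] at h1
  have hκ₃ := c.hκ₃
  have hκ₆ := c.hκ₆
  have ht0 : 0 ≤ t := by rw [← ht]; positivity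
  have h2 : (M.K : ℝ) ^ 2 * (c.κ₃ * t) ≤ c.size ^ 2 * (c.κ₃ * t) := by
    have := M.K_le_size
    gcongr
  have h3 := mul_le_mul_of_nonneg_left (h1.trans h2) (sq_nonneg c.κ₆)
  refine mul_le_mul_of_nonneg_right ?_ (sq_nonneg _)
  change c.κ₈ / 2 ≤ c.κ₈ - c.κ₆ ^ 2 * M.ν.real {x | M.dec (M.ctrl m ω) x ≠ M.opt x}
  linarith

/-- Explorations are polylogarithmically few, so most periods in the second half are myopic. Keeping
only late periods makes failure probabilities at times `m ∈ A` comparable to those at time `n`. -/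
lemma exists_myopic_periods (c : Constants) : ∃ n₀ : ℕ, ∀ M : Model.{u} c, ∀ n ≥ n₀, 1 ≤ n →
    ∃ A ⊆ Finset.range n, (n : ℝ) / 4 ≤ A.card ∧
      ∀ m ∈ A, (n : ℝ) ≤ 4 * m ∧ ¬ (exploreSet M.K M.I.a m).Nonempty := by
  classical
  have ha := c.ha
  have h1 : (fun x : ℝ => Real.log x ^ 9) =o[Filter.atTop] (id : ℝ → ℝ) :=
    Real.isLittleO_pow_log_id_atTop
  have h2 := (h1.comp_tendsto tendsto_natCast_atTop_atTop).bound (c := c.a ^ 9 / 4) (by positivity)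
  obtain ⟨n₀, hn₀⟩ := Filter.eventually_atTop.1 h2
  -- The extra `2` ensures `n ≤ 4 * (n / 2)` despite the integer division.
  refine ⟨n₀ + 2, fun M n hn hn1 => ?_⟩
  have h3 := hn₀ n (by omega)
  simp only [Function.comp_apply, id, Real.norm_eq_abs, Nat.abs_cast] at h3
  have h4 : (Real.log n / c.a) ^ 9 ≤ n / 4 := by
    rw [div_pow, div_le_iff₀ (by positivity)]
    have := (le_abs_self _).trans h3
    linarith
  set E := (Finset.range n).filter fun m => (exploreSet M.K M.I.a m).Nonempty with hE
  have h5 : (E.card : ℝ) ≤ n / 4 := (card_explore_le c M hn1).trans h4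
  refine ⟨Finset.Ico (n / 2) n \ E, fun m hm => ?_, ?_, fun m hm => ?_⟩
  · have := (Finset.mem_Ico.1 (Finset.mem_sdiff.1 hm).1).2
    exact Finset.mem_range.2 this
  · have h6 := Finset.le_card_sdiff E (Finset.Ico (n / 2) n)
    rw [Nat.card_Ico] at h6
    have h7 : ((n - n / 2 : ℕ) : ℝ) ≤ (Finset.Ico (n / 2) n \ E).card + E.card := by
      exact_mod_cast (by omega : n - n / 2 ≤ (Finset.Ico (n / 2) n \ E).card + E.card)
    have h8 : (n : ℝ) ≤ 2 * ((n - n / 2 : ℕ) : ℝ) := by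
      exact_mod_cast (by omega : n ≤ 2 * (n - n / 2))
    linarith
  · obtain ⟨h6, h7⟩ := Finset.mem_sdiff.1 hm
    rw [Finset.mem_Ico] at h6
    refine ⟨by exact_mod_cast (by omega : n ≤ 4 * m), fun h => h7 ?_⟩
    exact Finset.mem_filter.2 ⟨Finset.mem_range.2 h6.2, h⟩

lemma _root_.Real.exp_neg_le_div_pow {x : ℝ} (hx : 0 < x) (q : ℕ) :
    Real.exp (-x) ≤ q.factorial / x ^ q := by
  rw [Real.exp_neg, inv_eq_one_div, div_le_div_iff₀ (Real.exp_pos _) (by positivity), one_mul]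
  have := Real.pow_div_factorial_le_exp x hx.le q
  rw [div_le_iff₀ (by positivity)] at this
  linarith

/-- The Gram matrices grow linearly, outside of an event of small probability. -/
lemma measure_gramForm_lt_linear_le (c : Constants) : ∃ C : ℝ, 0 < C ∧ ∀ M : Model.{u} c,
    ∀ n, 1 ≤ n → M.P {ω | ∃ k, ∃ v, M.gramForm n ω k v v < c.κ₈ / 16 * n * ‖v‖ ^ 2} ≤
      ENNReal.ofReal (C / (n : ℝ) ^ 4) := by
  have hκ₁ := c.hκ₁
  have hκ₃ := c.hκ₃
  have hκ₆ := c.hκ₆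
  have hκ₈ := c.hκ₈
  have hsz := c.one_le_size
  obtain ⟨t, ht0, ht₁, ht₂⟩ : ∃ t, 0 < t ∧ t ≤ c.κ₁ ∧
      c.κ₆ ^ 2 * (c.size ^ 2 * (c.κ₃ * t)) ≤ c.κ₈ / 2 := by
    have hp : 0 < c.κ₈ / (2 * (c.κ₆ ^ 2 * (c.size ^ 2 * c.κ₃))) := by positivity
    refine ⟨min c.κ₁ (c.κ₈ / (2 * (c.κ₆ ^ 2 * (c.size ^ 2 * c.κ₃)))), lt_min hκ₁ hp,
      min_le_left _ _, ?_⟩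
    calc _ ≤ c.κ₆ ^ 2 * (c.size ^ 2 * (c.κ₃ *
          (c.κ₈ / (2 * (c.κ₆ ^ 2 * (c.size ^ 2 * c.κ₃)))))) := by gcongr; exact min_le_right _ _
      _ = _ := by field_simp
  have hδ : 0 < t / (4 * c.κ₆) := by positivity
  have ht : 2 * c.κ₆ * (t / (4 * c.κ₆)) + t / 2 = t := by field_simp; ring
  -- The exponent `5` loses one power in the union over at most `n` periods. The resulting `n ^
  -- (-4)` will offset a weight `n ^ 3` on the bad event.
  obtain ⟨C₁, hC₁, hnear⟩ := measure_near_compl_le.{u} c hδ (half_pos ht0) 5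
  obtain ⟨n₀, hmyo⟩ := exists_myopic_periods.{u} c
  obtain ⟨η, hη0, hη1, hη6⟩ : ∃ η, 0 < η ∧ η * c.size ≤ c.κ₈ / 4 ∧ η ≤ 4 * c.κ₆ ^ 2 := by
    refine ⟨min (c.κ₈ / (4 * c.size)) (4 * c.κ₆ ^ 2), lt_min (by positivity) (by positivity), ?_,
      min_le_right _ _⟩
    calc _ ≤ c.κ₈ / (4 * c.size) * c.size := by gcongr; exact min_le_left _ _
      _ = _ := by field_simp
  set γ := η ^ 2 / (16 * c.κ₆ ^ 4) / 4 with hγ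
  have hγ0 : 0 < γ := by positivity
  refine exists_const_of_eventually (f := fun (M : Model.{u} c) n => M.P {ω | ∃ k, ∃ v,
    M.gramForm n ω k v v < c.κ₈ / 16 * n * ‖v‖ ^ 2}) (fun M n => prob_le_one) (n₀ := n₀)
    (C := 4 ^ 5 * C₁ + c.size * (2 * c.size ^ 2 * (24 / γ ^ 4))) (by positivity)
    fun M n hn hn1 => ?_
  obtain ⟨A, hAn, hAcard, hA⟩ := hmyo M n hn hn1
  have hn0 : (0 : ℝ) < n := by exact_mod_cast hn1
  have hKs := M.K_le_size
  have hds := M.d_le_size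
  -- The constant `κ₈ / 16`: each period of `A` has information at least `κ₈ / 2`, the deviation
  -- costs at most `κ₈ / 4`, and `A` has at least `n / 4` elements.
  have hcover : {ω | ∃ k, ∃ v, M.gramForm n ω k v v < c.κ₈ / 16 * n * ‖v‖ ^ 2} ⊆
      (⋃ m ∈ A, (M.near (t / (4 * c.κ₆)) (t / 2) m)ᶜ) ∪ ⋃ k, {ω | ∃ v, M.gramForm n ω k v v <
        ∑ m ∈ A, M.infoForm m (M.ctrl m ω) k v - η * M.d * A.card * ‖v‖ ^ 2} := by
    rintro ω ⟨k, v, hv⟩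
    by_cases hω : ∀ m ∈ A, ω ∈ M.near (t / (4 * c.κ₆)) (t / 2) m
    · refine Or.inr (Set.mem_iUnion.2 ⟨k, v, hv.trans_le ?_⟩)
      have h1 : (A.card : ℝ) * (c.κ₈ / 2 * ‖v‖ ^ 2) ≤ ∑ m ∈ A, M.infoForm m (M.ctrl m ω) k v := by
        rw [← nsmul_eq_mul]
        exact Finset.card_nsmul_le_sum _ _ _ fun m hm =>
          M.le_infoForm_of_near hδ.le (half_pos ht0).le ht ht₁ ht₂ (hA m hm).2 (hω m hm) k v
      have h2 : η * M.d ≤ c.κ₈ / 4 := le_trans (by gcongr) hη1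
      have hA0 : (0 : ℝ) ≤ A.card := Nat.cast_nonneg _
      have h3 : η * M.d * A.card * ‖v‖ ^ 2 ≤ c.κ₈ / 4 * A.card * ‖v‖ ^ 2 := by
        generalize (A.card : ℝ) = N at *
        gcongr
      have h4 : c.κ₈ / 4 * (n / 4) * ‖v‖ ^ 2 ≤ c.κ₈ / 4 * A.card * ‖v‖ ^ 2 := by gcongr
      linarith
    · push Not at hω
      obtain ⟨m, hm, hm'⟩ := hω
      exact Or.inl (Set.mem_biUnion hm hm')
  have hb1 : M.P (⋃ m ∈ A, (M.near (t / (4 * c.κ₆)) (t / 2) m)ᶜ) ≤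
      ENNReal.ofReal (4 ^ 5 * C₁ / (n : ℝ) ^ 4) := by
    refine (measure_biUnion_finset_le _ _).trans ?_
    calc _ ≤ ∑ _m ∈ A, ENNReal.ofReal (4 ^ 5 * C₁ / (n : ℝ) ^ 5) := by
          refine Finset.sum_le_sum fun m hm => ?_
          have h1 := (hA m hm).1
          have hm0 : (0 : ℝ) < m := by linarith
          refine (hnear M m (by exact_mod_cast hm0)).trans (ENNReal.ofReal_le_ofReal ?_)
          rw [div_le_div_iff₀ (by positivity) (by positivity)]
          have h2 : (n : ℝ) ^ 5 ≤ (4 * m) ^ 5 := by gcongr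
          rw [mul_pow] at h2
          have := mul_le_mul_of_nonneg_left h2 hC₁.le
          linarith
      _ = (A.card : ℝ≥0∞) * ENNReal.ofReal (4 ^ 5 * C₁ / (n : ℝ) ^ 5) := by simp
      _ ≤ (n : ℝ≥0∞) * ENNReal.ofReal (4 ^ 5 * C₁ / (n : ℝ) ^ 5) := by
          gcongr
          simpa using Finset.card_le_card hAn
      _ = _ := by
          rw [← ENNReal.ofReal_natCast, ← ENNReal.ofReal_mul hn0.le]
          congr 1
          field_simp
  have hb2 : ∀ k, M.P {ω | ∃ v, M.gramForm n ω k v v <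
      ∑ m ∈ A, M.infoForm m (M.ctrl m ω) k v - η * M.d * A.card * ‖v‖ ^ 2} ≤
      ENNReal.ofReal (2 * c.size ^ 2 * (24 / γ ^ 4) / (n : ℝ) ^ 4) := by
    intro k
    refine (M.measure_gramForm_lt_le n k A hAn hη0.le hη6).trans (ENNReal.ofReal_le_ofReal ?_)
    have h1 : γ * n ≤ η ^ 2 / (16 * c.κ₆ ^ 4) * A.card := by
      have h2 := mul_le_mul_of_nonneg_left hAcard
        (by positivity : 0 ≤ η ^ 2 / (16 * c.κ₆ ^ 4))
      rw [hγ]; linarith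
    calc _ ≤ 2 * c.size ^ 2 * Real.exp (-(γ * n)) := by gcongr
      _ ≤ 2 * c.size ^ 2 * ((Nat.factorial 4 : ℕ) / (γ * n) ^ 4) := by
          gcongr
          exact Real.exp_neg_le_div_pow (by positivity) 4
      _ = _ := by
          rw [mul_pow]; norm_num [Nat.factorial]; field_simp
  refine (measure_mono hcover).trans ((measure_union_le _ _).trans
    ((add_le_add hb1 ((measure_iUnion_fintype_le _ _).trans
      (Finset.sum_le_sum fun k _ => hb2 k))).trans ?_))
  rw [Finset.sum_const, Finset.card_univ, Fintype.card_fin, nsmul_eq_mul,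
    ← ENNReal.ofReal_natCast, ← ENNReal.ofReal_mul (by positivity),
    ← ENNReal.ofReal_add (by positivity) (by positivity)]
  refine ENNReal.ofReal_le_ofReal ?_
  rw [add_div, mul_div_assoc c.size]
  gcongr

/-- Deterministic bounds for the estimation error. -/
lemma norm_err_le (n : ℕ) (ω : M.Ω) (k : Fin M.K) :
    ‖M.err n ω k‖ ≤ 2 * c.R + ‖M.noise n ω k‖ := by
  have hR := c.hR
  have hβ := M.norm_β k
  set v := M.err n ω k with hv
  rcases M.err_equation n ω k with ⟨-, h⟩ | ⟨r, hr1, -, heq⟩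
  · have h1 := norm_sub_le (M.I.b₀ k) (M.β k)
    have h2 := M.norm_b₀ k
    rw [hv, h]
    linarith [norm_nonneg (M.noise n ω k)]
  · have h1 := heq v
    rw [real_inner_self_eq_norm_sq] at h1
    have h2 := M.gramForm_self_nonneg n ω k v
    have h3 : ⟪M.noise n ω k, v⟫ ≤ ‖M.noise n ω k‖ * ‖v‖ := real_inner_le_norm _ _
    have h4 : -⟪M.β k, v⟫ ≤ c.R * ‖v‖ :=
      (neg_le_abs _).trans ((abs_real_inner_le_norm _ _).trans (by gcongr))
    rcases (norm_nonneg v).eq_or_lt with h0 | h0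
    · rw [← h0]; positivity
    have hr0 : 0 < r := by linarith
    have h5 := mul_le_mul_of_nonneg_left h4 hr0.le
    have h6 : ‖M.noise n ω k‖ * ‖v‖ ≤ r * (‖M.noise n ω k‖ * ‖v‖) :=
      le_mul_of_one_le_left (by positivity) hr1
    have h7 : r * ‖v‖ * ‖v‖ ≤ r * ‖v‖ * (‖M.noise n ω k‖ + c.R) := by nlinarith
    have h8 := le_of_mul_le_mul_left h7 (by positivity)
    linarith

/-- Testing the normal equation with the error itself bounds the Gram form by regularization bias
and noise, each linear in the norm of the error. -/
lemma norm_err_le_of_le_gramForm {n : ℕ} {ω : M.Ω} {k : Fin M.K} {Λ : ℝ} (hΛ : 0 < Λ)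
    (h : ∀ v, Λ * ‖v‖ ^ 2 ≤ M.gramForm n ω k v v) :
    ‖M.err n ω k‖ ≤ (rho n * c.R + ‖M.noise n ω k‖) / Λ := by
  have hR := c.hR
  have hβ := M.norm_β k
  have hρ := one_le_rho n
  have h0 := h (M.err n ω k)
  rw [le_div_iff₀ hΛ]
  set v := M.err n ω k with hv
  rcases (norm_nonneg v).eq_or_lt with hv0 | hv0
  · rw [← hv0, zero_mul]; positivity
  rcases M.err_equation n ω k with ⟨h1, -⟩ | ⟨r, hr1, hr2, heq⟩
  · have h2 : M.gramForm n ω k v v = 0 :=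
      Finset.sum_eq_zero fun m hm => if_neg (h1 m (Finset.mem_range.1 hm))
    rw [h2] at h0
    have : 0 < Λ * ‖v‖ ^ 2 := by positivity
    linarith
  · have h1 := heq v
    rw [real_inner_self_eq_norm_sq, ← hv] at h1
    have h3 : ⟪M.noise n ω k, v⟫ ≤ ‖M.noise n ω k‖ * ‖v‖ := real_inner_le_norm _ _
    have h4 : -⟪M.β k, v⟫ ≤ c.R * ‖v‖ :=
      (neg_le_abs _).trans ((abs_real_inner_le_norm _ _).trans (by gcongr))
    have hr0 : 0 < r := by linarith
    have h5 := mul_le_mul_of_nonneg_left h4 hr0.le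
    have h6 : r * (c.R * ‖v‖) ≤ rho n * (c.R * ‖v‖) := by gcongr
    have h7 : 0 ≤ r * ‖v‖ ^ 2 := by positivity
    refine le_of_mul_le_mul_right ?_ hv0
    nlinarith

/-- With `z` the norm of the noise, `z ^ 2 ≤ n + z ^ 4 / n` is used where the Gram forms are large
and `z ^ 2 ≤ n ^ 3 + z ^ 4 / n ^ 3` elsewhere. Noise and bad event are thereby separated additively,
and a fourth moment together with the probability of the event suffices. -/
lemma norm_err_sq_le (c : Constants) : ∃ C : ℝ, 0 < C ∧ ∀ M : Model.{u} c, ∀ n, 1 ≤ n → ∀ ω k,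
    ‖M.err n ω k‖ ^ 2 ≤ C * (1 / n + ‖M.noise n ω k‖ ^ 4 / (n : ℝ) ^ 3 +
      {ω | ∃ k, ∃ v, M.gramForm n ω k v v < c.κ₈ / 16 * n * ‖v‖ ^ 2}.indicator
        (fun _ => (n : ℝ) ^ 3) ω) := by
  have hκ₈ := c.hκ₈
  have hR := c.hR
  refine ⟨2 * (217 ^ 2 * c.R ^ 2 + 1) / (c.κ₈ / 16) ^ 2 + (8 * c.R ^ 2 + 2), by positivity,
    fun M n hn ω k => ?_⟩
  have hn1 : (1 : ℝ) ≤ n := by exact_mod_cast hn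
  have hn0 : (0 : ℝ) < n := by linarith
  set z := ‖M.noise n ω k‖ with hz
  have hz0 : 0 ≤ z := norm_nonneg _
  by_cases hω : ω ∈ {ω | ∃ k, ∃ v, M.gramForm n ω k v v < c.κ₈ / 16 * n * ‖v‖ ^ 2}
  · rw [Set.indicator_of_mem hω]
    have h1 := M.norm_err_le n ω k
    have h2 : z ^ 2 ≤ (n : ℝ) ^ 3 + z ^ 4 / (n : ℝ) ^ 3 := by
      have h3 : (n : ℝ) ^ 3 + z ^ 4 / (n : ℝ) ^ 3 - z ^ 2 =
        (((n : ℝ) ^ 3 - z ^ 2 / 2) ^ 2 + 3 / 4 * z ^ 4) / (n : ℝ) ^ 3 := by field_simp; ring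
      have h4 : 0 ≤ (((n : ℝ) ^ 3 - z ^ 2 / 2) ^ 2 + 3 / 4 * z ^ 4) / (n : ℝ) ^ 3 := by positivity
      linarith
    have h3 : (1 : ℝ) ≤ (n : ℝ) ^ 3 := one_le_pow₀ hn1
    have h5 : 0 ≤ z ^ 4 / (n : ℝ) ^ 3 := by positivity
    have h6 : 0 ≤ 1 / (n : ℝ) := by positivity
    calc ‖M.err n ω k‖ ^ 2 ≤ (2 * c.R + z) ^ 2 := by gcongr
      _ ≤ 8 * c.R ^ 2 * 1 + 2 * z ^ 2 := by nlinarith [sq_nonneg (2 * c.R - z)]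
      _ ≤ 8 * c.R ^ 2 * (1 / n + z ^ 4 / (n : ℝ) ^ 3 + (n : ℝ) ^ 3) +
          2 * (1 / n + z ^ 4 / (n : ℝ) ^ 3 + (n : ℝ) ^ 3) := by
          gcongr <;> linarith
      _ = (0 + (8 * c.R ^ 2 + 2)) * (1 / n + z ^ 4 / (n : ℝ) ^ 3 + (n : ℝ) ^ 3) := by ring
      _ ≤ _ := by gcongr; positivity
  · rw [Set.indicator_of_notMem hω, add_zero]
    simp only [Set.mem_ofPred_eq, not_exists, not_lt] at hω
    have h1 := M.norm_err_le_of_le_gramForm (by positivity) (hω k)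
    have h2 : z ^ 2 ≤ n + z ^ 4 / n := by
      have h3 : n + z ^ 4 / n - z ^ 2 = (((n : ℝ) - z ^ 2 / 2) ^ 2 + 3 / 4 * z ^ 4) / n := by
        field_simp; ring
      have h4 : 0 ≤ (((n : ℝ) - z ^ 2 / 2) ^ 2 + 3 / 4 * z ^ 4) / n := by positivity
      linarith
    have h3 := rho_sq_le hn
    have h4 : 0 ≤ z ^ 4 / n := by positivity
    have hρ := one_le_rho n
    have h5 : (rho n * c.R + z) ^ 2 ≤ 2 * (217 ^ 2 * c.R ^ 2 + 1) * (n + z ^ 4 / n) := by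
      have h6 := mul_le_mul_of_nonneg_right h3 (sq_nonneg c.R)
      have h7 : 217 ^ 2 * c.R ^ 2 * n ≤ 217 ^ 2 * c.R ^ 2 * (n + z ^ 4 / n) := by
        gcongr; linarith
      nlinarith [sq_nonneg (rho n * c.R - z)]
    calc ‖M.err n ω k‖ ^ 2 ≤ ((rho n * c.R + z) / (c.κ₈ / 16 * n)) ^ 2 := by gcongr
      _ = (rho n * c.R + z) ^ 2 / (c.κ₈ / 16 * n) ^ 2 := div_pow _ _ _
      _ ≤ 2 * (217 ^ 2 * c.R ^ 2 + 1) * (n + z ^ 4 / n) / (c.κ₈ / 16 * n) ^ 2 := by gcongr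
      _ = 2 * (217 ^ 2 * c.R ^ 2 + 1) / (c.κ₈ / 16) ^ 2 * (1 / n + z ^ 4 / (n : ℝ) ^ 3) := by
          field_simp
      _ ≤ _ := by
          gcongr
          have : 0 ≤ 8 * c.R ^ 2 + 2 := by positivity
          linarith

lemma lintegral_norm_err_sq_le (c : Constants) : ∃ C : ℝ, 0 < C ∧ ∀ M : Model.{u} c, ∀ n, 1 ≤ n →
    ∫⁻ ω, ENNReal.ofReal (∑ k, ‖M.err n ω k‖ ^ 2) ∂M.P ≤ ENNReal.ofReal (C / n) := by
  obtain ⟨C₁, hC₁, hpt⟩ := norm_err_sq_le.{u} c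
  obtain ⟨C₂, hC₂, hgram⟩ := measure_gramForm_lt_linear_le.{u} c
  have hsz := c.one_le_size
  set C₃ := 48 * c.size ^ 2 * Real.exp (c.κ₇ / 2 * c.κ₆ ^ 2) with hC₃
  have hC₃0 : 0 < C₃ := by positivity
  refine ⟨c.size * (C₁ * (1 + C₃ + C₂)), by positivity, fun M n hn => ?_⟩
  have hn0 : (0 : ℝ) < n := by exact_mod_cast hn
  have hK := M.K_le_size
  have hd := M.d_le_size
  set B := {ω | ∃ k, ∃ v, M.gramForm n ω k v v < c.κ₈ / 16 * n * ‖v‖ ^ 2} with hB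
  have hnoise : ∀ k, Measurable fun ω => ‖M.noise n ω k‖ ^ 4 :=
    fun k => (M.measurable_of_F (M.measurable_noise n k)).norm.pow_const 4
  have hone : ∀ k, ∫⁻ ω, ENNReal.ofReal (‖M.err n ω k‖ ^ 2) ∂M.P ≤
      ENNReal.ofReal (C₁ * (1 + C₃ + C₂) / n) := by
    intro k
    -- The bad event is a union over all directions `v`; its measurable hull, of the same measure,
    -- avoids proving it measurable.
    have hpt' : ∀ ω, ENNReal.ofReal (‖M.err n ω k‖ ^ 2) ≤ ENNReal.ofReal (C₁ / n) +
        ENNReal.ofReal (C₁ / (n : ℝ) ^ 3) * ENNReal.ofReal (‖M.noise n ω k‖ ^ 4) +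
        (toMeasurable M.P B).indicator (fun _ => ENNReal.ofReal (C₁ * (n : ℝ) ^ 3)) ω := by
      intro ω
      have h1 : B.indicator (fun _ => ENNReal.ofReal (C₁ * (n : ℝ) ^ 3)) ω ≤
          (toMeasurable M.P B).indicator (fun _ => ENNReal.ofReal (C₁ * (n : ℝ) ^ 3)) ω :=
        Set.indicator_le_indicator_of_subset (subset_toMeasurable _ _) (fun _ => zero_le) ω
      refine le_trans ?_ (add_le_add_right h1 _)
      have h2 : B.indicator (fun _ => ENNReal.ofReal (C₁ * (n : ℝ) ^ 3)) ω =
          ENNReal.ofReal (C₁ * B.indicator (fun _ => (n : ℝ) ^ 3) ω) := by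
        by_cases hω : ω ∈ B
        · simp only [Set.indicator_of_mem hω]
        · simp only [Set.indicator_of_notMem hω, mul_zero, ENNReal.ofReal_zero]
      have h3 : 0 ≤ B.indicator (fun _ => (n : ℝ) ^ 3) ω :=
        Set.indicator_nonneg (fun _ _ => by positivity) ω
      rw [h2, ← ENNReal.ofReal_mul (by positivity), ← ENNReal.ofReal_add (by positivity)
        (by positivity), ← ENNReal.ofReal_add (by positivity) (by positivity)]
      refine ENNReal.ofReal_le_ofReal ((hpt M n hn ω k).trans_eq ?_)
      rw [← hB]; ring
    refine (lintegral_mono hpt').trans ?_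
    rw [lintegral_add_right _ (measurable_const.indicator (measurableSet_toMeasurable _ _)),
      lintegral_add_left measurable_const, lintegral_const_mul' _ _ ENNReal.ofReal_ne_top,
      lintegral_indicator (measurableSet_toMeasurable _ _), lintegral_const, measure_univ, mul_one,
      setLIntegral_const, measure_toMeasurable]
    have h4 : ∫⁻ ω, ENNReal.ofReal (‖M.noise n ω k‖ ^ 4) ∂M.P ≤ ENNReal.ofReal (C₃ * n ^ 2) := by
      refine (M.lintegral_norm_noise_pow_four_le n hn k).trans (ENNReal.ofReal_le_ofReal ?_)
      rw [hC₃]; gcongr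
    refine (add_le_add (add_le_add_right (mul_le_mul_right h4 _) _)
      (mul_le_mul_right (hgram M n hn) _)).trans_eq ?_
    rw [← ENNReal.ofReal_mul (by positivity), ← ENNReal.ofReal_mul (by positivity),
      ← ENNReal.ofReal_add (by positivity) (by positivity),
      ← ENNReal.ofReal_add (by positivity) (by positivity)]
    congr 1
    field_simp
  have herr : ∀ k, Measurable fun ω => ENNReal.ofReal (‖M.err n ω k‖ ^ 2) := fun k =>
    ((M.measurable_of_F (M.measurable_err n k)).norm.pow_const 2).ennreal_ofReal
  calc _ = ∫⁻ ω, ∑ k, ENNReal.ofReal (‖M.err n ω k‖ ^ 2) ∂M.P :=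
        lintegral_congr fun ω => ENNReal.ofReal_sum_of_nonneg fun _ _ => by positivity
    _ = ∑ k, ∫⁻ ω, ENNReal.ofReal (‖M.err n ω k‖ ^ 2) ∂M.P :=
        lintegral_finsetSum _ fun k _ => herr k
    _ ≤ ∑ _k : Fin M.K, ENNReal.ofReal (C₁ * (1 + C₃ + C₂) / n) :=
        Finset.sum_le_sum fun k _ => hone k
    _ = ENNReal.ofReal (M.K * (C₁ * (1 + C₃ + C₂) / n)) := by
        rw [Finset.sum_const, Finset.card_univ, Fintype.card_fin, nsmul_eq_mul,
          ← ENNReal.ofReal_natCast, ← ENNReal.ofReal_mul (by positivity)]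
    _ ≤ _ := by
        refine ENNReal.ofReal_le_ofReal ?_
        rw [mul_div_assoc c.size]
        gcongr

end Model

/-! ### The rate of the dual vector. -/

lemma Constants.width_sq_le (c : Constants) : ∃ C : ℝ, 0 < C ∧ ∀ n : ℕ, 1 ≤ n →
    c.width n ^ 2 ≤ C * n := by
  have hα := c.hα
  have hR := c.hR
  refine ⟨(2 * c.R + 2 * c.α) ^ 2, by positivity, fun n hn => ?_⟩
  have hn1 : (1 : ℝ) ≤ n := by exact_mod_cast hn
  have hn0 : (0 : ℝ) < n := by linarith
  have hs1 : 1 ≤ Real.sqrt n := Real.one_le_sqrt.2 hn1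
  have h1 : Real.log n ≤ 2 * Real.sqrt n - 1 := by
    have h2 := Real.log_le_sub_one_of_pos (Real.sqrt_pos.2 hn0)
    rw [Real.log_sqrt hn0.le] at h2
    linarith
  have h3 : c.width n ≤ (2 * c.R + 2 * c.α) * Real.sqrt n := by
    have h4 := mul_le_mul_of_nonneg_left h1 hα.le
    have h5 := mul_le_mul_of_nonneg_left hs1 hR.le
    unfold Constants.width; linarith
  calc _ ≤ ((2 * c.R + 2 * c.α) * Real.sqrt n) ^ 2 :=
        pow_le_pow_left₀ (c.width_nonneg n) h3 2
    _ = _ := by rw [mul_pow, Real.sq_sqrt hn0.le]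

/-- The contraction rate of the dual vector. -/
def Constants.rate (c : Constants) : ℝ := c.κ₂ * c.κ₅ / (8 * c.size)

lemma Constants.rate_pos (c : Constants) : 0 < c.rate := by
  have := c.hκ₂
  have := c.hκ₅
  have := c.one_le_size
  unfold Constants.rate; positivity

/-- A recursion with contraction factors `1 - A / (n + 1)`, `2 ≤ A`, decreases like `1 / n`. -/
lemma le_const_div_of_contraction {e : ℕ → ℝ≥0∞} {A B D : ℝ} {n₀ : ℕ} (hA : 2 ≤ A)
    (hAn : A ≤ n₀) (hBD : B ≤ D) (hB : 0 ≤ B)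
    (h : ∀ n, n₀ ≤ n → e (n + 1) ≤ ENNReal.ofReal (1 - A / ((n : ℝ) + 1)) * e n +
      ENNReal.ofReal (B / ((n : ℝ) + 1) ^ 2))
    (hbase : e n₀ ≤ ENNReal.ofReal (D / n₀)) :
    ∀ n, n₀ ≤ n → e n ≤ ENNReal.ofReal (D / n) := by
  intro n hn
  induction n, hn using Nat.le_induction with
  | base => exact hbase
  | succ n hn ih =>
    have hn' : (n₀ : ℝ) ≤ n := by exact_mod_cast hn
    have hn0 : (0 : ℝ) < n := by linarith
    have hD : 0 ≤ D := hB.trans hBD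
    have h1 : 0 ≤ 1 - A / ((n : ℝ) + 1) := by
      rw [sub_nonneg, div_le_one (by positivity)]; linarith
    refine (h n hn).trans ((add_le_add_left (mul_le_mul_right ih _) _).trans ?_)
    rw [← ENNReal.ofReal_mul h1, ← ENNReal.ofReal_add (by positivity) (by positivity)]
    refine ENNReal.ofReal_le_ofReal ?_
    push_cast
    -- The surplus over `D / (n + 1)` is nonpositive because `A - 1 ≥ 1` and `B ≤ D`.
    have h2 : (1 - A / ((n : ℝ) + 1)) * (D / n) + B / ((n : ℝ) + 1) ^ 2 = D / ((n : ℝ) + 1) -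
        ((A - 1) * D * ((n : ℝ) + 1) - B * n) / (n * ((n : ℝ) + 1) ^ 2) := by
      field_simp; ring
    have h3 : 0 ≤ (A - 1) * D * ((n : ℝ) + 1) - B * n := by
      have h4 : 1 * D * ((n : ℝ) + 1) ≤ (A - 1) * D * ((n : ℝ) + 1) := by gcongr; linarith
      have h5 : B * n ≤ D * n := by gcongr
      linarith
    have h4 : 0 ≤ ((A - 1) * D * ((n : ℝ) + 1) - B * n) / (n * ((n : ℝ) + 1) ^ 2) := by
      positivity
    linarith

namespace Model

variable {c : Constants} (M : Model.{u} c)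

/-- The fluctuation in `pot_next_le` integrates to zero; the bound `W` serves only its
integrability. -/
lemma lintegral_pot_next_le (n : ℕ) (γ : ℝ) (s : M.Ctrl) {W : ℝ}
    (hW : ∀ k, |M.cen s.1 k| ≤ W) :
    ∫⁻ ω, ENNReal.ofReal (M.pot (M.next γ s (M.X n ω))) ∂M.P ≤
      ENNReal.ofReal (M.pot s.1 + 2 * γ * M.drift s + 2 * γ ^ 2) := by
  have hmf : Measurable fun x => M.cen s.1 (M.dec s x) :=
    (measurable_of_finite (M.cen s.1)).comp (M.measurable_dec_right s)
  have hY : Measurable fun ω => M.cen s.1 (M.dec s (M.X n ω)) := hmf.comp (M.measurable_X n)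
  have hYi : Integrable (fun ω => M.cen s.1 (M.dec s (M.X n ω))) M.P :=
    Integrable.of_bound hY.aestronglyMeasurable W (Filter.Eventually.of_forall fun ω => hW _)
  set I := ∫ x, M.cen s.1 (M.dec s x) ∂M.ν with hI
  have hfi : Integrable (fun ω => M.pot s.1 + 2 * γ * (M.drift s +
      (I - M.cen s.1 (M.dec s (M.X n ω)))) + 2 * γ ^ 2) M.P :=
    (((integrable_const _).add (((integrable_const _).add ((integrable_const _).sub
      hYi)).const_mul _)).add (integrable_const _))
  have hle := fun ω => M.pot_next_le γ s (M.X n ω)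
  refine (lintegral_mono fun ω => ENNReal.ofReal_le_ofReal (hle ω)).trans_eq ?_
  rw [← ofReal_integral_eq_lintegral_ofReal hfi
    (Filter.Eventually.of_forall fun ω => (M.pot_nonneg _).trans (hle ω))]
  congr 1
  have e : ∀ ω, M.pot s.1 + 2 * γ * (M.drift s + (I - M.cen s.1 (M.dec s (M.X n ω)))) +
      2 * γ ^ 2 = (M.pot s.1 + 2 * γ * (M.drift s + I) + 2 * γ ^ 2) -
      2 * γ * M.cen s.1 (M.dec s (M.X n ω)) := fun ω => by ring
  simp only [e]
  rw [integral_sub (integrable_const _) (hYi.const_mul _), integral_const_mul, integral_const,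
    M.integral_X n hmf, ← hI]
  simp
  ring

/-- In the local drift bound, Young's inequality splits the mixed term `Δ * L * e`: one half of the
negative quadratic term absorbs its part in `Δ`, the other half is at least `rate * pot` because
`pot ≤ size * Δ ^ 2`. -/
lemma drift_le_of_mem_near {δ r : ℝ} (hr : 0 ≤ r) (hsmall : r + 2 * c.κ₆ * δ ≤ c.κ₁) :
    ∃ C : ℝ, 0 < C ∧ ∀ (M : Model.{u} c) (n : ℕ) (ω : M.Ω), ω ∈ M.near δ r n →
      M.drift (M.ctrl n ω) ≤
        -(c.rate * M.pot (M.ctrl n ω).1) + C * ∑ k, ‖M.err n ω k‖ ^ 2 := by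
  have hκ₂ := c.hκ₂
  have hκ₃ := c.hκ₃
  have hκ₅ := c.hκ₅
  have hκ₆ := c.hκ₆
  have hsz := c.one_le_size
  set L := c.size ^ 2 * (c.κ₃ * (2 * c.κ₆)) with hL
  refine ⟨2 * L ^ 2 / (c.κ₂ * c.κ₅), by positivity, fun M n ω hω => ?_⟩
  obtain ⟨i, hi⟩ := Finite.exists_max fun k => ‖M.err n ω k‖
  set e := ‖M.err n ω i‖ with he
  have he0 : 0 ≤ e := norm_nonneg _
  have heδ : e ≤ δ := hω.1 i
  obtain ⟨j, k, hmax, hpot⟩ := M.exists_max_spread (M.sum_cen n ω)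
  set Δ := M.cen (M.ctrl n ω).1 j - M.cen (M.ctrl n ω).1 k with hΔ
  have hΔ0 : 0 ≤ Δ := by simpa using hmax j j
  have hΔr : Δ ≤ r := M.spread_le_of_pot_lt hr hω.2 j k
  have hdr := M.drift_le_of_near (M.ctrl n ω) (δ := e) hi j k (Δ := Δ) (by rw [hΔ, M.cen_sub])
    (fun i l => by rw [← M.cen_sub]; exact hmax i l) (le_trans (by gcongr) hsmall)
  have hK := M.K_le_size
  have hK1 := M.one_le_K
  have h1 : Δ * ((M.K : ℝ) ^ 2 * (c.κ₃ * (2 * c.κ₆ * e))) ≤ Δ * (L * e) := by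
    have : (M.K : ℝ) ^ 2 * (c.κ₃ * (2 * c.κ₆ * e)) ≤ L * e := by
      calc _ ≤ c.size ^ 2 * (c.κ₃ * (2 * c.κ₆ * e)) := by gcongr
        _ = _ := by rw [hL]; ring
    gcongr
  have h2 : Δ * (L * e) ≤ c.κ₂ * c.κ₅ / 8 * Δ ^ 2 + 2 * L ^ 2 / (c.κ₂ * c.κ₅) * e ^ 2 := by
    have h3 : c.κ₂ * c.κ₅ / 8 * Δ ^ 2 + 2 * L ^ 2 / (c.κ₂ * c.κ₅) * e ^ 2 - Δ * (L * e) =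
        (c.κ₂ * c.κ₅ * Δ - 4 * L * e) ^ 2 / (8 * (c.κ₂ * c.κ₅)) := by field_simp; ring
    have h4 : 0 ≤ (c.κ₂ * c.κ₅ * Δ - 4 * L * e) ^ 2 / (8 * (c.κ₂ * c.κ₅)) := by positivity
    linarith
  have h3 : c.rate * M.pot (M.ctrl n ω).1 ≤ c.κ₂ * c.κ₅ / 8 * Δ ^ 2 := by
    have h4 : M.pot (M.ctrl n ω).1 ≤ c.size * Δ ^ 2 := hpot.trans (by gcongr)
    calc _ ≤ c.rate * (c.size * Δ ^ 2) := mul_le_mul_of_nonneg_left h4 c.rate_pos.le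
      _ = _ := by rw [Constants.rate]; field_simp
  have h4 : e ^ 2 ≤ ∑ k, ‖M.err n ω k‖ ^ 2 :=
    Finset.single_le_sum (f := fun k => ‖M.err n ω k‖ ^ 2) (fun _ _ => sq_nonneg _)
      (Finset.mem_univ i)
  have h5 := mul_le_mul_of_nonneg_left h4 (by positivity : 0 ≤ 2 * L ^ 2 / (c.κ₂ * c.κ₅))
  linarith

/-- A crude bound for use where nothing is known to be close: the global drift bound with spread
zero, and `2 * e ≤ 1 + e ^ 2`. -/
lemma drift_le_sum (n : ℕ) (ω : M.Ω) :
    M.drift (M.ctrl n ω) ≤ c.κ₆ * (1 + ∑ k, ‖M.err n ω k‖ ^ 2) := by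
  have hκ₆ := c.hκ₆
  obtain ⟨i, hi⟩ := Finite.exists_max fun k => ‖M.err n ω k‖
  have h1 := M.drift_le (M.ctrl n ω) hi i i le_rfl (by simp)
  rw [zero_mul, mul_zero, sub_zero] at h1
  have h4 : ‖M.err n ω i‖ ^ 2 ≤ ∑ k, ‖M.err n ω k‖ ^ 2 :=
    Finset.single_le_sum (f := fun k => ‖M.err n ω k‖ ^ 2) (fun _ _ => sq_nonneg _)
      (Finset.mem_univ i)
  refine h1.trans ?_
  rw [mul_assoc, mul_left_comm]
  refine mul_le_mul_of_nonneg_left ?_ hκ₆.le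
  nlinarith [sq_nonneg (‖M.err n ω i‖ - 1)]

lemma measurable_pot_ctrl (n : ℕ) : Measurable fun ω => M.pot (M.ctrl n ω).1 :=
  M.measurable_pot.comp (M.measurable_of_F (M.measurable_ctrl n)).fst

lemma measurable_sum_norm_err_sq (n : ℕ) : Measurable fun ω => ∑ k, ‖M.err n ω k‖ ^ 2 :=
  Finset.measurable_fun_sum _ fun k _ =>
    (M.measurable_of_F (M.measurable_err n k)).norm.pow_const 2

lemma lintegral_pot_succ_le (n : ℕ) :
    ∫⁻ ω, ENNReal.ofReal (M.pot (M.ctrl (n + 1) ω).1) ∂M.P ≤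
      ∫⁻ ω, ENNReal.ofReal (M.pot (M.ctrl n ω).1 + 2 * (c.α / ((n : ℝ) + 1)) *
        M.drift (M.ctrl n ω) + 2 * (c.α / ((n : ℝ) + 1)) ^ 2) ∂M.P := by
  have hh : Measurable (Function.uncurry fun (s : M.Ctrl) (z : M.E × (Fin M.K → ℝ)) =>
      ENNReal.ofReal (M.pot (M.next (c.α / ((n : ℝ) + 1)) s z.1))) := by
    have h4 : Measurable (Function.uncurry fun (s : M.Ctrl) (x : M.E) =>
        ENNReal.ofReal (M.pot (M.next (c.α / ((n : ℝ) + 1)) s x))) :=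
      ENNReal.measurable_ofReal.comp (M.measurable_pot.comp (M.measurable_next _))
    exact measurable_uncurry_fst h4
  calc _ = ∫⁻ ω, (fun _ => (1 : ℝ≥0∞)) ω * (fun (s : M.Ctrl) (z : M.E × (Fin M.K → ℝ)) =>
          ENNReal.ofReal (M.pot (M.next (c.α / ((n : ℝ) + 1)) s z.1))) (M.ctrl n ω)
          (M.Z n ω) ∂M.P := by
        refine lintegral_congr fun ω => ?_
        simp only [one_mul, ctrl_succ]; rfl
    _ = ∫⁻ ω, (fun _ => (1 : ℝ≥0∞)) ω * ∫⁻ ω', ENNReal.ofReal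
          (M.pot (M.next (c.α / ((n : ℝ) + 1)) (M.ctrl n ω) (M.X n ω'))) ∂M.P ∂M.P :=
        M.lintegral_period n (@measurable_const _ _ _ (M.F n) (1 : ℝ≥0∞)) (M.measurable_ctrl n) hh
    _ ≤ _ := by
        refine lintegral_mono fun ω => ?_
        simp only [one_mul]
        exact M.lintegral_pot_next_le n _ (M.ctrl n ω) (M.abs_cen_le n ω)

/-- The recursion for the mean squared distance to the optimal dual vector. -/
lemma lintegral_pot_recursion (c : Constants) : ∃ B : ℝ, 0 < B ∧ ∃ n₀ : ℕ, 1 ≤ n₀ ∧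
    ∀ M : Model.{u} c, ∀ n, n₀ ≤ n →
      ∫⁻ ω, ENNReal.ofReal (M.pot (M.ctrl (n + 1) ω).1) ∂M.P ≤
        ENNReal.ofReal (1 - 2 * c.α * c.rate / ((n : ℝ) + 1)) *
          ∫⁻ ω, ENNReal.ofReal (M.pot (M.ctrl n ω).1) ∂M.P +
        ENNReal.ofReal (B / ((n : ℝ) + 1) ^ 2) := by
  have hκ₁ := c.hκ₁
  have hκ₆ := c.hκ₆
  have hα := c.hα
  have hsz := c.one_le_size
  have hrate := c.rate_pos
  have hδ : 0 < c.κ₁ / (4 * c.κ₆) := by positivity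
  have hsmall : c.κ₁ / 2 + 2 * c.κ₆ * (c.κ₁ / (4 * c.κ₆)) ≤ c.κ₁ := by
    have : 2 * c.κ₆ * (c.κ₁ / (4 * c.κ₆)) = c.κ₁ / 2 := by field_simp; ring
    linarith
  obtain ⟨C₁, hC₁, hdrift⟩ := drift_le_of_mem_near.{u} (half_pos hκ₁).le hsmall
  obtain ⟨C₂, hC₂, hnear⟩ := measure_near_compl_le.{u} c hδ (half_pos hκ₁) 2
  obtain ⟨C₃, hC₃, herr⟩ := lintegral_norm_err_sq_le.{u} c
  obtain ⟨C₄, hC₄, hwidth⟩ := c.width_sq_le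
  -- On the bad event the contraction term `rate * pot` is not available and has to be added back;
  -- it is at most of order `n`. Against a probability of order `n ^ (-2)` this leaves `1 / n`, like
  -- the squared estimation error.
  set C₅ := c.κ₆ + c.rate * (c.size * C₄) with hC₅
  have hC₅0 : 0 < C₅ := by positivity
  refine ⟨2 * c.α * ((C₁ + c.κ₆) * (2 * C₃) + C₅ * (2 * C₂)) + 2 * c.α ^ 2, by positivity,
    ⌈2 * c.α * c.rate⌉₊ + 1, by omega, fun M n hn => ?_⟩
  have hn1 : 1 ≤ n := by omega
  have hn1' : (1 : ℝ) ≤ n := by exact_mod_cast hn1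
  have hn0 : (0 : ℝ) < n := by linarith
  -- For such `n` the contraction factor is nonnegative, so `ENNReal.ofReal` does not truncate it.
  have hAn : 2 * c.α * c.rate ≤ n :=
    (Nat.le_ceil _).trans (by exact_mod_cast (by omega : ⌈2 * c.α * c.rate⌉₊ ≤ n))
  set γ := c.α / ((n : ℝ) + 1) with hγ
  have hγ0 : 0 < γ := by positivity
  have hfac : 0 ≤ 1 - 2 * c.α * c.rate / ((n : ℝ) + 1) := by
    rw [sub_nonneg, div_le_one (by positivity)]; linarith
  have hfac' : 1 - 2 * c.α * c.rate / ((n : ℝ) + 1) = 1 - 2 * γ * c.rate := by rw [hγ]; ring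
  set N := (M.near (c.κ₁ / (4 * c.κ₆)) (c.κ₁ / 2) n)ᶜ with hN
  have hpt : ∀ ω, ENNReal.ofReal (M.pot (M.ctrl n ω).1 + 2 * γ * M.drift (M.ctrl n ω) +
      2 * γ ^ 2) ≤ ENNReal.ofReal (1 - 2 * c.α * c.rate / ((n : ℝ) + 1)) *
      ENNReal.ofReal (M.pot (M.ctrl n ω).1) + (ENNReal.ofReal (2 * γ * (C₁ + c.κ₆)) *
      ENNReal.ofReal (∑ k, ‖M.err n ω k‖ ^ 2) + (ENNReal.ofReal (2 * γ ^ 2) +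
      (toMeasurable M.P N).indicator (fun _ => ENNReal.ofReal (2 * γ * (C₅ * n))) ω)) := by
    intro ω
    have hV := M.pot_nonneg (M.ctrl n ω).1
    have hS : 0 ≤ ∑ k, ‖M.err n ω k‖ ^ 2 := Finset.sum_nonneg fun _ _ => sq_nonneg _
    have h1 : N.indicator (fun _ => ENNReal.ofReal (2 * γ * (C₅ * n))) ω ≤
        (toMeasurable M.P N).indicator (fun _ => ENNReal.ofReal (2 * γ * (C₅ * n))) ω :=
      Set.indicator_le_indicator_of_subset (subset_toMeasurable _ _) (fun _ => zero_le) ω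
    refine le_trans ?_ (add_le_add_right (add_le_add_right (add_le_add_right h1 _) _) _)
    by_cases hω : ω ∈ M.near (c.κ₁ / (4 * c.κ₆)) (c.κ₁ / 2) n
    · rw [Set.indicator_of_notMem (fun h : ω ∈ N => h hω), add_zero, ← ENNReal.ofReal_mul hfac,
        ← ENNReal.ofReal_mul (by positivity), ← ENNReal.ofReal_add (by positivity) (by positivity),
        ← ENNReal.ofReal_add (by positivity) (by positivity)]
      refine ENNReal.ofReal_le_ofReal ?_
      have h2 := mul_le_mul_of_nonneg_left (hdrift M n ω hω) (by positivity : 0 ≤ 2 * γ)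
      have h3 : 0 ≤ 2 * γ * c.κ₆ * ∑ k, ‖M.err n ω k‖ ^ 2 := by positivity
      rw [hfac']
      linarith
    · rw [Set.indicator_of_mem (show ω ∈ N from hω), ← ENNReal.ofReal_mul hfac,
        ← ENNReal.ofReal_mul (by positivity), ← ENNReal.ofReal_add (by positivity) (by positivity),
        ← ENNReal.ofReal_add (by positivity) (by positivity),
        ← ENNReal.ofReal_add (by positivity) (by positivity)]
      refine ENNReal.ofReal_le_ofReal ?_
      have h2 := mul_le_mul_of_nonneg_left (M.drift_le_sum n ω) (by positivity : 0 ≤ 2 * γ)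
      have h3 : 0 ≤ 2 * γ * C₁ * ∑ k, ‖M.err n ω k‖ ^ 2 := by positivity
      have h4 : M.pot (M.ctrl n ω).1 ≤ c.size * (C₄ * n) := (M.pot_ctrl_le n ω).trans
        (mul_le_mul_of_nonneg_left (hwidth n hn1) (by linarith))
      have h5 := mul_le_mul_of_nonneg_left h4 (by positivity : 0 ≤ 2 * γ * c.rate)
      have h6 := mul_le_mul_of_nonneg_left hn1' (by positivity : 0 ≤ 2 * γ * c.κ₆)
      rw [hfac', hC₅]
      linarith
  refine (M.lintegral_pot_succ_le n).trans ((lintegral_mono hpt).trans ?_)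
  have hmp := (M.measurable_pot_ctrl n).ennreal_ofReal
  have hme := (M.measurable_sum_norm_err_sq n).ennreal_ofReal
  rw [lintegral_add_left (hmp.const_mul _), lintegral_add_left (hme.const_mul _),
    lintegral_add_left measurable_const, lintegral_const_mul' _ _ ENNReal.ofReal_ne_top,
    lintegral_const_mul' _ _ ENNReal.ofReal_ne_top, lintegral_const, measure_univ, mul_one,
    lintegral_indicator (measurableSet_toMeasurable _ _), setLIntegral_const, measure_toMeasurable]
  refine add_le_add_right ((add_le_add (mul_le_mul_right (herr M n hn1) _)
    (add_le_add_right (mul_le_mul_right (hnear M n hn1) _) _)).trans ?_) _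
  rw [← ENNReal.ofReal_mul (by positivity), ← ENNReal.ofReal_mul (by positivity),
    ← ENNReal.ofReal_add (by positivity) (by positivity),
    ← ENNReal.ofReal_add (by positivity) (by positivity)]
  refine ENNReal.ofReal_le_ofReal ?_
  have hinv : ∀ C : ℝ, 0 ≤ C → C / (n : ℝ) ≤ 2 * C / ((n : ℝ) + 1) := fun C hC => by
    rw [div_le_div_iff₀ hn0 (by positivity)]
    nlinarith
  have e1 : 2 * γ * (C₅ * n) * (C₂ / (n : ℝ) ^ 2) = 2 * γ * C₅ * (C₂ / n) := by field_simp
  have e2 : (2 * c.α * ((C₁ + c.κ₆) * (2 * C₃) + C₅ * (2 * C₂)) + 2 * c.α ^ 2) /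
      ((n : ℝ) + 1) ^ 2 = 2 * γ * (C₁ + c.κ₆) * (2 * C₃ / ((n : ℝ) + 1)) + (2 * γ ^ 2 +
      2 * γ * C₅ * (2 * C₂ / ((n : ℝ) + 1))) := by
    rw [hγ]; field_simp; ring
  rw [e1, e2]
  have h1 := mul_le_mul_of_nonneg_left (hinv C₃ hC₃.le)
    (by positivity : 0 ≤ 2 * γ * (C₁ + c.κ₆))
  have h2 := mul_le_mul_of_nonneg_left (hinv C₂ hC₂.le) (by positivity : 0 ≤ 2 * γ * C₅)
  linarith

/-- The condition on `α` makes the contraction constant `2 * α * rate` at least `2`, as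
`le_const_div_of_contraction` requires. The finitely many early times are covered by the
deterministic bound on the potential. -/
lemma lintegral_pot_le (c : Constants) (hc : 1 ≤ c.α * c.rate) : ∃ C : ℝ, 0 < C ∧
    ∀ M : Model.{u} c, ∀ n, 1 ≤ n →
      ∫⁻ ω, ENNReal.ofReal (M.pot (M.ctrl n ω).1) ∂M.P ≤ ENNReal.ofReal (C / n) := by
  obtain ⟨B, hB, n₁, hn₁, hrec⟩ := lintegral_pot_recursion.{u} c
  have hsz := c.one_le_size
  set n₀ := max n₁ ⌈2 * c.α * c.rate⌉₊ with hn₀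
  have hn₀1 : 1 ≤ n₀ := hn₁.trans (le_max_left _ _)
  have hn₀A : 2 * c.α * c.rate ≤ n₀ := (Nat.le_ceil _).trans (by exact_mod_cast le_max_right _ _)
  have hD0 : 0 ≤ c.size * c.width n₀ ^ 2 * n₀ := by positivity
  have hsmall : ∀ M : Model.{u} c, ∀ n, 1 ≤ n → n ≤ n₀ →
      ∫⁻ ω, ENNReal.ofReal (M.pot (M.ctrl n ω).1) ∂M.P ≤
        ENNReal.ofReal ((B + c.size * c.width n₀ ^ 2 * n₀) / n) := by
    intro M n hn hnn
    have hn0 : (0 : ℝ) < n := by exact_mod_cast hn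
    calc _ ≤ ∫⁻ _ω, ENNReal.ofReal ((B + c.size * c.width n₀ ^ 2 * n₀) / n) ∂M.P := by
          refine lintegral_mono fun ω => ENNReal.ofReal_le_ofReal ?_
          rw [le_div_iff₀ hn0]
          have h1 : M.pot (M.ctrl n ω).1 ≤ c.size * c.width n₀ ^ 2 := by
            refine (M.pot_ctrl_le n ω).trans ?_
            have := c.width_mono hnn
            have := c.width_nonneg n
            gcongr
          have h2 : (n : ℝ) ≤ n₀ := by exact_mod_cast hnn
          have h3 : M.pot (M.ctrl n ω).1 * n ≤ c.size * c.width n₀ ^ 2 * n₀ := by gcongr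
          linarith
      _ = _ := by simp
  refine ⟨B + c.size * c.width n₀ ^ 2 * n₀, by positivity, fun M n hn => ?_⟩
  rcases le_total n n₀ with h | h
  · exact hsmall M n hn h
  · exact le_const_div_of_contraction
      (e := fun n => ∫⁻ ω, ENNReal.ofReal (M.pot (M.ctrl n ω).1) ∂M.P) (by linarith) hn₀A
      (by linarith) hB.le (fun n hn => hrec M n ((le_max_left _ _).trans hn))
      (hsmall M n₀ hn₀1 le_rfl) n h

lemma _root_.MeasureTheory.integrable_and_integral_le {Ω : Type*} [MeasurableSpace Ω]
    {P : Measure Ω} {f g : Ω → ℝ} (hf : Measurable f) (hf0 : ∀ ω, 0 ≤ f ω) (hfg : ∀ ω, f ω ≤ g ω)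
    {B : ℝ} (hB : 0 ≤ B) (h : ∫⁻ ω, ENNReal.ofReal (g ω) ∂P ≤ ENNReal.ofReal B) :
    Integrable f P ∧ ∫ ω, f ω ∂P ≤ B := by
  have h1 : ∫⁻ ω, ENNReal.ofReal (f ω) ∂P ≤ ENNReal.ofReal B :=
    (lintegral_mono fun ω => ENNReal.ofReal_le_ofReal (hfg ω)).trans h
  refine ⟨⟨hf.aestronglyMeasurable, ?_⟩, ?_⟩
  · rw [hasFiniteIntegral_iff_ofReal (Filter.Eventually.of_forall hf0)]
    exact h1.trans_lt ENNReal.ofReal_lt_top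
  · rw [integral_eq_lintegral_of_nonneg_ae (Filter.Eventually.of_forall hf0)
      hf.aestronglyMeasurable]
    exact ENNReal.toReal_le_of_le_ofReal hB h1

/-- Convergence rate of the estimates. -/
lemma integral_iSup_norm_err_sq_le (c : Constants) : ∃ C : ℝ, 0 < C ∧ ∀ M : Model.{u} c, ∀ n,
    1 ≤ n → Integrable (fun ω => ⨆ j, ‖M.err n ω j‖ ^ 2) M.P ∧
      ∫ ω, (⨆ j, ‖M.err n ω j‖ ^ 2) ∂M.P ≤ C / n := by
  obtain ⟨C, hC, h⟩ := lintegral_norm_err_sq_le.{u} c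
  refine ⟨C, hC, fun M n hn => MeasureTheory.integrable_and_integral_le ?_ (fun ω => ?_)
    (fun ω => ?_) (by positivity) (h M n hn)⟩
  · exact Measurable.iSup fun j => (M.measurable_of_F (M.measurable_err n j)).norm.pow_const 2
  · exact Real.iSup_nonneg fun j => sq_nonneg _
  · exact ciSup_le fun j => Finset.single_le_sum (f := fun k => ‖M.err n ω k‖ ^ 2)
      (fun _ _ => sq_nonneg _) (Finset.mem_univ j)

lemma sum_sub_sq_le (g : Fin M.K → ℝ) (i : Fin M.K) :
    ∑ k, ((g k - g i) - (M.gstar k - M.gstar i)) ^ 2 ≤ (2 + 2 * c.size) * M.pot g := by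
  have hK := M.K_le_size
  have hsz := c.one_le_size
  have hi : M.cen g i ^ 2 ≤ M.pot g :=
    Finset.single_le_sum (f := fun k => M.cen g k ^ 2) (fun _ _ => sq_nonneg _) (Finset.mem_univ i)
  calc _ ≤ ∑ k, (2 * M.cen g k ^ 2 + 2 * M.cen g i ^ 2) := by
        refine Finset.sum_le_sum fun k _ => ?_
        have e : (g k - g i) - (M.gstar k - M.gstar i) = M.cen g k - M.cen g i := by
          rw [M.cen_sub]; ring
        rw [e]
        nlinarith [sq_nonneg (M.cen g k + M.cen g i)]
    _ = 2 * M.pot g + M.K * (2 * M.cen g i ^ 2) := by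
        rw [Finset.sum_add_distrib, ← Finset.mul_sum, Finset.sum_const, Finset.card_univ,
          Fintype.card_fin, nsmul_eq_mul, pot]
    _ ≤ 2 * M.pot g + c.size * (2 * M.pot g) := by
        have := M.pot_nonneg g
        gcongr
    _ = _ := by ring

/-- Convergence rate of the dual vector. -/
lemma integral_sum_sq_le (c : Constants) (hc : 1 ≤ c.α * c.rate) : ∃ C : ℝ, 0 < C ∧
    ∀ M : Model.{u} c, ∀ n, 1 ≤ n →
      (Integrable (fun ω => ∑ k, (((M.S n ω).g k - (M.S n ω).g 0) -
          (M.gstar k - M.gstar 0)) ^ 2) M.P ∧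
        ∫ ω, (∑ k, (((M.S n ω).g k - (M.S n ω).g 0) - (M.gstar k - M.gstar 0)) ^ 2) ∂M.P
          ≤ C / n) ∧
      (∑ k, M.I.g₀ k = ∑ k, M.gstar k →
        Integrable (fun ω => ∑ k, ((M.S n ω).g k - M.gstar k) ^ 2) M.P ∧
        ∫ ω, (∑ k, ((M.S n ω).g k - M.gstar k) ^ 2) ∂M.P ≤ C / n) := by
  obtain ⟨C, hC, h⟩ := lintegral_pot_le.{u} c hc
  have hsz := c.one_le_size
  refine ⟨(2 + 2 * c.size) * C, by positivity, fun M n hn => ?_⟩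
  have hn0 : (0 : ℝ) < n := by exact_mod_cast hn
  have hg : ∀ k, Measurable fun ω => (M.S n ω).g k := fun k =>
    (measurable_pi_apply k).comp (M.measurable_of_F (M.measurable_ctrl n)).fst
  have hint : ∫⁻ ω, ENNReal.ofReal ((2 + 2 * c.size) * M.pot (M.ctrl n ω).1) ∂M.P ≤
      ENNReal.ofReal ((2 + 2 * c.size) * C / n) := by
    have h1 : (0 : ℝ) ≤ 2 + 2 * c.size := by positivity
    simp only [ENNReal.ofReal_mul h1]
    rw [lintegral_const_mul' _ _ ENNReal.ofReal_ne_top, mul_div_assoc, ENNReal.ofReal_mul h1]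
    exact mul_le_mul_right (h M n hn) _
  refine ⟨MeasureTheory.integrable_and_integral_le ?_
    (fun ω => Finset.sum_nonneg fun _ _ => sq_nonneg _)
    (fun ω => M.sum_sub_sq_le (M.ctrl n ω).1 0) (by positivity) hint, fun hsum =>
    MeasureTheory.integrable_and_integral_le ?_
    (fun ω => Finset.sum_nonneg fun _ _ => sq_nonneg _) (fun ω => ?_) (by positivity) hint⟩
  · exact Finset.measurable_fun_sum _ fun k _ => (((hg k).sub (hg 0)).sub_const _).pow_const 2
  · exact Finset.measurable_fun_sum _ fun k _ => ((hg k).sub_const _).pow_const 2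
  -- With equal sums the centring constant vanishes, and the potential is the squared distance
  -- itself.
  · have h0 : M.meanGap = 0 := by
      rw [meanGap, Finset.sum_sub_distrib, hsum, sub_self, zero_div]
    have h1 : ∑ k, ((M.S n ω).g k - M.gstar k) ^ 2 = M.pot (M.ctrl n ω).1 := by
      simp only [pot, cen, h0, sub_zero]; rfl
    rw [h1]
    have := M.pot_nonneg (M.ctrl n ω).1
    nlinarith

end Model

end

end SemidiscreteOT

/-! ### The theorem. -/

theorem theorem2 (κ₁ κ₂ κ₃ κ₄ κ₅ κ₆ κ₇ κ₈ : ℝ) (hκ₁ : 0 < κ₁) (hκ₂ : 0 < κ₂) (hκ₃ : 0 < κ₃)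
    (hκ₄ : 0 < κ₄) (hκ₅ : 0 < κ₅) (hκ₆ : 0 < κ₆) (hκ₇ : 0 < κ₇) (hκ₈ : 0 < κ₈) :
    ∃ αbar : ℝ, 0 < αbar ∧ ∀ a α R : ℝ, 0 < a → 0 < α → 0 < R →
      ∃ C C' : ℝ, 0 < C ∧ 0 < C' ∧
        ∀ (K d : ℕ) [NeZero K] (ν : Measure (EuclideanSpace ℝ (Fin d)))
          (β : Fin K → EuclideanSpace ℝ (Fin d)) (gstar : Fin K → ℝ)
          (I : SemidiscreteOT.Inputs K d)
          (Ω : Type*) [MeasurableSpace Ω] (P : Measure Ω) [IsProbabilityMeasure P]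
          (X : ℕ → Ω → EuclideanSpace ℝ (Fin d)) (ε : ℕ → Ω → Fin K → ℝ),
          I.a = a → I.α = α →
          (∀ k, 0 ≤ I.p k) → ∑ k, I.p k = 1 →
          SemidiscreteOT.IsArgminRule I.sel →
          (∀ g, SemidiscreteOT.dualObjective ν β I.p g
            ≤ SemidiscreteOT.dualObjective ν β I.p gstar) →
          (∀ k, ‖β k‖ ≤ R) → (∀ k, ‖I.b₀ k‖ ≤ R) → (∀ k, |I.g₀ k - gstar k| ≤ R) →
          SemidiscreteOT.CostDifferencesAC ν β →
          SemidiscreteOT.MarginCondition ν β gstar κ₁ κ₂ κ₃ κ₄ κ₅ κ₆ →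
          SemidiscreteOT.MinEigenvalueCondition ν I.sel β gstar κ₈ →
          SemidiscreteOT.ObservationModel P ν X ε κ₇ →
          let S : ℕ → Ω → SemidiscreteOT.State K d := fun n ω =>
            SemidiscreteOT.run I β (fun m => X m ω) (fun m => ε m ω) n
          ∀ n : ℕ, 1 ≤ n →
            (Integrable (fun ω => ⨆ j, ‖(S n ω).bhat j - β j‖ ^ 2) P ∧
              ∫ ω, (⨆ j, ‖(S n ω).bhat j - β j‖ ^ 2) ∂P ≤ C / n) ∧
            (αbar < α →
              (Integrable (fun ω =>
                  ∑ k, (((S n ω).g k - (S n ω).g 0) - (gstar k - gstar 0)) ^ 2) P ∧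
                ∫ ω, (∑ k, (((S n ω).g k - (S n ω).g 0) - (gstar k - gstar 0)) ^ 2) ∂P
                  ≤ C' / n) ∧
              (∑ k, I.g₀ k = ∑ k, gstar k →
                Integrable (fun ω => ∑ k, ((S n ω).g k - gstar k) ^ 2) P ∧
                ∫ ω, (∑ k, ((S n ω).g k - gstar k) ^ 2) ∂P ≤ C' / n)) := by
  -- This value is `1 / rate`; it involves only the `κ`'s because `size` bounds the number of
  -- alternatives.
  refine ⟨8 * (1 + κ₆ ^ 2 / κ₈) / (κ₂ * κ₅), by positivity, fun a α R ha hα hR => ?_⟩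
  let c : SemidiscreteOT.Constants := ⟨κ₁, κ₂, κ₃, κ₄, κ₅, κ₆, κ₇, κ₈, a, α, R, hκ₁, hκ₂, hκ₃, hκ₄,
    hκ₅, hκ₆, hκ₇, hκ₈, ha, hα, hR⟩
  obtain ⟨C, hC, hb⟩ := SemidiscreteOT.Model.integral_iSup_norm_err_sq_le c
  have hc : 8 * (1 + κ₆ ^ 2 / κ₈) / (κ₂ * κ₅) < α → 1 ≤ c.α * c.rate := by
    intro h
    have h1 : c.rate = κ₂ * κ₅ / (8 * (1 + κ₆ ^ 2 / κ₈)) := rfl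
    rw [h1, ← mul_div_assoc, one_le_div (by positivity)]
    rw [div_lt_iff₀ (by positivity)] at h
    exact h.le
  obtain ⟨C', hC', hg⟩ : ∃ C' : ℝ, 0 < C' ∧ (8 * (1 + κ₆ ^ 2 / κ₈) / (κ₂ * κ₅) < α →
      ∀ M : SemidiscreteOT.Model c, ∀ n, 1 ≤ n →
      (Integrable (fun ω => ∑ k, (((M.S n ω).g k - (M.S n ω).g 0) -
          (M.gstar k - M.gstar 0)) ^ 2) M.P ∧
        ∫ ω, (∑ k, (((M.S n ω).g k - (M.S n ω).g 0) - (M.gstar k - M.gstar 0)) ^ 2) ∂M.P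
          ≤ C' / n) ∧
      (∑ k, M.I.g₀ k = ∑ k, M.gstar k →
        Integrable (fun ω => ∑ k, ((M.S n ω).g k - M.gstar k) ^ 2) M.P ∧
        ∫ ω, (∑ k, ((M.S n ω).g k - M.gstar k) ^ 2) ∂M.P ≤ C' / n)) := by
    by_cases h : 8 * (1 + κ₆ ^ 2 / κ₈) / (κ₂ * κ₅) < α
    · obtain ⟨C', hC', hg⟩ := SemidiscreteOT.Model.integral_sum_sq_le c (hc h)
      exact ⟨C', hC', fun _ => hg⟩
    -- For small `α` nothing is claimed about the dual vector, but a positive constant must still be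
    -- supplied.
    · exact ⟨1, one_pos, fun h' => absurd h' h⟩
  refine ⟨C, C', hC, hC', ?_⟩
  intro K d _ ν β gstar I Ω _ P _ X ε hIa hIα hp hp1 hsel hopt hβ hb₀ hg₀ _ hmargin heig hobs S n hn
  let M : SemidiscreteOT.Model c :=
    { K := K, d := d, neZero := inferInstance, ν := ν, β := β, gstar := gstar, I := I, Ω := Ω
      mΩ := inferInstance, P := P, prob := inferInstance, X := X, ε := ε, ha := hIa, hα := hIα
      p_nonneg := hp, p_sum := hp1, argmin := hsel, optimal := hopt, norm_β := hβ, norm_b₀ := hb₀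
      abs_g₀ := hg₀, margin := hmargin, eig := heig, obs := hobs }
  exact ⟨hb M n hn, fun h => hg h M n hn⟩
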